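/- Let $b\ge 2$ be an integer. Let $\mathscr{P}_b^*$ be the set of positive integers $n$ whose sequence of base-$b$ digits is a palindrome and which satisfy $(n,b^3-b)=1$ (such $n$ necessarily have an odd number of base-$b$ digits, since a palindrome with an even number of digits is divisible by $b+1$). For real $y$ and integers $a$ and $q\ge 1$ put $$\mathscr{P}_b^*(y)=\{n\in\mathscr{P}_b^* : n\le y\},\qquad \mathscr{P}_b^*(y,a,q)=\{n\in\mathscr{P}_b^*(y) : n\equiv a \pmod q\}.$$ Then for every $\epsilon>0$ there exist real numbers $\sigma=\sigma(b,\epsilon)>0$ and $C=C(b,\epsilon)>0$, depending only on $b$ and $\epsilon$, such that for every real $x\ge 1$, $$\sum_{\substack{1\le q\le x^{1/5-\epsilon}\\ (q,b^3-b)=1}}\ \sup_{y\le x}\ \max_{a\in\mathbb{Z}}\left|\#\mathscr{P}_b^*(y,a,q)-\frac{\#\mathscr{P}_b^*(y)}{q}\right|\ \le\ C\,\frac{\#\mathscr{P}_b^*(x)}{e^{\sigma\sqrt{\log x}}},$$ where $q$ runs over positive integers and $y$ over real numbers. -/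

import Mathlib

/-- The set of positive integers whose sequence of base-`b` digits is a palindrome and which are
coprime to `b ^ 3 - b`. (For `b ≥ 2` such an integer automatically has an odd number of base-`b`
digits, since every palindrome with an even number of digits is divisible by `b + 1`.) -/
def coprimePalindromes (b : ℕ) : Set ℕ :=
  {n | 0 < n ∧ (Nat.digits b n).Palindrome ∧ Nat.Coprime n (b ^ 3 - b)}

open Classical in
/-- The elements of `coprimePalindromes b` that are at most the real number `y`. -/
noncomputable def coprimePalindromesUpTo (b : ℕ) (y : ℝ) : Finset ℕ :=
  (Finset.Icc 1 ⌊y⌋₊).filter (fun n => n ∈ coprimePalindromes b)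

/-- The elements of `coprimePalindromes b` that are at most the real number `y` and
congruent to `a` modulo `q`. -/
noncomputable def coprimePalindromesInClass (b : ℕ) (y : ℝ) (a : ℤ) (q : ℕ) : Finset ℕ :=
  (coprimePalindromesUpTo b y).filter (fun n => (n : ℤ) ≡ a [ZMOD (q : ℤ)])

/-- The discrepancy of the palindromes coprime to `b ^ 3 - b`, up to `y`, in the residue class
of `a` modulo `q`. -/
noncomputable def palindromeDiscrepancy (b : ℕ) (y : ℝ) (a : ℤ) (q : ℕ) : ℝ :=
  |((coprimePalindromesInClass b y a q).card : ℝ) - ((coprimePalindromesUpTo b y).card : ℝ) / q|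

/-- The supremum, over all real `y ≤ x` and all integers `a`, of the discrepancy modulo `q`.
(These are suprema of bounded sets; see the two lemmas below.) -/
noncomputable def maxPalindromeDiscrepancy (b : ℕ) (x : ℝ) (q : ℕ) : ℝ :=
  ⨆ y : Set.Iic x, ⨆ a : ℤ, palindromeDiscrepancy b (y : ℝ) a q

open Classical in
theorem mem_coprimePalindromesUpTo {b : ℕ} {y : ℝ} {n : ℕ} :
    n ∈ coprimePalindromesUpTo b y ↔ n ∈ coprimePalindromes b ∧ (n : ℝ) ≤ y := by
  unfold coprimePalindromesUpTo
  rw [Finset.mem_filter, Finset.mem_Icc]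
  constructor
  · rintro ⟨⟨h1, h2⟩, h3⟩
    exact ⟨h3, (Nat.le_floor_iff' (by omega)).1 h2⟩
  · rintro ⟨h1, h2⟩
    have h0 : 0 < n := h1.1
    exact ⟨⟨h0, (Nat.le_floor_iff' h0.ne').2 h2⟩, h1⟩

theorem palindromeDiscrepancy_le_card (b : ℕ) (y : ℝ) (a : ℤ) (q : ℕ) :
    palindromeDiscrepancy b y a q ≤ ((coprimePalindromesUpTo b y).card : ℝ) := by
  have h1 : ((coprimePalindromesInClass b y a q).card : ℝ)
      ≤ ((coprimePalindromesUpTo b y).card : ℝ) := by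
    exact_mod_cast Finset.card_le_card (Finset.filter_subset _ _)
  have h2 : (0 : ℝ) ≤ ((coprimePalindromesInClass b y a q).card : ℝ) := Nat.cast_nonneg _
  have h3 : (0 : ℝ) ≤ ((coprimePalindromesUpTo b y).card : ℝ) / q := by positivity
  have h4 : ((coprimePalindromesUpTo b y).card : ℝ) / q
      ≤ ((coprimePalindromesUpTo b y).card : ℝ) := by
    rcases Nat.eq_zero_or_pos q with rfl | hq
    · simp
    · exact div_le_self (Nat.cast_nonneg _) (by exact_mod_cast hq)
  unfold palindromeDiscrepancy
  rw [abs_le]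
  constructor <;> linarith

theorem bddAbove_palindromeDiscrepancy (b : ℕ) (y : ℝ) (q : ℕ) :
    BddAbove (Set.range fun a : ℤ => palindromeDiscrepancy b y a q) := by
  refine ⟨((coprimePalindromesUpTo b y).card : ℝ), ?_⟩
  rintro _ ⟨a, rfl⟩
  exact palindromeDiscrepancy_le_card b y a q

theorem bddAbove_iSup_palindromeDiscrepancy (b : ℕ) (x : ℝ) (q : ℕ) :
    BddAbove (Set.range fun y : Set.Iic x =>
      ⨆ a : ℤ, palindromeDiscrepancy b (y : ℝ) a q) := by
  refine ⟨((coprimePalindromesUpTo b x).card : ℝ), ?_⟩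
  rintro _ ⟨y, rfl⟩
  refine ciSup_le fun a => (palindromeDiscrepancy_le_card b y a q).trans ?_
  have hsub : coprimePalindromesUpTo b (y : ℝ) ⊆ coprimePalindromesUpTo b x := by
    intro n hn
    rw [mem_coprimePalindromesUpTo] at hn ⊢
    exact ⟨hn.1, hn.2.trans y.2⟩
  exact_mod_cast Finset.card_le_card hsub

/-!
The discrepancy of the palindromes in residue classes is an average of exponential sums, and a
palindromic exponential sum is a product of sums over single digits.

*Reduction to products.* Orthogonality of characters modulo `q` and modulo `b ^ 3 - b` bounds the
discrepancy modulo `q` by exponential sums over palindromes at the frequencies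
`h / q + k / (b ^ 3 - b)` with `h ≠ 0` (`palindromeDiscrepancy_le_sum_norm`). Peeling off the outer
digits one pair at a time removes the cut-off `n ≤ y` and leaves complete sums over inner digits
(`norm_palindromeExpSum_le`), which are `palindromeProduct b r θ`, a product of `r` digit sums at the
frequencies `(b ^ i + b ^ (2 * r - i)) θ`. Since at least one outer digit has been removed, `θ` has
been multiplied by `b`, so that `k / (b ^ 3 - b)` has become a fraction with denominator `b ^ 2 - 1`.
Writing `h / q` in lowest terms costs a logarithm (`sum_fractions_le`). With `b ^ (2 * N)` of the size
of `x`, a lower bound `≫ b ^ N` for the number of palindromes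
(`pow_le_card_coprimePalindromesUpTo`) leaves the following claim: the sum `fareySum` of
`palindromeProduct b r`, `r ≤ N`, over the reduced fractions whose denominators have `K + 1` digits
is `O(b ^ (K + N) exp (-σ √N))`, uniformly for `K ≤ κ N + 1`, for any `κ < 2 / 5`
(`exists_fareySum_le`).

*Neighbouring digits.* A digit sum is close to its maximum `b` only if its frequency is close to an
integer. If that holds for the digits `i` and `i + 1`, then linear combinations of the two
frequencies show that `b ^ i (b ^ 2 - 1) θ` and `b ^ (2 * r - 1 - i) (b ^ 2 - 1) θ` are close to
integers (`norm_digitSum_mul_le`). The factor `b ^ 2 - 1` removes the shift by `k / (b ^ 2 - 1)` and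
permutes the reduced fractions with a given denominator, because the denominators are coprime to
`b ^ 3 - b`. That `b ^ j z` is close to an integer means that two consecutive digits of `z` agree.
Distinct fractions have distinct strings of `2 * K + 2` leading digits, so the fractions for which
the digits change rarely can be counted (`sum_fareyBlock_nearWeight_le`).

*Three ranges.* When `K` is less than a small multiple of `√N`, every window of `K + 1` digits
contains a change, as the fraction is not an integer, and `≫ √N` windows save a constant factor each
(`fareySum_le_small`). When `K` is less than a small multiple of `N`, there are many disjoint windows
of `2 * K + 1` digits, and the count of digit strings applies to each (`fareySum_le_medium`). When
`K` is of the order of `N`, the inner `T ≈ K / 2` digits of the palindrome constrain `2 * T ≈ K`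
digits of the fraction, which makes their product small outside an exceptional set of
`O(b ^ (c K))` fractions with some `c < 1`. Off that set the remaining digits are cut into two outer blocks of
`U ≈ (N - K / 2) / 2` digits, each of which is estimated in mean square by orthogonality modulo the
denominators and the divisor bound (`sum_fareyBlock_sq_prod_le`). This succeeds when `K < U`, that
is, when `K < 2 N / 5` (`fareySum_le_large`), and `b ^ (2 N / 5)` is `x ^ (1 / 5)`.
-/


/-! ### The divisor bound -/

/-- The divisor function is `O(n ^ δ)` for every `δ > 0`. -/
theorem exists_card_divisors_le (δ : ℝ) (hδ : 0 < δ) :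
    ∃ C : ℝ, 0 < C ∧ ∀ n : ℕ, n ≠ 0 → (n.divisors.card : ℝ) ≤ C * (n : ℝ) ^ δ := by
  set A : ℝ := max 1 (1 / (δ * Real.log 2)) with hA
  have hlog2 : 0 < Real.log 2 := Real.log_pos (by norm_num)
  have hA1 : 1 ≤ A := le_max_left _ _
  obtain ⟨P, hP⟩ := exists_nat_ge ((2 : ℝ) ^ (1 / δ))
  -- the loss at a small prime
  have hsmall : ∀ p a : ℕ, 2 ≤ p → ((a : ℝ) + 1) ≤ A * (p : ℝ) ^ (δ * a) := by
    intro p a hp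
    have h1 : (2 : ℝ) ^ (δ * a) ≤ (p : ℝ) ^ (δ * a) :=
      Real.rpow_le_rpow (by norm_num) (by exact_mod_cast hp) (by positivity)
    have h2 : 1 + δ * Real.log 2 * a ≤ (2 : ℝ) ^ (δ * a) := by
      rw [Real.rpow_def_of_pos (by norm_num)]
      have := Real.add_one_le_exp (Real.log 2 * (δ * a))
      linarith
    have h3 : (1 : ℝ) ≤ A * (δ * Real.log 2) := by
      have : 1 / (δ * Real.log 2) ≤ A := le_max_right _ _
      rwa [div_le_iff₀ (by positivity)] at this
    have ha : (0 : ℝ) ≤ a := Nat.cast_nonneg a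
    calc (a : ℝ) + 1 ≤ A * (1 + δ * Real.log 2 * a) := by nlinarith
      _ ≤ A * (p : ℝ) ^ (δ * a) := by
        apply mul_le_mul_of_nonneg_left (h2.trans h1); linarith
  -- no loss at a large prime
  have hlarge : ∀ p a : ℕ, P ≤ p → ((a : ℝ) + 1) ≤ (p : ℝ) ^ (δ * a) := by
    intro p a hp
    have h1 : (2 : ℝ) ≤ (p : ℝ) ^ δ := by
      have h2 : (2 : ℝ) ^ (1 / δ) ≤ p := hP.trans (by exact_mod_cast hp)
      calc (2 : ℝ) = ((2 : ℝ) ^ (1 / δ)) ^ δ := by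
            rw [← Real.rpow_mul (by norm_num), one_div_mul_cancel hδ.ne', Real.rpow_one]
        _ ≤ (p : ℝ) ^ δ := Real.rpow_le_rpow (by positivity) h2 hδ.le
    rw [Real.rpow_mul (Nat.cast_nonneg p), Real.rpow_natCast]
    calc (a : ℝ) + 1 ≤ 2 ^ a := by exact_mod_cast Nat.lt_two_pow_self
      _ ≤ _ := pow_le_pow_left₀ (by norm_num) h1 a
  refine ⟨A ^ P, by positivity, fun n hn => ?_⟩
  have hn2 : (n : ℝ) ^ δ = ∏ p ∈ n.primeFactors, (p : ℝ) ^ (δ * n.factorization p) := by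
    conv_lhs => rw [← Nat.prod_factorization_pow_eq_self hn]
    rw [Finsupp.prod, Nat.support_factorization, Nat.cast_prod,
      ← Real.finsetProd_rpow _ _ (fun i _ => by positivity)]
    refine Finset.prod_congr rfl fun p _ => ?_
    rw [Nat.cast_pow, ← Real.rpow_natCast, ← Real.rpow_mul (Nat.cast_nonneg p), mul_comm]
  have hprod : ∏ p ∈ n.primeFactors, (if p < P then A else 1) ≤ A ^ P := by
    rw [Finset.prod_ite, Finset.prod_const, Finset.prod_const_one, mul_one]
    refine pow_le_pow_right₀ hA1 ?_
    calc _ ≤ (Finset.range P).card := Finset.card_le_card fun p hp => by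
          simp only [Finset.mem_filter] at hp; exact Finset.mem_range.2 hp.2
      _ = P := Finset.card_range P
  rw [Nat.card_divisors hn, Nat.cast_prod, hn2]
  calc ∏ p ∈ n.primeFactors, ((n.factorization p + 1 : ℕ) : ℝ)
      ≤ ∏ p ∈ n.primeFactors, ((if p < P then A else 1) * (p : ℝ) ^ (δ * n.factorization p)) := by
        refine Finset.prod_le_prod (fun _ _ => by positivity) fun p hp => ?_
        push_cast
        split_ifs with h
        · exact hsmall p _ (Nat.prime_of_mem_primeFactors hp).two_le
        · rw [one_mul]; exact hlarge p _ (not_lt.1 h)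
    _ ≤ _ := by
        rw [Finset.prod_mul_distrib]
        exact mul_le_mul_of_nonneg_right hprod (Finset.prod_nonneg fun _ _ => by positivity)

/-! ### Additive characters and digit sums -/

/-- The additive character `x ↦ exp (2 π i x)`. -/
noncomputable def expChar (x : ℝ) : ℂ := Complex.exp ((2 * Real.pi * x : ℝ) * Complex.I)

theorem expChar_add (x y : ℝ) : expChar (x + y) = expChar x * expChar y := by
  unfold expChar
  rw [← Complex.exp_add]
  congr 1
  push_cast
  ring

theorem expChar_zero : expChar 0 = 1 := by simp [expChar]

theorem norm_expChar (x : ℝ) : ‖expChar x‖ = 1 := Complex.norm_exp_ofReal_mul_I _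

theorem expChar_int (n : ℤ) : expChar n = 1 := by
  unfold expChar
  rw [Complex.exp_eq_one_iff]
  exact ⟨n, by push_cast; ring⟩

theorem expChar_add_int (x : ℝ) (n : ℤ) : expChar (x + n) = expChar x := by
  rw [expChar_add, expChar_int, mul_one]

theorem expChar_nat_mul (n : ℕ) (x : ℝ) : expChar (n * x) = expChar x ^ n := by
  unfold expChar
  rw [← Complex.exp_nat_mul]
  congr 1
  push_cast
  ring

theorem conj_expChar (x : ℝ) : (starRingEnd ℂ) (expChar x) = expChar (-x) := by
  unfold expChar
  rw [← Complex.exp_conj, map_mul, Complex.conj_ofReal, Complex.conj_I]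
  congr 1
  push_cast
  ring

/-- Orthogonality of the additive characters modulo `q`. -/
theorem sum_expChar_div (q : ℕ) (hq : 0 < q) (m : ℤ) :
    ∑ h ∈ Finset.range q, expChar (h * m / q) = if (q : ℤ) ∣ m then (q : ℂ) else 0 := by
  have hq' : (q : ℝ) ≠ 0 := by positivity
  have key : ∀ h : ℕ, expChar (h * m / q) = expChar (m / q) ^ h := fun h => by
    rw [← expChar_nat_mul, mul_div_assoc]
  simp_rw [key]
  split_ifs with h
  · obtain ⟨k, rfl⟩ := h
    have : expChar (((q * k : ℤ) : ℝ) / q) = 1 := by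
      rw [show (((q * k : ℤ) : ℝ) / q) = ((k : ℤ) : ℝ) by push_cast; field_simp]
      exact expChar_int k
    rw [this]
    simp
  · have h1 : expChar (m / q) ≠ 1 := by
      intro h1
      unfold expChar at h1
      rw [Complex.exp_eq_one_iff] at h1
      obtain ⟨n, hn⟩ := h1
      have h2 : ((2 * Real.pi * (m / q) : ℝ) : ℂ) = ((n * (2 * Real.pi) : ℝ) : ℂ) := by
        have := mul_right_cancel₀ Complex.I_ne_zero
          (show ((2 * Real.pi * (m / q) : ℝ) : ℂ) * Complex.I
            = ((n * (2 * Real.pi) : ℝ) : ℂ) * Complex.I by rw [hn]; push_cast; ring)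
        exact this
      have h3 := Complex.ofReal_injective h2
      have h4 : (m : ℝ) = q * n := by
        have hpi := Real.pi_pos
        field_simp at h3
        linarith
      exact h ⟨n, by exact_mod_cast h4⟩
    rw [geom_sum_eq h1, ← expChar_nat_mul,
      show ((q : ℕ) : ℝ) * ((m : ℝ) / q) = ((m : ℤ) : ℝ) by field_simp, expChar_int]
    simp

/-- The exponential sum over one base-`b` digit. -/
noncomputable def digitSum (b : ℕ) (x : ℝ) : ℂ := ∑ d ∈ Finset.range b, expChar (d * x)

theorem norm_digitSum_le (b : ℕ) (x : ℝ) : ‖digitSum b x‖ ≤ b := by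
  refine (norm_sum_le _ _).trans ?_
  simp [norm_expChar]

theorem digitSum_add_int (b : ℕ) (x : ℝ) (n : ℤ) : digitSum b (x + n) = digitSum b x := by
  refine Finset.sum_congr rfl fun d _ => ?_
  rw [show (d : ℝ) * (x + n) = d * x + ((d * n : ℤ) : ℝ) by push_cast; ring, expChar_add_int]

/-- `x` lies within `ρ` of an integer. -/
def NearInt (ρ x : ℝ) : Prop := ∃ n : ℤ, |x - n| < ρ

theorem norm_one_add_expChar_le {ρ x : ℝ} (hρ : 0 < ρ) (hx : ¬ NearInt ρ x) :
    ‖1 + expChar x‖ ≤ Real.sqrt (2 + 2 * Real.cos (2 * Real.pi * ρ)) := by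
  have hpi := Real.pi_pos
  apply Real.le_sqrt_of_sq_le
  have h1 : ‖1 + expChar x‖ ^ 2 = 2 + 2 * Real.cos (2 * Real.pi * x) := by
    unfold expChar
    rw [← Complex.normSq_eq_norm_sq, Complex.exp_mul_I, Complex.normSq_apply]
    simp only [Complex.add_re, Complex.add_im, Complex.mul_re, Complex.mul_im, Complex.I_re,
      Complex.I_im, Complex.one_re, Complex.one_im, ← Complex.ofReal_cos, ← Complex.ofReal_sin,
      Complex.ofReal_re, Complex.ofReal_im]
    nlinarith [Real.sin_sq_add_cos_sq (2 * Real.pi * x)]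
  have h2 : ρ ≤ |x - round x| := not_lt.1 fun h => hx ⟨round x, h⟩
  have h3 : |x - round x| ≤ 1 / 2 := abs_sub_round x
  have h4 : Real.cos (2 * Real.pi * x) = Real.cos (2 * Real.pi * |x - round x|) := by
    rw [← Real.cos_sub_int_mul_two_pi (2 * Real.pi * x) (round x),
      ← Real.cos_abs (2 * Real.pi * x - _)]
    rw [show 2 * Real.pi * x - round x * (2 * Real.pi) = 2 * Real.pi * (x - round x) by ring,
      abs_mul, abs_of_pos (by positivity : 0 < 2 * Real.pi)]
  rw [h1, h4]
  have h5 : Real.cos (2 * Real.pi * |x - round x|) ≤ Real.cos (2 * Real.pi * ρ) :=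
    Real.cos_le_cos_of_nonneg_of_le_pi (by positivity) (by nlinarith) (by nlinarith)
  linarith

/-- Away from the integers, the sum over one digit saves a constant factor, written `μ ^ 2`
for later use. -/
theorem exists_norm_digitSum_le (b : ℕ) (hb : 2 ≤ b) (ρ : ℝ) (hρ : 0 < ρ) (hρ2 : ρ ≤ 1 / 2) :
    ∃ μ : ℝ, 0 < μ ∧ μ < 1 ∧ ∀ x : ℝ, ¬ NearInt ρ x → ‖digitSum b x‖ ≤ b * μ ^ 2 := by
  have hpi := Real.pi_pos
  set m := Real.sqrt (2 + 2 * Real.cos (2 * Real.pi * ρ)) with hm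
  have hm2 : m < 2 := by
    rw [hm, Real.sqrt_lt' (by norm_num)]
    have : Real.cos (2 * Real.pi * ρ) < Real.cos 0 :=
      Real.cos_lt_cos_of_nonneg_of_le_pi le_rfl (by nlinarith) (by positivity)
    rw [Real.cos_zero] at this
    linarith
  have hm0 : 0 ≤ m := Real.sqrt_nonneg _
  have hb' : (2 : ℝ) ≤ b := by exact_mod_cast hb
  set t : ℝ := max ((b - 2 + m) / b) (1 / 2) with ht
  have ht0 : 0 < t := lt_of_lt_of_le (by norm_num) (le_max_right _ _)
  have ht1 : t < 1 := by
    refine max_lt ?_ (by norm_num)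
    rw [div_lt_one (by linarith)]
    linarith
  refine ⟨Real.sqrt t, Real.sqrt_pos.2 ht0, by rw [Real.sqrt_lt' one_pos]; simpa, fun x hx => ?_⟩
  rw [Real.sq_sqrt ht0.le]
  have h1 : digitSum b x = (1 + expChar x) + ∑ d ∈ Finset.Ico 2 b, expChar (d * x) := by
    unfold digitSum
    rw [← Finset.sum_range_add_sum_Ico _ hb]
    simp [Finset.sum_range_succ, expChar_zero]
  have h2 : ‖∑ d ∈ Finset.Ico 2 b, expChar (d * x)‖ ≤ b - 2 := by
    refine (norm_sum_le _ _).trans ?_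
    simp [norm_expChar, Nat.cast_sub hb]
  calc ‖digitSum b x‖ ≤ ‖1 + expChar x‖ + ‖∑ d ∈ Finset.Ico 2 b, expChar (d * x)‖ := by
        rw [h1]; exact norm_add_le _ _
    _ ≤ m + (b - 2) := add_le_add (norm_one_add_expChar_le hρ hx) h2
    _ = b * ((b - 2 + m) / b) := by field_simp; ring
    _ ≤ b * t := by gcongr; exact le_max_left _ _

/-! ### Palindromes with an odd number of digits -/

/-- The nonnegative integers whose base-`b` expansion, padded with zeros to `2 * R + 1` digits, is
a palindrome. Peeling off the two outer digits gives the recursion. -/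
def paddedPalindromes (b : ℕ) : ℕ → Finset ℕ
  | 0 => Finset.range b
  | R + 1 => (Finset.range b ×ˢ paddedPalindromes b R).image
      fun p => p.1 * (1 + b ^ (2 * R + 2)) + b * p.2

theorem paddedPalindromes_lt {b : ℕ} {R n : ℕ} (hn : n ∈ paddedPalindromes b R) :
    n < b ^ (2 * R + 1) := by
  induction R generalizing n with
  | zero => simpa [paddedPalindromes] using hn
  | succ R ih =>
    simp only [paddedPalindromes, Finset.mem_image, Finset.mem_product, Finset.mem_range,
      Prod.exists] at hn
    obtain ⟨d, m, ⟨hd, hm⟩, rfl⟩ := hn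
    have h1 := ih hm
    calc d * (1 + b ^ (2 * R + 2)) + b * m
        < b * (m + 1) + d * b ^ (2 * R + 2) := by nlinarith
      _ ≤ b * b ^ (2 * R + 1) + d * b ^ (2 * R + 2) := by gcongr; omega
      _ = (d + 1) * b ^ (2 * R + 2) := by ring
      _ ≤ b * b ^ (2 * R + 2) := by gcongr; omega
      _ = b ^ (2 * (R + 1) + 1) := by ring

theorem peel_injective {b R d d' m m' : ℕ} (hd : d < b) (hd' : d' < b)
    (h : d * (1 + b ^ (2 * R + 2)) + b * m = d' * (1 + b ^ (2 * R + 2)) + b * m') :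
    d = d' ∧ m = m' := by
  have hb : 0 < b := by omega
  have e : ∀ d m : ℕ, d * (1 + b ^ (2 * R + 2)) + b * m = d + b * (d * b ^ (2 * R + 1) + m) :=
    fun d m => by ring
  have h1 : d = d' := by
    have := congrArg (· % b) h
    simpa [e, Nat.add_mul_mod_self_left, Nat.mod_eq_of_lt hd, Nat.mod_eq_of_lt hd'] using this
  subst h1
  exact ⟨rfl, Nat.eq_of_mul_eq_mul_left hb (by omega)⟩

theorem sum_paddedPalindromes_succ {α : Type*} [AddCommMonoid α] (b R : ℕ) (f : ℕ → α) :
    ∑ n ∈ paddedPalindromes b (R + 1), f n =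
      ∑ d ∈ Finset.range b, ∑ m ∈ paddedPalindromes b R,
        f (d * (1 + b ^ (2 * R + 2)) + b * m) := by
  rw [paddedPalindromes, Finset.sum_image, Finset.sum_product]
  rintro ⟨d, m⟩ h1 ⟨d', m'⟩ h2 h3
  simp only [Finset.coe_product, Set.mem_prod, Finset.mem_coe, Finset.mem_range] at h1 h2
  obtain ⟨rfl, rfl⟩ := peel_injective h1.1 h2.1 h3
  rfl

theorem mem_paddedPalindromes_succ {b R d m : ℕ} (hd : d < b) (hm : m ∈ paddedPalindromes b R) :
    d * (1 + b ^ (2 * R + 2)) + b * m ∈ paddedPalindromes b (R + 1) := by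
  simp only [paddedPalindromes, Finset.mem_image, Finset.mem_product, Finset.mem_range,
    Prod.exists]
  exact ⟨d, m, ⟨hd, hm⟩, rfl⟩

theorem ofDigits_palindrome {b : ℕ} {l : List ℕ} (hl : l.Palindrome) (hlt : ∀ x ∈ l, x < b) :
    (∃ M, l.length = 2 * M + 1 ∧ Nat.ofDigits b l ∈ paddedPalindromes b M) ∨
      (∃ M, l.length = 2 * M ∧ b + 1 ∣ Nat.ofDigits b l) := by
  induction hl with
  | nil => exact Or.inr ⟨0, by simp⟩
  | singleton x =>
    refine Or.inl ⟨0, by simp, ?_⟩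
    simpa [paddedPalindromes, Nat.ofDigits_singleton] using hlt x (by simp)
  | @cons_concat x l hl ih =>
    have hx : x < b := hlt x (by simp)
    have e : Nat.ofDigits b (x :: (l ++ [x]))
        = x * (1 + b ^ (l.length + 1)) + b * Nat.ofDigits b l := by
      rw [Nat.ofDigits_cons, Nat.ofDigits_append, Nat.ofDigits_singleton]
      ring
    rcases ih fun y hy => hlt y (by simp [hy]) with ⟨M, h1, h2⟩ | ⟨M, h1, h2⟩
    · refine Or.inl ⟨M + 1, by simp [h1]; ring, ?_⟩
      rw [e, h1]
      exact mem_paddedPalindromes_succ hx h2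
    · refine Or.inr ⟨M + 1, by simp [h1]; ring, ?_⟩
      rw [e, h1]
      refine dvd_add (Dvd.dvd.mul_left ?_ _) (Dvd.dvd.mul_left h2 _)
      have := Odd.nat_add_dvd_pow_add_pow b 1 (n := 2 * M + 1) ⟨M, rfl⟩
      rwa [one_pow, add_comm (b ^ _)] at this

theorem exists_palindrome_of_mem {b R n : ℕ} (hn : n ∈ paddedPalindromes b R) :
    ∃ l : List ℕ, l.Palindrome ∧ l.length = 2 * R + 1 ∧ (∀ x ∈ l, x < b) ∧
      Nat.ofDigits b l = n := by
  induction R generalizing n with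
  | zero =>
    refine ⟨[n], .singleton n, rfl, ?_, Nat.ofDigits_singleton⟩
    simpa [paddedPalindromes] using hn
  | succ R ih =>
    simp only [paddedPalindromes, Finset.mem_image, Finset.mem_product, Finset.mem_range,
      Prod.exists] at hn
    obtain ⟨d, m, ⟨hd, hm⟩, rfl⟩ := hn
    obtain ⟨l, h1, h2, h3, h4⟩ := ih hm
    refine ⟨d :: (l ++ [d]), .cons_concat d h1, by simp [h2]; ring, ?_, ?_⟩
    · intro x hx
      simp only [List.mem_cons, List.mem_append, List.not_mem_nil, or_false] at hx
      rcases hx with rfl | hx | rfl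
      exacts [hd, h3 x hx, hd]
    · rw [Nat.ofDigits_cons, Nat.ofDigits_append, Nat.ofDigits_singleton, h4, h2]
      ring

theorem dvd_cube_sub (b : ℕ) : b ∣ b ^ 3 - b := ⟨b ^ 2 - 1, by
  rw [Nat.mul_sub, mul_one, pow_succ' b 2]⟩

theorem cube_sub_eq (b : ℕ) : b ^ 3 - b = b * (b ^ 2 - 1) := by
  rw [Nat.mul_sub, mul_one, pow_succ' b 2]

theorem succ_dvd_cube_sub (b : ℕ) : b + 1 ∣ b ^ 3 - b := by
  rw [cube_sub_eq, ← one_pow 2, Nat.sq_sub_sq, one_pow]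
  exact Dvd.dvd.mul_left (Dvd.intro _ rfl) _

theorem mod_ne_zero_of_coprime {b n : ℕ} (hb : 2 ≤ b) (hn : Nat.Coprime n (b ^ 3 - b)) :
    n % b ≠ 0 := by
  intro h
  have := Nat.dvd_gcd (Nat.dvd_of_mod_eq_zero h) (dvd_cube_sub b)
  rw [hn] at this
  have := Nat.le_of_dvd one_pos this
  omega

/-- A palindrome with an even number of digits is divisible by `b + 1`, so coprimality to
`b ^ 3 - b` leaves only the odd lengths, and it makes the outer digits nonzero. -/
theorem mem_coprimePalindromes_iff {b n : ℕ} (hb : 2 ≤ b) :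
    n ∈ coprimePalindromes b ↔
      ∃ M, n ∈ paddedPalindromes b M ∧ Nat.Coprime n (b ^ 3 - b) := by
  constructor
  · rintro ⟨h0, h1, h2⟩
    rcases ofDigits_palindrome h1 fun x hx => Nat.digits_lt_base hb hx with
      ⟨M, h3, h4⟩ | ⟨M, h3, h4⟩
    · rw [Nat.ofDigits_digits] at h4
      exact ⟨M, h4, h2⟩
    · exfalso
      rw [Nat.ofDigits_digits] at h4
      have := Nat.dvd_gcd h4 (succ_dvd_cube_sub b)
      rw [h2] at this
      have := Nat.le_of_dvd one_pos this
      omega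
  · rintro ⟨M, h1, h2⟩
    have hmod := mod_ne_zero_of_coprime hb h2
    refine ⟨Nat.pos_of_ne_zero fun h => hmod (by simp [h]), ?_, h2⟩
    obtain ⟨l, h3, h4, h5, h6⟩ := exists_palindrome_of_mem h1
    have hne : l ≠ [] := by rintro rfl; simp at h4
    have hlast : ∀ h : l ≠ [], l.getLast h ≠ 0 := by
      intro h h7
      -- the last digit is the first one, and that is `n % b`
      have h8 : l.head h = l.getLast h := by
        have := h3.reverse_eq
        rw [← List.head_reverse (by simpa using h)]
        simp only [this]
      obtain ⟨a, l', rfl⟩ := List.exists_cons_of_ne_nil hne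
      rw [h7] at h8
      simp only [List.head_cons] at h8
      apply hmod
      rw [← h6, Nat.ofDigits_cons, h8]
      simp
    have := Nat.digits_ofDigits b hb l h5 hlast
    rw [← h6, this]
    exact h3

theorem le_of_mem_paddedPalindromes {b M n : ℕ} (hb : 2 ≤ b) (hn : n ∈ paddedPalindromes b M)
    (hc : Nat.Coprime n (b ^ 3 - b)) : b ^ (2 * M) ≤ n := by
  have hmod := mod_ne_zero_of_coprime hb hc
  cases M with
  | zero =>
    rw [mul_zero, pow_zero]
    exact Nat.pos_of_ne_zero fun h => hmod (by simp [h])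
  | succ R =>
    simp only [paddedPalindromes, Finset.mem_image, Finset.mem_product, Finset.mem_range,
      Prod.exists] at hn
    obtain ⟨d, m, ⟨hd, hm⟩, rfl⟩ := hn
    have hd0 : 1 ≤ d := by
      by_contra h
      have : d = 0 := by omega
      apply hmod
      simp [this]
    calc b ^ (2 * (R + 1)) = 1 * b ^ (2 * R + 2) := by ring
      _ ≤ d * b ^ (2 * R + 2) := by gcongr
      _ ≤ _ := by nlinarith [Nat.zero_le (b * m)]

theorem sum_coprimePalindromesUpTo {α : Type*} [AddCommMonoid α] {b N : ℕ} (hb : 2 ≤ b) {y : ℝ}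
    (hy : y < (b : ℝ) ^ (2 * N + 2)) (f : ℕ → α) :
    ∑ n ∈ coprimePalindromesUpTo b y, f n =
      ∑ M ∈ Finset.range (N + 1), ∑ n ∈ (paddedPalindromes b M).filter
        (fun n => n ≤ ⌊y⌋₊ ∧ Nat.Coprime n (b ^ 3 - b)), f n := by
  rw [← Finset.sum_biUnion]
  · refine Finset.sum_congr ?_ fun _ _ => rfl
    ext n
    simp only [mem_coprimePalindromesUpTo, mem_coprimePalindromes_iff hb, Finset.mem_biUnion,
      Finset.mem_range, Finset.mem_filter]
    constructor
    · rintro ⟨⟨M, h1, h2⟩, h3⟩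
      refine ⟨M, ?_, h1, Nat.le_floor h3, h2⟩
      have h4 := le_of_mem_paddedPalindromes hb h1 h2
      have h5 : b ^ (2 * M) < b ^ (2 * N + 2) := by
        have : ((b ^ (2 * M) : ℕ) : ℝ) < ((b ^ (2 * N + 2) : ℕ) : ℝ) := by
          push_cast
          calc ((b : ℝ) ^ (2 * M)) ≤ n := by exact_mod_cast h4
            _ < _ := h3.trans_lt hy
        exact_mod_cast this
      have := (Nat.pow_lt_pow_iff_right (by omega : 1 < b)).1 h5
      omega
    · rintro ⟨M, hM, h1, h2, h3⟩
      refine ⟨⟨M, h1, h3⟩, ?_⟩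
      have hn0 : n ≠ 0 := by
        rintro rfl
        exact mod_ne_zero_of_coprime hb h3 (by simp)
      exact (Nat.le_floor_iff' hn0).1 h2
  · intro M _ M' _ hne
    rw [Function.onFun, Finset.disjoint_left]
    intro n h1 h2
    rw [Finset.mem_filter] at h1 h2
    have a1 := le_of_mem_paddedPalindromes hb h1.1 h1.2.2
    have a2 := le_of_mem_paddedPalindromes hb h2.1 h2.2.2
    have a3 := paddedPalindromes_lt h1.1
    have a4 := paddedPalindromes_lt h2.1
    have a5 := (Nat.pow_lt_pow_iff_right (by omega : 1 < b)).1 (a1.trans_lt a4)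
    have a6 := (Nat.pow_lt_pow_iff_right (by omega : 1 < b)).1 (a2.trans_lt a3)
    omega

/-! ### Exponential sums over palindromes -/

/-- The product of the exponential sums over the `r` digits off the centre of a padded palindrome
with `2 * r + 1` digits. -/
noncomputable def palindromeProduct (b r : ℕ) (θ : ℝ) : ℝ :=
  ∏ i ∈ Finset.range r, ‖digitSum b (((b : ℝ) ^ i + (b : ℝ) ^ (2 * r - i)) * θ)‖

theorem palindromeProduct_nonneg (b r : ℕ) (θ : ℝ) : 0 ≤ palindromeProduct b r θ :=
  Finset.prod_nonneg fun _ _ => norm_nonneg _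

theorem palindromeProduct_zero (b : ℕ) (θ : ℝ) : palindromeProduct b 0 θ = 1 := by
  simp [palindromeProduct]

theorem palindromeProduct_succ (b r : ℕ) (θ : ℝ) : palindromeProduct b (r + 1) θ =
    ‖digitSum b ((1 + (b : ℝ) ^ (2 * r + 2)) * θ)‖ * palindromeProduct b r (b * θ) := by
  unfold palindromeProduct
  rw [Finset.prod_range_succ', mul_comm]
  congr 1
  refine Finset.prod_congr rfl fun i hi => ?_
  have hi' := Finset.mem_range.1 hi
  rw [show 2 * (r + 1) - (i + 1) = (2 * r - i) + 1 by omega]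
  congr 2
  ring

theorem palindromeProduct_add_int (b r : ℕ) (θ : ℝ) (n : ℤ) :
    palindromeProduct b r (θ + n) = palindromeProduct b r θ := by
  refine Finset.prod_congr rfl fun i _ => ?_
  rw [← digitSum_add_int b (((b : ℝ) ^ i + (b : ℝ) ^ (2 * r - i)) * θ)
    (((b : ℤ) ^ i + (b : ℤ) ^ (2 * r - i)) * n)]
  congr 2
  push_cast
  ring

/-- The exponential sum over the padded palindromes that are at most `y`. -/
noncomputable def palindromeExpSum (b R y : ℕ) (θ : ℝ) : ℂ :=
  ∑ n ∈ (paddedPalindromes b R).filter (· ≤ y), expChar (n * θ)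

theorem norm_sum_expChar_paddedPalindromes_le (b R : ℕ) (θ : ℝ) :
    ‖∑ n ∈ paddedPalindromes b R, expChar (n * θ)‖ ≤ b * palindromeProduct b R θ := by
  induction R generalizing θ with
  | zero =>
    rw [palindromeProduct_zero, mul_one]
    exact norm_digitSum_le b θ
  | succ R ih =>
    have e : ∑ n ∈ paddedPalindromes b (R + 1), expChar (n * θ)
        = digitSum b ((1 + (b : ℝ) ^ (2 * R + 2)) * θ) *
          ∑ m ∈ paddedPalindromes b R, expChar (m * (b * θ)) := by
      rw [sum_paddedPalindromes_succ, digitSum, Finset.sum_mul]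
      refine Finset.sum_congr rfl fun d _ => ?_
      rw [Finset.mul_sum]
      refine Finset.sum_congr rfl fun m _ => ?_
      rw [← expChar_add]
      congr 1
      push_cast
      ring
    rw [e, norm_mul, palindromeProduct_succ]
    calc _ ≤ ‖digitSum b ((1 + (b : ℝ) ^ (2 * R + 2)) * θ)‖ *
          (b * palindromeProduct b R (b * θ)) := by gcongr; exact ih _
      _ = _ := by ring

/-- Splitting at the first digit in which a palindrome falls below `y` reduces the sum over the
palindromes up to `y` to complete sums over the inner digits, uniformly in `y`. -/
theorem norm_palindromeExpSum_le (b : ℕ) (hb : 2 ≤ b) (R y : ℕ) (θ : ℝ) :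
    ‖palindromeExpSum b R y θ‖ ≤
      b ^ 2 * (1 + ∑ r ∈ Finset.range R, palindromeProduct b r (b ^ (R - r) * θ)) := by
  have hb' : (2 : ℝ) ≤ b := by exact_mod_cast hb
  induction R generalizing y θ with
  | zero =>
    simp only [Finset.range_zero, Finset.sum_empty, add_zero, mul_one]
    refine (norm_sum_le _ _).trans ?_
    simp only [norm_expChar, Finset.sum_const, nsmul_eq_mul, mul_one]
    calc _ ≤ ((paddedPalindromes b 0).card : ℝ) := by
          exact_mod_cast Finset.card_filter_le _ _
      _ = b := by simp [paddedPalindromes]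
      _ ≤ _ := by nlinarith
  | succ R ih =>
    set t := y / b ^ (2 * R + 2) with ht
    have hpow : 0 < b ^ (2 * R + 2) := by positivity
    set U : ℝ := b * palindromeProduct b R (b * θ) with hU
    have hU0 : 0 ≤ U := by have := palindromeProduct_nonneg b R (b * θ); positivity
    set V : ℝ := b ^ 2 * (1 + ∑ r ∈ Finset.range R, palindromeProduct b r (b ^ (R - r) * (b * θ)))
      with hV
    have hV0 : 0 ≤ V := by
      have : 0 ≤ ∑ r ∈ Finset.range R, palindromeProduct b r (b ^ (R - r) * (b * θ)) :=
        Finset.sum_nonneg fun _ _ => palindromeProduct_nonneg _ _ _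
      positivity
    have e : palindromeExpSum b (R + 1) y θ = ∑ d ∈ Finset.range b,
        expChar (d * ((1 + (b : ℝ) ^ (2 * R + 2)) * θ)) *
          ∑ m ∈ (paddedPalindromes b R).filter
            (fun m => d * (1 + b ^ (2 * R + 2)) + b * m ≤ y), expChar (m * (b * θ)) := by
      rw [palindromeExpSum, Finset.sum_filter, sum_paddedPalindromes_succ]
      refine Finset.sum_congr rfl fun d _ => ?_
      rw [Finset.mul_sum, Finset.sum_filter]
      refine Finset.sum_congr rfl fun m _ => ?_
      split_ifs
      · rw [← expChar_add]
        congr 1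
        push_cast
        ring
      · rfl
    have hterm : ∀ d ∈ Finset.range b, ‖expChar (d * ((1 + (b : ℝ) ^ (2 * R + 2)) * θ)) *
          ∑ m ∈ (paddedPalindromes b R).filter
            (fun m => d * (1 + b ^ (2 * R + 2)) + b * m ≤ y), expChar (m * (b * θ))‖
          ≤ U + if d = t then V else 0 := by
      intro d hd
      have hd' := Finset.mem_range.1 hd
      rw [norm_mul, norm_expChar, one_mul]
      rcases lt_trichotomy d t with h | h | h
      · rw [if_neg h.ne, add_zero, Finset.filter_true_of_mem]
        · exact norm_sum_expChar_paddedPalindromes_le b R _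
        · intro m hm
          have h1 := paddedPalindromes_lt hm
          calc d * (1 + b ^ (2 * R + 2)) + b * m
              ≤ b * (m + 1) + d * b ^ (2 * R + 2) := by nlinarith
            _ ≤ b * b ^ (2 * R + 1) + d * b ^ (2 * R + 2) := by gcongr; omega
            _ = (d + 1) * b ^ (2 * R + 2) := by ring
            _ ≤ t * b ^ (2 * R + 2) := by gcongr; omega
            _ ≤ y := Nat.div_mul_le_self _ _
      · rw [if_pos h]
        refine le_trans ?_ (le_add_of_nonneg_left hU0)
        by_cases h2 : d * (1 + b ^ (2 * R + 2)) ≤ y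
        · have e2 : (paddedPalindromes b R).filter
              (fun m => d * (1 + b ^ (2 * R + 2)) + b * m ≤ y)
              = (paddedPalindromes b R).filter
                (· ≤ (y - d * (1 + b ^ (2 * R + 2))) / b) := by
            refine Finset.filter_congr fun m _ => ?_
            rw [Nat.le_div_iff_mul_le (by omega), mul_comm m b]
            omega
          rw [e2]
          exact ih _ _
        · rw [Finset.filter_false_of_mem]
          · simpa using hV0
          · intro m _
            omega
      · rw [if_neg h.ne', add_zero, Finset.filter_false_of_mem]
        · simpa using hU0
        · intro m _ h3
          have h4 : (t + 1) * b ^ (2 * R + 2) ≤ y := by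
            calc (t + 1) * b ^ (2 * R + 2) ≤ d * b ^ (2 * R + 2) := by gcongr; omega
              _ ≤ d * (1 + b ^ (2 * R + 2)) + b * m := by nlinarith [Nat.zero_le (b * m)]
              _ ≤ y := h3
          have := (Nat.le_div_iff_mul_le hpow).2 h4
          omega
    have hsplit : ∑ r ∈ Finset.range (R + 1), palindromeProduct b r (b ^ (R + 1 - r) * θ)
        = ∑ r ∈ Finset.range R, palindromeProduct b r (b ^ (R - r) * (b * θ))
          + palindromeProduct b R (b * θ) := by
      rw [Finset.sum_range_succ]
      congr 1
      · refine Finset.sum_congr rfl fun r hr => ?_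
        have := Finset.mem_range.1 hr
        rw [show R + 1 - r = (R - r) + 1 by omega, pow_succ, mul_assoc]
      · rw [show R + 1 - R = 1 by omega, pow_one]
    calc ‖palindromeExpSum b (R + 1) y θ‖ ≤ ∑ d ∈ Finset.range b, (U + if d = t then V else 0) := by
          rw [e]; exact norm_sum_le_of_le _ hterm
      _ = b * U + ∑ d ∈ Finset.range b, (if d = t then V else 0) := by
          rw [Finset.sum_add_distrib]; simp
      _ ≤ b * U + V := by
          gcongr
          rw [Finset.sum_ite_eq']
          split_ifs
          exacts [le_rfl, hV0]
      _ = _ := by rw [hsplit, hU, hV]; ring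

/-! ### Fractions near which many digit sums are large -/

/-- The reduced fractions `h / d`, as pairs `(d, h)`, whose denominator `d > 1` is coprime to
`b ^ 3 - b` and has exactly `K + 1` digits in base `b`. -/
def fareyBlock (b K : ℕ) : Finset (ℕ × ℕ) :=
  (Finset.Ico (b ^ K) (b ^ (K + 1)) ×ˢ Finset.range (b ^ (K + 1))).filter
    fun p => 1 < p.1 ∧ p.1.Coprime (b ^ 3 - b) ∧ p.2 < p.1 ∧ p.2.Coprime p.1

theorem mem_fareyBlock {b K : ℕ} {p : ℕ × ℕ} : p ∈ fareyBlock b K ↔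
    b ^ K ≤ p.1 ∧ p.1 < b ^ (K + 1) ∧ 1 < p.1 ∧ p.1.Coprime (b ^ 3 - b) ∧ p.2 < p.1 ∧
      p.2.Coprime p.1 := by
  simp only [fareyBlock, Finset.mem_filter, Finset.mem_product, Finset.mem_Ico, Finset.mem_range]
  constructor
  · tauto
  · rintro ⟨h1, h2, h3, h4, h5, h6⟩
    exact ⟨⟨⟨h1, h2⟩, h5.trans h2⟩, h3, h4, h5, h6⟩

theorem card_fareyBlock_le (b K : ℕ) : (fareyBlock b K).card ≤ b ^ (2 * K + 2) := by
  refine (Finset.card_filter_le _ _).trans ?_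
  rw [Finset.card_product, Nat.card_Ico, Finset.card_range]
  calc _ ≤ b ^ (K + 1) * b ^ (K + 1) := Nat.mul_le_mul_right _ (Nat.sub_le _ _)
    _ = _ := by ring

theorem NearInt.of_sub_int {ρ x : ℝ} (n : ℤ) (h : NearInt ρ (x - n)) : NearInt ρ x := by
  obtain ⟨m, hm⟩ := h
  exact ⟨m + n, by rw [Int.cast_add]; convert hm using 2; ring⟩

theorem nearInt_add_int {ρ x : ℝ} (n : ℤ) : NearInt ρ (x + n) ↔ NearInt ρ x := by
  constructor
  · intro h
    apply NearInt.of_sub_int (-n)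
    push_cast
    simpa using h
  · intro h
    apply NearInt.of_sub_int n
    simpa using h

theorem NearInt.mul_sub {ρ ρ' x y : ℝ} (b : ℕ) (hx : NearInt ρ x) (hy : NearInt ρ y)
    (h : (b + 1) * ρ ≤ ρ') : NearInt ρ' (b * x - y) := by
  obtain ⟨m, hm⟩ := hx
  obtain ⟨n, hn⟩ := hy
  refine ⟨b * m - n, ?_⟩
  push_cast
  have hb : (0 : ℝ) ≤ b := Nat.cast_nonneg b
  calc |b * x - y - (b * m - n)| = |b * (x - m) + -(y - n)| := by congr 1; ring
    _ ≤ |b * (x - m)| + |-(y - n)| := abs_add_le _ _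
    _ = b * |x - m| + |y - n| := by rw [abs_mul, abs_of_nonneg hb, abs_neg]
    _ < b * ρ + ρ := by nlinarith
    _ ≤ ρ' := by linarith

open Classical in
/-- Weight `1` at the reals within `1 / b ^ 2` of an integer and weight `μ` elsewhere. -/
noncomputable def nearWeight (b : ℕ) (μ x : ℝ) : ℝ :=
  if NearInt (1 / (b : ℝ) ^ 2) x then 1 else μ

theorem nearWeight_add_int (b : ℕ) (μ x : ℝ) (n : ℤ) :
    nearWeight b μ (x + n) = nearWeight b μ x := by
  unfold nearWeight
  by_cases h : NearInt (1 / (b : ℝ) ^ 2) x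
  · rw [if_pos h, if_pos ((nearInt_add_int n).2 h)]
  · rw [if_neg h, if_neg (mt (nearInt_add_int n).1 h)]

theorem nearWeight_nonneg {b : ℕ} {μ : ℝ} (hμ : 0 ≤ μ) (x : ℝ) : 0 ≤ nearWeight b μ x := by
  unfold nearWeight
  split_ifs <;> linarith

theorem nearWeight_le_one {b : ℕ} {μ : ℝ} (hμ : μ ≤ 1) (x : ℝ) : nearWeight b μ x ≤ 1 := by
  unfold nearWeight
  split_ifs <;> linarith

theorem nearWeight_pow (b : ℕ) (μ x : ℝ) (m : ℕ) :
    nearWeight b μ x ^ m = nearWeight b (μ ^ m) x := by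
  unfold nearWeight
  split_ifs <;> simp

/-- The two frequencies attached to neighbouring digits of a palindrome satisfy
`b c_{i+1} - c_i = b ^ i (b ^ 2 - 1)` and `b c_i - c_{i+1} = b ^ (2 r - 1 - i) (b ^ 2 - 1)`.
So when both digit sums are large, two multiples of `(b ^ 2 - 1) θ` are close to integers. -/
theorem norm_digitSum_mul_le {b : ℕ} (hb : 2 ≤ b) {μ : ℝ} (hμ0 : 0 < μ) (hμ1 : μ < 1)
    (hμ : ∀ x : ℝ, ¬ NearInt (1 / (b : ℝ) ^ 4) x → ‖digitSum b x‖ ≤ b * μ ^ 2)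
    {r i : ℕ} (hi : i + 1 < r) (θ : ℝ) :
    (‖digitSum b (((b : ℝ) ^ i + (b : ℝ) ^ (2 * r - i)) * θ)‖ / b) *
      (‖digitSum b (((b : ℝ) ^ (i + 1) + (b : ℝ) ^ (2 * r - (i + 1))) * θ)‖ / b)
      ≤ nearWeight b μ (b ^ i * ((b ^ 2 - 1) * θ)) ^ 2 ∧
    (‖digitSum b (((b : ℝ) ^ i + (b : ℝ) ^ (2 * r - i)) * θ)‖ / b) *
      (‖digitSum b (((b : ℝ) ^ (i + 1) + (b : ℝ) ^ (2 * r - (i + 1))) * θ)‖ / b)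
      ≤ nearWeight b μ (b ^ (2 * r - 1 - i) * ((b ^ 2 - 1) * θ)) ^ 2 := by
  have hb' : (2 : ℝ) ≤ b := by exact_mod_cast hb
  have hb0 : (0 : ℝ) < b := by linarith
  set x := ((b : ℝ) ^ i + (b : ℝ) ^ (2 * r - i)) * θ with hx
  set y := ((b : ℝ) ^ (i + 1) + (b : ℝ) ^ (2 * r - (i + 1))) * θ with hy
  have hle : ∀ z : ℝ, ‖digitSum b z‖ / b ≤ 1 := fun z => by
    rw [div_le_one hb0]; exact norm_digitSum_le b z
  have h0 : ∀ z : ℝ, 0 ≤ ‖digitSum b z‖ / b := fun z => by positivity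
  have hsmall : ∀ z : ℝ, ¬ NearInt (1 / (b : ℝ) ^ 4) z → ‖digitSum b z‖ / b ≤ μ ^ 2 := by
    intro z hz
    rw [div_le_iff₀ hb0, mul_comm]
    exact hμ z hz
  have hρ : ((b : ℝ) + 1) * (1 / (b : ℝ) ^ 4) ≤ 1 / (b : ℝ) ^ 2 := by
    rw [mul_one_div, div_le_div_iff₀ (by positivity) (by positivity)]
    have : (b : ℝ) + 1 ≤ b ^ 2 := by nlinarith
    nlinarith [pow_pos hb0 2]
  have e1 : b * y - x = b ^ i * ((b ^ 2 - 1) * θ) := by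
    rw [hx, hy, show 2 * r - i = (2 * r - (i + 1)) + 1 by omega]
    ring
  have e2 : b * x - y = b ^ (2 * r - 1 - i) * ((b ^ 2 - 1) * θ) := by
    rw [hx, hy, show 2 * r - i = (2 * r - 1 - i) + 1 by omega,
      show 2 * r - (i + 1) = 2 * r - 1 - i by omega]
    ring
  by_cases hnx : NearInt (1 / (b : ℝ) ^ 4) x
  · by_cases hny : NearInt (1 / (b : ℝ) ^ 4) y
    · have n1 := hny.mul_sub b hnx hρ
      have n2 := hnx.mul_sub b hny hρ
      rw [e1] at n1
      rw [e2] at n2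
      rw [nearWeight, nearWeight, if_pos n1, if_pos n2, one_pow, and_self]
      exact mul_le_one₀ (hle _) (h0 _) (hle _)
    · have : ‖digitSum b x‖ / b * (‖digitSum b y‖ / b) ≤ μ ^ 2 := by
        calc _ ≤ 1 * (‖digitSum b y‖ / b) := mul_le_mul_of_nonneg_right (hle _) (h0 _)
          _ ≤ μ ^ 2 := by rw [one_mul]; exact hsmall _ hny
      have hw : ∀ z, μ ^ 2 ≤ nearWeight b μ z ^ 2 := fun z => by
        unfold nearWeight; split_ifs <;> nlinarith
      exact ⟨this.trans (hw _), this.trans (hw _)⟩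
  · have : ‖digitSum b x‖ / b * (‖digitSum b y‖ / b) ≤ μ ^ 2 := by
      calc _ ≤ (‖digitSum b x‖ / b) * 1 := mul_le_mul_of_nonneg_left (hle _) (h0 _)
        _ ≤ μ ^ 2 := by rw [mul_one]; exact hsmall _ hnx
    have hw : ∀ z, μ ^ 2 ≤ nearWeight b μ z ^ 2 := fun z => by
      unfold nearWeight; split_ifs <;> nlinarith
    exact ⟨this.trans (hw _), this.trans (hw _)⟩

/-- Each factor is paired with its left and with its right neighbour, which uses every factor
twice; hence the square. -/
theorem sq_prod_Ico_le {g v : ℕ → ℝ} {a r : ℕ} (h0 : ∀ i, 0 ≤ g i) (h1 : ∀ i, g i ≤ 1)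
    (hv : ∀ i ∈ Finset.Ico a (r - 1), g i * g (i + 1) ≤ v i) :
    (∏ i ∈ Finset.Ico a r, g i) ^ 2 ≤ ∏ i ∈ Finset.Ico a (r - 1), v i := by
  have hA : ∏ i ∈ Finset.Ico a r, g i ≤ ∏ i ∈ Finset.Ico a (r - 1), g i :=
    Finset.prod_le_prod_of_subset_of_le_one (Finset.Ico_subset_Ico_right (by omega))
      (fun i _ => h0 i) (fun i _ _ => h1 i)
  have hB : ∏ i ∈ Finset.Ico a r, g i ≤ ∏ i ∈ Finset.Ico a (r - 1), g (i + 1) := by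
    rw [Finset.prod_Ico_add' g a (r - 1) 1]
    refine Finset.prod_le_prod_of_subset_of_le_one ?_ (fun i _ => h0 i) (fun i _ _ => h1 i)
    intro i hi
    rw [Finset.mem_Ico] at hi ⊢
    omega
  have hC : 0 ≤ ∏ i ∈ Finset.Ico a r, g i := Finset.prod_nonneg fun i _ => h0 i
  calc (∏ i ∈ Finset.Ico a r, g i) ^ 2
      ≤ (∏ i ∈ Finset.Ico a (r - 1), g i) * ∏ i ∈ Finset.Ico a (r - 1), g (i + 1) := by
        rw [sq]; exact mul_le_mul hA hB hC (hC.trans hA)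
    _ = ∏ i ∈ Finset.Ico a (r - 1), g i * g (i + 1) := Finset.prod_mul_distrib.symm
    _ ≤ _ := Finset.prod_le_prod (fun i _ => mul_nonneg (h0 _) (h0 _)) hv

theorem sum_range_mul_eq {α : Type*} [AddCommMonoid α] (f : ℕ → α) (m n : ℕ) :
    ∑ k ∈ Finset.range (m * n), f k =
      ∑ i ∈ Finset.range m, ∑ j ∈ Finset.range n, f (i * n + j) := by
  induction m with
  | zero => simp
  | succ m ih => rw [Nat.succ_mul, Finset.sum_range_add, ih, Finset.sum_range_succ]

theorem prod_range_mul_eq {α : Type*} [CommMonoid α] (f : ℕ → α) (m n : ℕ) :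
    ∏ k ∈ Finset.range (m * n), f k =
      ∏ i ∈ Finset.range m, ∏ j ∈ Finset.range n, f (i * n + j) := by
  induction m with
  | zero => simp
  | succ m ih => rw [Nat.succ_mul, Finset.prod_range_add, ih, Finset.prod_range_succ]

/-- The product over `j < T` of `1` if the digits `j - 1` and `j` of the `T`-digit number `k`
(leading digit first, preceded by a zero) agree, and of `w j` if they differ. -/
noncomputable def digitChangeWeight (b : ℕ) (w : ℕ → ℝ) : ℕ → ℕ → ℝ
  | 0, _ => 1
  | T + 1, k => digitChangeWeight b w T (k / b) * if k % b = k / b % b then 1 else w T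

theorem digitChangeWeight_nonneg {b : ℕ} {w : ℕ → ℝ} (hw : ∀ j, 0 ≤ w j) (T k : ℕ) :
    0 ≤ digitChangeWeight b w T k := by
  induction T generalizing k with
  | zero => exact zero_le_one
  | succ T ih =>
    unfold digitChangeWeight
    refine mul_nonneg (ih _) ?_
    split_ifs
    exacts [zero_le_one, hw T]

theorem sum_digitChangeWeight {b : ℕ} (hb : 0 < b) (w : ℕ → ℝ) (T : ℕ) :
    ∑ k ∈ Finset.range (b ^ T), digitChangeWeight b w T k
      = ∏ j ∈ Finset.range T, (1 + (b - 1) * w j) := by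
  induction T with
  | zero => simp [digitChangeWeight]
  | succ T ih =>
    rw [pow_succ, sum_range_mul_eq, Finset.prod_range_succ, ← ih, Finset.sum_mul]
    refine Finset.sum_congr rfl fun i _ => ?_
    have h1 : ∀ j ∈ Finset.range b, digitChangeWeight b w (T + 1) (i * b + j)
        = digitChangeWeight b w T i * if j = i % b then 1 else w T := by
      intro j hj
      have hj' := Finset.mem_range.1 hj
      have e1 : (i * b + j) / b = i := by
        rw [mul_comm, Nat.mul_add_div hb, Nat.div_eq_of_lt hj', add_zero]
      have e2 : (i * b + j) % b = j := by
        rw [mul_comm, Nat.mul_add_mod, Nat.mod_eq_of_lt hj']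
      rw [digitChangeWeight, e1, e2]
    rw [Finset.sum_congr rfl h1, ← Finset.mul_sum]
    congr 1
    rw [← Finset.add_sum_erase _ _ (Finset.mem_range.2 (Nat.mod_lt i hb)), if_pos rfl]
    congr 1
    rw [Finset.sum_congr rfl (g := fun _ => w T)
      fun j hj => if_neg (Finset.ne_of_mem_erase hj)]
    rw [Finset.sum_const, Finset.card_erase_of_mem (Finset.mem_range.2 (Nat.mod_lt i hb)),
      Finset.card_range, nsmul_eq_mul, Nat.cast_sub hb, Nat.cast_one]

/-- A real within `1 / b ^ 2` of an integer has its first two digits after the point equal. -/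
theorem digits_eq_of_nearInt {b p d j : ℕ} (hb : 2 ≤ b) (hd : 0 < d)
    (h : NearInt (1 / (b : ℝ) ^ 2) (b ^ j * (p / d))) :
    b ^ (j + 2) * p / d % b = b ^ (j + 1) * p / d % b := by
  obtain ⟨n, hn⟩ := h
  have hb0 : (0 : ℝ) < b := by positivity
  have hd0 : (0 : ℝ) < d := by positivity
  have h1 : |((b : ℤ) ^ (j + 2) * p - n * b ^ 2 * d : ℤ)| < (d : ℤ) := by
    have h2 : |((b : ℝ) ^ (j + 2) * p - n * b ^ 2 * d)| < d := by
      have : ((b : ℝ) ^ (j + 2) * p - n * b ^ 2 * d)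
          = (b ^ j * (p / d) - n) * (b ^ 2 * d) := by field_simp; ring
      rw [this, abs_mul, abs_of_pos (by positivity : (0 : ℝ) < b ^ 2 * d)]
      rw [lt_div_iff₀ (by positivity)] at hn
      nlinarith
    exact_mod_cast h2
  rw [abs_lt] at h1
  have hbz : (0 : ℤ) < b := by exact_mod_cast (by omega : 0 < b)
  have hdz : (0 : ℤ) < d := by exact_mod_cast hd
  have hk : b ^ (j + 1) * p / d = b ^ (j + 2) * p / d / b := by
    rw [Nat.div_div_eq_div_mul, show b ^ (j + 2) * p = b ^ (j + 1) * p * b by ring,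
      Nat.mul_div_mul_right _ _ (by omega)]
  rw [hk]
  zify
  set A : ℤ := (b : ℤ) ^ (j + 2) * p with hA
  rcases le_or_gt 0 (A - n * b ^ 2 * d) with h3 | h3
  · have e1 : A / d = n * b ^ 2 := by
      rw [Int.ediv_eq_iff_of_pos hdz]
      constructor <;> linarith
    rw [e1, show n * (b : ℤ) ^ 2 = b * (n * b) by ring, Int.mul_ediv_cancel_left _ hbz.ne']
    simp
  · have e1 : A / d = n * b ^ 2 - 1 := by
      rw [Int.ediv_eq_iff_of_pos hdz]
      constructor <;> linarith
    have e2 : (n * (b : ℤ) ^ 2 - 1) / b = n * b - 1 := by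
      have : (2 : ℤ) ≤ b := by exact_mod_cast hb
      rw [Int.ediv_eq_iff_of_pos hbz]
      constructor <;> nlinarith
    rw [e1, e2, show n * (b : ℤ) ^ 2 - 1 = -1 + b * (n * b) by ring,
      show n * (b : ℤ) - 1 = -1 + b * n by ring, Int.add_mul_emod_self_left,
      Int.add_mul_emod_self_left]

/-- The first `T + 1` digits of `p / d` form the number `b ^ (T + 1) * p / d`. Nothing is known
about the first of them, whence the weight `1` in position `0`. -/
theorem prod_nearWeight_le_digitChangeWeight {b p d : ℕ} (hb : 2 ≤ b) (hpd : p < d)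
    {w : ℕ → ℝ} (hw0 : ∀ j, 0 ≤ w j) (hw1 : ∀ j, w j ≤ 1) (T : ℕ) :
    ∏ j ∈ Finset.range T, nearWeight b (w j) (b ^ j * (p / d)) ≤
      digitChangeWeight b (fun j => if j = 0 then 1 else w (j - 1)) (T + 1)
        (b ^ (T + 1) * p / d) := by
  have hd : 0 < d := by omega
  have hk : ∀ j, b ^ (j + 1) * p / d / b = b ^ j * p / d := fun j => by
    rw [Nat.div_div_eq_div_mul, show b ^ (j + 1) * p = b ^ j * p * b by ring,
      Nat.mul_div_mul_right _ _ (by omega)]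
  induction T with
  | zero => simp [digitChangeWeight]
  | succ T ih =>
    rw [Finset.prod_range_succ, digitChangeWeight, hk]
    refine mul_le_mul ih ?_ (nearWeight_nonneg (hw0 _) _) (digitChangeWeight_nonneg (fun j => ?_) _ _)
    · rw [if_neg (Nat.succ_ne_zero T), Nat.add_sub_cancel]
      by_cases h : NearInt (1 / (b : ℝ) ^ 2) (b ^ T * (p / d))
      · rw [if_pos (digits_eq_of_nearInt hb hd h)]
        exact nearWeight_le_one (hw1 _) _
      · rw [nearWeight, if_neg h]
        split_ifs
        exacts [hw1 T, le_rfl]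
    · split_ifs
      exacts [zero_le_one, hw0 _]

theorem fareyBlock_coprime {b K : ℕ} {p : ℕ × ℕ} (hp : p ∈ fareyBlock b K) :
    Nat.Coprime b p.1 ∧ Nat.Coprime (b ^ 2 - 1) p.1 := by
  have h := (mem_fareyBlock.1 hp).2.2.2.1
  rw [cube_sub_eq, Nat.coprime_mul_iff_right] at h
  exact ⟨h.1.symm, h.2.symm⟩

/-- Distinct reduced fractions with denominators below `b ^ (K + 1)`, multiplied by an integer
coprime to the denominators, fall into distinct `b`-adic intervals of length
`b ^ (-(2 * K + 2))`. -/
theorem injOn_fareyBlock {b K c : ℕ}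
    (hc : ∀ p ∈ fareyBlock b K, Nat.Coprime c p.1) :
    Set.InjOn (fun p : ℕ × ℕ => b ^ (2 * K + 2) * (c * p.2 % p.1) / p.1)
      (fareyBlock b K) := by
  rintro ⟨d, h⟩ hp ⟨d', h'⟩ hp' heq
  have c1 := hc _ hp
  have c2 := hc _ hp'
  obtain ⟨-, a1, a2, -, a3, a4⟩ := mem_fareyBlock.1 hp
  obtain ⟨-, a1', a2', -, a3', a4'⟩ := mem_fareyBlock.1 hp'
  dsimp only at *
  set r := c * h % d with hr
  set r' := c * h' % d' with hr'
  have g1 : Nat.Coprime r d := by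
    rw [hr, Nat.coprime_iff_gcd_eq_one, ← Nat.gcd_rec, Nat.gcd_comm]
    exact Nat.Coprime.mul_left c1 a4
  have g2 : Nat.Coprime r' d' := by
    rw [hr', Nat.coprime_iff_gcd_eq_one, ← Nat.gcd_rec, Nat.gcd_comm]
    exact Nat.Coprime.mul_left c2 a4'
  have hd0 : 0 < d := by omega
  have hd0' : 0 < d' := by omega
  have hdd : d * d' < b ^ (2 * K + 2) := by
    calc d * d' < b ^ (K + 1) * b ^ (K + 1) := Nat.mul_lt_mul'' a1 a1'
      _ = _ := by ring
  -- `r / d = r' / d'`, as the difference is less than `1 / (d d')`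
  have hcross : r * d' = r' * d := by
    set P := b ^ (2 * K + 2)
    set k := P * r / d with hk
    have u1 : k * d ≤ P * r := Nat.div_mul_le_self _ _
    have u2 : P * r < (k + 1) * d := (Nat.div_lt_iff_lt_mul hd0).1 (Nat.lt_succ_self k)
    have u3 : k * d' ≤ P * r' := by rw [heq]; exact Nat.div_mul_le_self _ _
    have u4 : P * r' < (k + 1) * d' := by
      rw [heq]; exact (Nat.div_lt_iff_lt_mul hd0').1 (Nat.lt_succ_self _)
    rcases lt_trichotomy (r * d') (r' * d) with h | h | h
    · exfalso
      have : P * (r * d' + 1) ≤ P * (r' * d) := Nat.mul_le_mul_left _ h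
      nlinarith
    · exact h
    · exfalso
      have : P * (r' * d + 1) ≤ P * (r * d') := Nat.mul_le_mul_left _ h
      nlinarith
  have hdd' : d = d' := by
    apply Nat.dvd_antisymm
    · exact g1.symm.dvd_of_dvd_mul_left (hcross ▸ Dvd.intro_left _ rfl)
    · exact g2.symm.dvd_of_dvd_mul_left (hcross ▸ Dvd.intro_left _ rfl)
  subst hdd'
  have hrr : c * h ≡ c * h' [MOD d] := Nat.eq_of_mul_eq_mul_right hd0 hcross
  have := Nat.ModEq.cancel_left_of_coprime (c1.symm) hrr
  have := Nat.ModEq.eq_of_lt_of_lt this a3 a3'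
  rw [this]

/-- Few reduced fractions have almost all of their multiples by powers of `b` near integers: a
`b`-adic interval on which that happens is given by a digit string with few changes. -/
theorem sum_fareyBlock_nearWeight_le {b : ℕ} (hb : 2 ≤ b) (K a : ℕ) {w : ℕ → ℝ}
    (hw0 : ∀ j, 0 ≤ w j) (hw1 : ∀ j, w j ≤ 1) :
    ∑ p ∈ fareyBlock b K, ∏ j ∈ Finset.range (2 * K + 1),
        nearWeight b (w j) (b ^ j * (b ^ a * ((b ^ 2 - 1) * (p.2 / p.1))))
      ≤ b * ∏ j ∈ Finset.range (2 * K + 1), (1 + (b - 1) * w j) := by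
  set c := b ^ a * (b ^ 2 - 1) with hc
  have hc1 : ∀ p ∈ fareyBlock b K, Nat.Coprime c p.1 := fun p hp =>
    Nat.Coprime.mul_left ((fareyBlock_coprime hp).1.pow_left a) (fareyBlock_coprime hp).2
  set w' : ℕ → ℝ := fun j => if j = 0 then 1 else w (j - 1) with hw'
  have hw'0 : ∀ j, 0 ≤ w' j := fun j => by
    simp only [hw']; split_ifs; exacts [zero_le_one, hw0 _]
  have hcR : (c : ℝ) = b ^ a * (b ^ 2 - 1) := by
    rw [hc, Nat.cast_mul, Nat.cast_sub (Nat.one_le_pow _ _ (by omega))]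
    push_cast
    ring
  have h1 : ∀ p ∈ fareyBlock b K, ∏ j ∈ Finset.range (2 * K + 1),
        nearWeight b (w j) (b ^ j * (b ^ a * ((b ^ 2 - 1) * (p.2 / p.1))))
      ≤ digitChangeWeight b w' (2 * K + 2) (b ^ (2 * K + 2) * (c * p.2 % p.1) / p.1) := by
    intro p hp
    have hd0 : 0 < p.1 := by have := (mem_fareyBlock.1 hp).2.2.1; omega
    refine le_trans (le_of_eq ?_)
      (prod_nearWeight_le_digitChangeWeight hb (Nat.mod_lt (c * p.2) hd0) hw0 hw1 _)
    refine Finset.prod_congr rfl fun j _ => ?_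
    rw [← nearWeight_add_int b (w j) (b ^ j * (((c * p.2 % p.1 : ℕ) : ℝ) / p.1))
      ((b ^ j * (c * p.2 / p.1) : ℕ) : ℤ)]
    congr 1
    have hdiv : ((c * p.2 : ℕ) : ℝ) = p.1 * ((c * p.2 / p.1 : ℕ) : ℝ) + ((c * p.2 % p.1 : ℕ) : ℝ) := by
      exact_mod_cast (Nat.div_add_mod _ _).symm
    have hd1 : (p.1 : ℝ) ≠ 0 := by positivity
    have : b ^ a * (((b : ℝ) ^ 2 - 1) * (p.2 / p.1)) = ((c * p.2 : ℕ) : ℝ) / p.1 := by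
      push_cast
      rw [hcR]
      ring
    rw [this, hdiv, Int.cast_natCast, Nat.cast_mul, Nat.cast_pow]
    field_simp
    ring
  calc _ ≤ ∑ p ∈ fareyBlock b K,
        digitChangeWeight b w' (2 * K + 2) (b ^ (2 * K + 2) * (c * p.2 % p.1) / p.1) :=
        Finset.sum_le_sum h1
    _ = ∑ k ∈ (fareyBlock b K).image
          (fun p : ℕ × ℕ => b ^ (2 * K + 2) * (c * p.2 % p.1) / p.1),
          digitChangeWeight b w' (2 * K + 2) k :=
        (Finset.sum_image (injOn_fareyBlock hc1)).symm
    _ ≤ ∑ k ∈ Finset.range (b ^ (2 * K + 2)), digitChangeWeight b w' (2 * K + 2) k := by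
        refine Finset.sum_le_sum_of_subset_of_nonneg ?_
          fun k _ _ => digitChangeWeight_nonneg hw'0 _ _
        intro k hk
        obtain ⟨p, hp, rfl⟩ := Finset.mem_image.1 hk
        have hd0 : 0 < p.1 := by have := (mem_fareyBlock.1 hp).2.2.1; omega
        rw [Finset.mem_range, Nat.div_lt_iff_lt_mul hd0]
        exact Nat.mul_lt_mul_of_pos_left (Nat.mod_lt _ hd0) (by positivity)
    _ = _ := by
        rw [sum_digitChangeWeight (by omega), Finset.prod_range_succ', mul_comm]
        congr 1
        simp [hw']

/-! ### Mean squares over fractions -/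

/-- Orthogonality modulo `d` bounds the mean square over all `h / d` by the number of pairs that
are congruent modulo `d`; on average over `d` the divisor bound controls that number. -/
theorem sum_norm_sq_expChar_le {S D : Finset ℕ} {N X : ℕ} {τ : ℝ}
    (hτ0 : 0 ≤ τ) (hD : ∀ d ∈ D, 0 < d ∧ d ≤ N) (hS : ∀ n ∈ S, n ≤ X)
    (hτ : ∀ n : ℕ, 0 < n → n ≤ X → (n.divisors.card : ℝ) ≤ τ) (β : ℝ) :
    ∑ d ∈ D, ∑ h ∈ Finset.range d, ‖∑ n ∈ S, expChar (n * (h / d + β))‖ ^ 2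
      ≤ N * (D.card * S.card + (S.card : ℝ) ^ 2 * τ) := by
  classical
  have hone : ∀ d ∈ D, ∑ h ∈ Finset.range d, ‖∑ n ∈ S, expChar (n * (h / d + β))‖ ^ 2
      ≤ N * ∑ n ∈ S, ∑ m ∈ S, if (d : ℤ) ∣ (n : ℤ) - m then (1 : ℝ) else 0 := by
    intro d hd
    obtain ⟨hd0, hdN⟩ := hD d hd
    have e : ((∑ h ∈ Finset.range d, ‖∑ n ∈ S, expChar (n * (h / d + β))‖ ^ 2 : ℝ) : ℂ)
        = ∑ n ∈ S, ∑ m ∈ S, expChar (((n : ℝ) - m) * β) *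
          (if (d : ℤ) ∣ (n : ℤ) - m then (d : ℂ) else 0) := by
      push_cast
      calc _ = ∑ h ∈ Finset.range d, ∑ n ∈ S, ∑ m ∈ S,
            expChar (((n : ℝ) - m) * β) * expChar (h * (((n : ℤ) - m : ℤ) : ℝ) / d) := by
            refine Finset.sum_congr rfl fun h _ => ?_
            rw [← Complex.mul_conj', map_sum, Finset.sum_mul_sum]
            refine Finset.sum_congr rfl fun n _ => Finset.sum_congr rfl fun m _ => ?_
            rw [conj_expChar, ← expChar_add, ← expChar_add]
            congr 1
            push_cast
            ring
        _ = _ := by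
            rw [Finset.sum_comm]
            refine Finset.sum_congr rfl fun n _ => ?_
            rw [Finset.sum_comm]
            refine Finset.sum_congr rfl fun m _ => ?_
            rw [← Finset.mul_sum, sum_expChar_div d hd0]
    have h0 : 0 ≤ ∑ h ∈ Finset.range d, ‖∑ n ∈ S, expChar (n * (h / d + β))‖ ^ 2 :=
      Finset.sum_nonneg fun _ _ => by positivity
    rw [← abs_of_nonneg h0, ← Real.norm_eq_abs, ← Complex.norm_real, e, Finset.mul_sum]
    refine norm_sum_le_of_le _ fun n _ => ?_
    rw [Finset.mul_sum]
    refine norm_sum_le_of_le _ fun m _ => ?_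
    rw [norm_mul, norm_expChar, one_mul]
    split_ifs
    · simpa using hdN
    · simp
  calc _ ≤ ∑ d ∈ D, (N : ℝ) * ∑ n ∈ S, ∑ m ∈ S, if (d : ℤ) ∣ (n : ℤ) - m then (1 : ℝ) else 0 :=
        Finset.sum_le_sum hone
    _ = N * ∑ n ∈ S, ∑ m ∈ S, ((D.filter fun d : ℕ => (d : ℤ) ∣ (n : ℤ) - m).card : ℝ) := by
        rw [← Finset.mul_sum, Finset.sum_comm]
        congr 1
        refine Finset.sum_congr rfl fun n _ => ?_
        rw [Finset.sum_comm]
        refine Finset.sum_congr rfl fun m _ => ?_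
        rw [Finset.sum_ite]
        simp
    _ ≤ N * ∑ n ∈ S, ∑ m ∈ S, ((if n = m then (D.card : ℝ) else 0) + τ) := by
        have hpair : ∀ n ∈ S, ∀ m ∈ S, n ≠ m → (((D.filter fun d : ℕ =>
            (d : ℤ) ∣ (n : ℤ) - m).card : ℕ) : ℝ) ≤ τ := by
          intro n hn m hm hnm
          have hne : ((n : ℤ) - m).natAbs ≠ 0 := by omega
          refine le_trans ?_ (hτ ((n : ℤ) - m).natAbs (by omega) ?_)
          · refine Nat.cast_le.2 (Finset.card_le_card fun d hd => ?_)
            rw [Finset.mem_filter] at hd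
            rw [Nat.mem_divisors]
            exact ⟨Int.natCast_dvd.1 hd.2, hne⟩
          · have := hS n hn
            have := hS m hm
            omega
        refine mul_le_mul_of_nonneg_left ?_ (Nat.cast_nonneg N)
        refine Finset.sum_le_sum fun n hn => Finset.sum_le_sum fun m hm => ?_
        split_ifs with h
        · have h1 : ((D.filter fun d : ℕ => (d : ℤ) ∣ (n : ℤ) - m).card : ℝ) ≤ D.card := by
            exact_mod_cast Finset.card_filter_le _ _
          linarith
        · rw [zero_add]
          exact hpair n hn m hm h
    _ = _ := by
        simp only [Finset.sum_add_distrib, Finset.sum_ite_eq, Finset.sum_const, nsmul_eq_mul]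
        rw [Finset.sum_congr rfl (g := fun _ => (D.card : ℝ)) fun n hn => if_pos hn]
        simp only [Finset.sum_const, nsmul_eq_mul]
        ring

theorem sum_fareyBlock_le (b K : ℕ) {f : ℕ → ℕ → ℝ} (hf : ∀ d h, 0 ≤ f d h) :
    ∑ p ∈ fareyBlock b K, f p.1 p.2
      ≤ ∑ d ∈ Finset.Ico 1 (b ^ (K + 1)), ∑ h ∈ Finset.range d, f d h := by
  have h1 : fareyBlock b K ⊆ (Finset.Ico 1 (b ^ (K + 1)) ×ˢ Finset.range (b ^ (K + 1))).filter
      fun p => p.2 < p.1 := by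
    intro p hp
    obtain ⟨-, h2, h3, -, h4, -⟩ := mem_fareyBlock.1 hp
    simp only [Finset.mem_filter, Finset.mem_product, Finset.mem_Ico, Finset.mem_range]
    omega
  refine (Finset.sum_le_sum_of_subset_of_nonneg h1 fun p _ _ => hf _ _).trans (le_of_eq ?_)
  rw [Finset.sum_filter, Finset.sum_product]
  refine Finset.sum_congr rfl fun d hd => ?_
  rw [← Finset.sum_filter]
  refine Finset.sum_congr ?_ fun _ _ => rfl
  ext h
  rw [Finset.mem_Ico] at hd
  simp only [Finset.mem_filter, Finset.mem_range]
  omega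

/-- A product of digit sums over consecutive digits is an exponential sum over distinct
integers. -/
theorem exists_prod_digitSum_eq {b r : ℕ} (hb : 2 ≤ b) (T a : ℕ) (h : a + T ≤ r) :
    ∃ S : Finset ℕ, S.card = b ^ T ∧ (∀ n ∈ S, b ^ a ∣ n ∧ n ≤ T * (b * (2 * b ^ (2 * r)))) ∧
      ∀ θ : ℝ, ∏ i ∈ Finset.range T, digitSum b (((b : ℝ) ^ (a + i) + (b : ℝ) ^ (2 * r - (a + i))) * θ)
        = ∑ n ∈ S, expChar (n * θ) := by
  induction T generalizing a with
  | zero => exact ⟨{0}, by simp, by simp, by simp [expChar_zero]⟩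
  | succ T ih =>
    obtain ⟨S, h1, h2, h3⟩ := ih (a + 1) (by omega)
    set c := b ^ a + b ^ (2 * r - a) with hc
    have hdvd : b ^ (a + 1) ∣ b ^ (2 * r - a) := pow_dvd_pow _ (by omega)
    have hinj : Set.InjOn (fun p : ℕ × ℕ => p.1 * c + p.2)
        ((Finset.range b ×ˢ S : Finset (ℕ × ℕ)) : Set (ℕ × ℕ)) := by
      rintro ⟨d, m⟩ hp ⟨d', m'⟩ hp' heq
      simp only [Finset.coe_product, Set.mem_prod, Finset.mem_coe, Finset.mem_range] at hp hp' heq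
      obtain ⟨u, hu⟩ := (h2 m hp.2).1
      obtain ⟨u', hu'⟩ := (h2 m' hp'.2).1
      obtain ⟨v, hv⟩ := hdvd
      have hdd : d = d' := by
        have e : ∀ d u, d * c + b ^ (a + 1) * u = b ^ a * (d + b * (d * v + u)) := by
          intro d u
          rw [hc, hv]
          ring
        rw [hu, hu', e, e] at heq
        have := Nat.eq_of_mul_eq_mul_left (by positivity) heq
        have := congrArg (· % b) this
        simpa [Nat.add_mul_mod_self_left, Nat.mod_eq_of_lt hp.1, Nat.mod_eq_of_lt hp'.1] using this
      subst hdd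
      simp only [add_right_inj] at heq
      rw [heq]
    refine ⟨(Finset.range b ×ˢ S).image fun p => p.1 * c + p.2, ?_, ?_, fun θ => ?_⟩
    · rw [Finset.card_image_of_injOn hinj, Finset.card_product, h1, Finset.card_range]
      ring
    · intro n hn
      simp only [Finset.mem_image, Finset.mem_product, Finset.mem_range, Prod.exists] at hn
      obtain ⟨d, m, ⟨hd, hm⟩, rfl⟩ := hn
      refine ⟨dvd_add (Dvd.dvd.mul_left (dvd_add dvd_rfl (pow_dvd_pow _ (by omega))) _)
        ((pow_dvd_pow _ (by omega)).trans (h2 m hm).1), ?_⟩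
      have hc2 : c ≤ 2 * b ^ (2 * r) := by
        have a1 : b ^ a ≤ b ^ (2 * r) := Nat.pow_le_pow_right (by omega) (by omega)
        have a2 : b ^ (2 * r - a) ≤ b ^ (2 * r) := Nat.pow_le_pow_right (by omega) (by omega)
        omega
      calc d * c + m ≤ b * (2 * b ^ (2 * r)) + T * (b * (2 * b ^ (2 * r))) :=
            add_le_add (Nat.mul_le_mul hd.le hc2) (h2 m hm).2
        _ = _ := by ring
    · rw [Finset.sum_image hinj, Finset.prod_range_succ', Finset.sum_product]
      have e : ∏ i ∈ Finset.range T,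
          digitSum b (((b : ℝ) ^ (a + (i + 1)) + (b : ℝ) ^ (2 * r - (a + (i + 1)))) * θ)
          = ∑ n ∈ S, expChar (n * θ) := by
        rw [← h3 θ]
        refine Finset.prod_congr rfl fun i _ => ?_
        rw [show a + (i + 1) = a + 1 + i by ring]
      rw [e, mul_comm, digitSum, Finset.sum_mul]
      refine Finset.sum_congr rfl fun d _ => ?_
      rw [Finset.mul_sum]
      refine Finset.sum_congr rfl fun m _ => ?_
      rw [← expChar_add]
      congr 1
      rw [hc, add_zero]
      push_cast
      ring

/-- The mean square over fractions of a block of `T` consecutive normalized digit sums is at most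
`b ^ (K + 1)` times the proportion `b ^ (-T)` of diagonal pairs, summed over the denominators, plus
the divisor bound `τ`. -/
theorem sum_fareyBlock_sq_prod_le {b K r a T : ℕ} (hb : 2 ≤ b) (h : a + T ≤ r) {τ : ℝ}
    (hτ : ∀ n : ℕ, 0 < n → n ≤ b ^ (4 * r + 2) → (n.divisors.card : ℝ) ≤ τ) (β : ℝ) :
    ∑ p ∈ fareyBlock b K, (∏ i ∈ Finset.range T,
      ‖digitSum b (((b : ℝ) ^ (a + i) + (b : ℝ) ^ (2 * r - (a + i))) * (p.2 / p.1 + β))‖ / b) ^ 2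
      ≤ b ^ (K + 1) * (b ^ (K + 1) / b ^ T + τ) := by
  obtain ⟨S, h1, h2, h3⟩ := exists_prod_digitSum_eq hb T a h
  have hb0 : (0 : ℝ) < b := by positivity
  have hX : T * (b * (2 * b ^ (2 * r))) ≤ b ^ (4 * r + 2) := by
    have a1 : T ≤ b ^ r := by
      have := (Nat.lt_pow_self (by omega : 1 < b) : r < b ^ r)
      omega
    calc T * (b * (2 * b ^ (2 * r))) ≤ b ^ r * (b * (b * b ^ (2 * r))) := by gcongr
      _ = b ^ (3 * r + 2) := by ring
      _ ≤ _ := Nat.pow_le_pow_right (by omega) (by omega)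
  have hmain := sum_norm_sq_expChar_le (S := S) (D := Finset.Ico 1 (b ^ (K + 1)))
    (N := b ^ (K + 1)) (X := b ^ (4 * r + 2)) (τ := τ)
    ((Nat.cast_nonneg _).trans (hτ 1 one_pos (Nat.one_le_pow _ _ (by omega))))
    (fun d hd => by rw [Finset.mem_Ico] at hd; omega)
    (fun n hn => (h2 n hn).2.trans hX) hτ β
  have e : ∀ θ : ℝ, (∏ i ∈ Finset.range T,
      ‖digitSum b (((b : ℝ) ^ (a + i) + (b : ℝ) ^ (2 * r - (a + i))) * θ)‖ / b) ^ 2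
      = ‖∑ n ∈ S, expChar (n * θ)‖ ^ 2 / (b ^ T) ^ 2 := by
    intro θ
    rw [Finset.prod_div_distrib, ← norm_prod, h3, div_pow]
    simp
  simp_rw [e]
  rw [← Finset.sum_div, div_le_iff₀ (by positivity)]
  refine (sum_fareyBlock_le b K (f := fun d h => ‖∑ n ∈ S, expChar (n * ((h : ℝ) / d + β))‖ ^ 2)
    fun _ _ => by positivity).trans (hmain.trans ?_)
  rw [Nat.card_Ico, h1]
  push_cast
  have : ((b ^ (K + 1) - 1 : ℕ) : ℝ) ≤ (b : ℝ) ^ (K + 1) := by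
    exact_mod_cast Nat.sub_le _ _
  calc (b : ℝ) ^ (K + 1) * (((b ^ (K + 1) - 1 : ℕ) : ℝ) * b ^ T + (b ^ T) ^ 2 * τ)
      ≤ b ^ (K + 1) * (b ^ (K + 1) * b ^ T + (b ^ T) ^ 2 * τ) := by gcongr
    _ = _ := by field_simp

/-! ### Averages of palindromic products over fractions -/

/-- The sum of a palindromic product over all reduced fractions with denominators of `K + 1`
digits, translated by a fixed fraction with denominator `b ^ 2 - 1`. -/
noncomputable def fareySum (b K r k : ℕ) : ℝ :=
  ∑ p ∈ fareyBlock b K, palindromeProduct b r (p.2 / p.1 + k / ((b : ℝ) ^ 2 - 1))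

/-- One factor of a palindromic product, normalized to lie in `[0, 1]`. -/
noncomputable def digitRatio (b r : ℕ) (θ : ℝ) (i : ℕ) : ℝ :=
  ‖digitSum b (((b : ℝ) ^ i + (b : ℝ) ^ (2 * r - i)) * θ)‖ / b

theorem digitRatio_nonneg (b r : ℕ) (θ : ℝ) (i : ℕ) : 0 ≤ digitRatio b r θ i := by
  unfold digitRatio
  positivity

theorem digitRatio_le_one {b : ℕ} (hb : 2 ≤ b) (r : ℕ) (θ : ℝ) (i : ℕ) :
    digitRatio b r θ i ≤ 1 := by
  have : (0 : ℝ) < b := by positivity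
  rw [digitRatio, div_le_one this]
  exact norm_digitSum_le b _

theorem palindromeProduct_eq {b : ℕ} (hb : 2 ≤ b) (r : ℕ) (θ : ℝ) :
    palindromeProduct b r θ = b ^ r * ∏ i ∈ Finset.range r, digitRatio b r θ i := by
  have : (b : ℝ) ≠ 0 := by positivity
  simp only [palindromeProduct, digitRatio]
  rw [Finset.prod_div_distrib, Finset.prod_const, Finset.card_range,
    mul_div_cancel₀ _ (pow_ne_zero r this)]

theorem fareySum_eq {b : ℕ} (hb : 2 ≤ b) (K r k : ℕ) :
    fareySum b K r k = b ^ r * ∑ p ∈ fareyBlock b K,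
      ∏ i ∈ Finset.range r, digitRatio b r (p.2 / p.1 + k / ((b : ℝ) ^ 2 - 1)) i := by
  simp only [fareySum, palindromeProduct_eq hb, Finset.mul_sum]

theorem prod_digitRatio_le_one {b : ℕ} (hb : 2 ≤ b) (r : ℕ) (θ : ℝ) (s : Finset ℕ) :
    ∏ i ∈ s, digitRatio b r θ i ≤ 1 :=
  Finset.prod_le_one (fun _ _ => digitRatio_nonneg _ _ _ _) fun _ _ => digitRatio_le_one hb _ _ _

theorem fareySum_le_trivial {b : ℕ} (hb : 2 ≤ b) (K r k : ℕ) :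
    fareySum b K r k ≤ b ^ r * b ^ (2 * K + 2) := by
  rw [fareySum_eq hb]
  refine mul_le_mul_of_nonneg_left ?_ (by positivity)
  calc _ ≤ ∑ p ∈ fareyBlock b K, (1 : ℝ) :=
        Finset.sum_le_sum fun _ _ => prod_digitRatio_le_one hb _ _ _
    _ = (fareyBlock b K).card := by simp
    _ ≤ _ := by exact_mod_cast card_fareyBlock_le b K

/-- After multiplication by `b ^ 2 - 1` the translation by `k / (b ^ 2 - 1)` is by an integer. -/
theorem nearWeight_shift {b : ℕ} (hb : 2 ≤ b) (μ x : ℝ) (i k : ℕ) :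
    nearWeight b μ (b ^ i * (((b : ℝ) ^ 2 - 1) * (x + k / ((b : ℝ) ^ 2 - 1))))
      = nearWeight b μ (b ^ i * (((b : ℝ) ^ 2 - 1) * x)) := by
  have hb' : (2 : ℝ) ≤ b := by exact_mod_cast hb
  have h1 : (b : ℝ) ^ 2 - 1 ≠ 0 := by nlinarith
  rw [← nearWeight_add_int b μ (b ^ i * (((b : ℝ) ^ 2 - 1) * x)) ((b ^ i * k : ℕ) : ℤ)]
  congr 1
  push_cast
  field_simp

section
variable {b : ℕ} {μ : ℝ} (hb : 2 ≤ b) (hμ0 : 0 < μ) (hμ1 : μ < 1)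
  (hμ : ∀ x : ℝ, ¬ NearInt (1 / (b : ℝ) ^ 4) x → ‖digitSum b x‖ ≤ b * μ ^ 2)
include hb hμ0 hμ1 hμ

theorem prod_digitRatio_le (r k : ℕ) (x : ℝ) :
    ∏ i ∈ Finset.range r, digitRatio b r (x + k / ((b : ℝ) ^ 2 - 1)) i
      ≤ ∏ i ∈ Finset.range (r - 1), nearWeight b μ (b ^ i * (((b : ℝ) ^ 2 - 1) * x)) := by
  rw [Finset.range_eq_Ico, Finset.range_eq_Ico]
  refine le_of_sq_le_sq ?_ (Finset.prod_nonneg fun i _ => nearWeight_nonneg hμ0.le _)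
  rw [← Finset.prod_pow (Finset.Ico 0 (r - 1))]
  refine sq_prod_Ico_le (fun i => digitRatio_nonneg _ _ _ i)
    (fun i => digitRatio_le_one hb _ _ i) fun i hi => ?_
  rw [Finset.mem_Ico] at hi
  rw [← nearWeight_shift hb μ x i k]
  exact (norm_digitSum_mul_le hb hμ0 hμ1 hμ (by omega) _).1

/-- A palindromic product is at most a product over `L` disjoint windows of `W` digits of the
fraction. -/
theorem prod_digitRatio_le_prod_blocks (r k : ℕ) (x : ℝ) {L W : ℕ} (h : L * W ≤ r - 1) :
    ∏ i ∈ Finset.range r, digitRatio b r (x + k / ((b : ℝ) ^ 2 - 1)) i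
      ≤ ∏ l ∈ Finset.range L, ∏ j ∈ Finset.range W,
        nearWeight b μ (b ^ j * (b ^ (l * W) * (((b : ℝ) ^ 2 - 1) * x))) := by
  refine (prod_digitRatio_le hb hμ0 hμ1 hμ r k x).trans ?_
  calc _ ≤ ∏ i ∈ Finset.range (L * W), nearWeight b μ (b ^ i * (((b : ℝ) ^ 2 - 1) * x)) :=
        Finset.prod_le_prod_of_subset_of_le_one (Finset.range_subset_range.2 h)
          (fun _ _ => nearWeight_nonneg hμ0.le _) fun _ _ _ => nearWeight_le_one hμ1.le _
    _ = _ := by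
        rw [prod_range_mul_eq]
        refine Finset.prod_congr rfl fun l _ => Finset.prod_congr rfl fun j _ => ?_
        congr 1
        ring

end

/-- The first `K + 1` multiples of a fraction by powers of `b` cannot all be close to integers:
otherwise the fraction itself would be closer to an integer than its denominator allows. -/
theorem exists_not_nearInt {b K : ℕ} (hb : 2 ≤ b) (a : ℕ) {p : ℕ × ℕ} (hp : p ∈ fareyBlock b K) :
    ∃ j < K + 1, ¬ NearInt (1 / (b : ℝ) ^ 2) (b ^ j * (b ^ a * (((b : ℝ) ^ 2 - 1) * (p.2 / p.1)))) := by
  by_contra! hall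
  have hb' : (2 : ℝ) ≤ b := by exact_mod_cast hb
  have hb0 : (0 : ℝ) < b := by linarith
  set x := (b : ℝ) ^ a * (((b : ℝ) ^ 2 - 1) * (p.2 / p.1)) with hx
  obtain ⟨n, hn⟩ := hall 0 (by omega)
  have key : ∀ j < K + 1, |b ^ j * x - b ^ j * n| < 1 / (b : ℝ) ^ 2 := by
    intro j
    induction j with
    | zero => intro _; simpa using hn
    | succ j ih =>
      intro hj
      have h1 := ih (by omega)
      obtain ⟨m, hm⟩ := hall (j + 1) hj
      have h2 : |b ^ (j + 1) * x - b ^ (j + 1) * n| < 1 / (b : ℝ) := by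
        have : b ^ (j + 1) * x - b ^ (j + 1) * n = b * (b ^ j * x - b ^ j * n) := by ring
        rw [this, abs_mul, abs_of_pos hb0]
        calc _ < b * (1 / (b : ℝ) ^ 2) := by gcongr
          _ = _ := by field_simp
      have h3 : (m : ℝ) = b ^ (j + 1) * n := by
        have h4 : |((m - b ^ (j + 1) * n : ℤ) : ℝ)| < 1 := by
          push_cast
          calc |(m : ℝ) - b ^ (j + 1) * n|
              = |(b ^ (j + 1) * x - b ^ (j + 1) * n) + -(b ^ (j + 1) * x - m)| := by
                congr 1; ring
            _ ≤ |b ^ (j + 1) * x - b ^ (j + 1) * n| + |-(b ^ (j + 1) * x - m)| := abs_add_le _ _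
            _ < 1 / b + 1 / (b : ℝ) ^ 2 := by rw [abs_neg]; exact add_lt_add h2 hm
            _ ≤ 1 / 2 + 1 / 2 ^ 2 := by gcongr
            _ < 1 := by norm_num
        have h5 : |m - b ^ (j + 1) * n| < 1 := by exact_mod_cast h4
        have h6 : m - b ^ (j + 1) * n = 0 := Int.abs_lt_one_iff.1 h5
        have h7 : m = b ^ (j + 1) * n := by linarith
        exact_mod_cast h7
      rwa [← h3]
  have hK := key K (by omega)
  obtain ⟨-, h1, h2, -, h3, h4⟩ := mem_fareyBlock.1 hp
  have hd0 : (0 : ℝ) < p.1 := by exact_mod_cast (by omega : 0 < p.1)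
  have hdK : (p.1 : ℝ) < b ^ (K + 1) := by exact_mod_cast h1
  have hc : (b ^ a * (b ^ 2 - 1) : ℕ) * p.2 = n * (p.1 : ℤ) := by
    have h5 : |(((b ^ a * (b ^ 2 - 1) : ℕ) * p.2 - n * (p.1 : ℤ) : ℤ) : ℝ)| < 1 := by
      have e : (((b ^ a * (b ^ 2 - 1) : ℕ) * p.2 - n * (p.1 : ℤ) : ℤ) : ℝ) = p.1 * (x - n) := by
        have hc : ((b ^ a * (b ^ 2 - 1) : ℕ) : ℝ) = b ^ a * ((b : ℝ) ^ 2 - 1) := by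
          rw [Nat.cast_mul, Nat.cast_sub (Nat.one_le_pow _ _ (by omega))]
          push_cast
          ring
        rw [Int.cast_sub, Int.cast_mul, Int.cast_natCast, hc, hx]
        push_cast
        field_simp
      rw [e, abs_mul, abs_of_pos hd0]
      have e2 : b ^ K * x - b ^ K * n = b ^ K * (x - n) := by ring
      rw [e2, abs_mul, abs_of_pos (by positivity : (0 : ℝ) < b ^ K)] at hK
      rw [lt_div_iff₀ (by positivity)] at hK
      calc (p.1 : ℝ) * |x - n| ≤ b ^ (K + 1) * |x - n| := by gcongr
        _ ≤ b ^ K * |x - n| * b ^ 2 := by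
          rw [show (b : ℝ) ^ K * |x - n| * b ^ 2 = b ^ (K + 1) * |x - n| * b by ring]
          exact le_mul_of_one_le_right (by positivity) (by linarith)
        _ < 1 := hK
    have h6 : |((b ^ a * (b ^ 2 - 1) : ℕ) * p.2 - n * (p.1 : ℤ) : ℤ)| < 1 := by exact_mod_cast h5
    have := Int.abs_lt_one_iff.1 h6
    linarith
  have hcop : Nat.Coprime (b ^ a * (b ^ 2 - 1) * p.2) p.1 :=
    Nat.Coprime.mul_left (Nat.Coprime.mul_left ((fareyBlock_coprime hp).1.pow_left a)
      (fareyBlock_coprime hp).2) h4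
  have hdvd : p.1 ∣ b ^ a * (b ^ 2 - 1) * p.2 := by
    rw [← Int.natCast_dvd_natCast]
    refine ⟨n, ?_⟩
    rw [mul_comm (p.1 : ℤ), ← hc]
    push_cast
    ring
  have := Nat.eq_one_of_dvd_coprimes hcop hdvd dvd_rfl
  omega

section
variable {b : ℕ} {μ : ℝ} (hb : 2 ≤ b) (hμ0 : 0 < μ) (hμ1 : μ < 1)
  (hμ : ∀ x : ℝ, ¬ NearInt (1 / (b : ℝ) ^ 4) x → ‖digitSum b x‖ ≤ b * μ ^ 2)
include hb hμ0 hμ1 hμ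

/-- Small denominators: every window of `K + 1` digits saves a constant factor. -/
theorem fareySum_le_small (K r k : ℕ) :
    fareySum b K r k ≤ b ^ r * (b ^ (2 * K + 2) * μ ^ ((r - 1) / (K + 1))) := by
  rw [fareySum_eq hb]
  refine mul_le_mul_of_nonneg_left ?_ (by positivity)
  have h1 : ∀ p ∈ fareyBlock b K,
      ∏ i ∈ Finset.range r, digitRatio b r (p.2 / p.1 + k / ((b : ℝ) ^ 2 - 1)) i
        ≤ μ ^ ((r - 1) / (K + 1)) := by
    intro p hp
    refine (prod_digitRatio_le_prod_blocks hb hμ0 hμ1 hμ r k _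
      (Nat.div_mul_le_self (r - 1) (K + 1))).trans ?_
    calc _ ≤ ∏ l ∈ Finset.range ((r - 1) / (K + 1)), μ := by
          refine Finset.prod_le_prod
            (fun l _ => Finset.prod_nonneg fun j _ => nearWeight_nonneg hμ0.le _) fun l _ => ?_
          obtain ⟨j, hj, hnear⟩ := exists_not_nearInt hb (l * (K + 1)) hp
          calc _ ≤ ∏ j ∈ {j}, nearWeight b μ
                (b ^ j * (b ^ (l * (K + 1)) * (((b : ℝ) ^ 2 - 1) * (p.2 / p.1)))) :=
                Finset.prod_le_prod_of_subset_of_le_one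
                  (Finset.singleton_subset_iff.2 (Finset.mem_range.2 hj))
                  (fun _ _ => nearWeight_nonneg hμ0.le _) fun _ _ _ => nearWeight_le_one hμ1.le _
            _ = μ := by rw [Finset.prod_singleton, nearWeight, if_neg hnear]
      _ = _ := by simp
  calc _ ≤ ∑ p ∈ fareyBlock b K, μ ^ ((r - 1) / (K + 1)) := Finset.sum_le_sum h1
    _ = (fareyBlock b K).card * μ ^ ((r - 1) / (K + 1)) := by simp
    _ ≤ _ := by
        gcongr
        exact_mod_cast card_fareyBlock_le b K

/-- Medium denominators: with `L` disjoint windows, each long enough to separate the fractions,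
the product over all windows is at most the sum of the `L`-th powers. -/
theorem fareySum_le_medium (K r k : ℕ) {L : ℕ} (hL : 0 < L) (h : L * (2 * K + 1) ≤ r - 1) :
    fareySum b K r k ≤ b ^ r * (L * (b * (1 + (b - 1) * μ ^ L) ^ (2 * K + 1))) := by
  rw [fareySum_eq hb]
  refine mul_le_mul_of_nonneg_left ?_ (by positivity)
  have h1 : ∀ p ∈ fareyBlock b K,
      ∏ i ∈ Finset.range r, digitRatio b r (p.2 / p.1 + k / ((b : ℝ) ^ 2 - 1)) i
        ≤ ∑ l ∈ Finset.range L, ∏ j ∈ Finset.range (2 * K + 1), nearWeight b (μ ^ L)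
          (b ^ j * (b ^ (l * (2 * K + 1)) * (((b : ℝ) ^ 2 - 1) * (p.2 / p.1)))) := by
    intro p _
    refine (prod_digitRatio_le_prod_blocks hb hμ0 hμ1 hμ r k _ h).trans ?_
    set A : ℕ → ℝ := fun l => ∏ j ∈ Finset.range (2 * K + 1), nearWeight b μ
          (b ^ j * (b ^ (l * (2 * K + 1)) * (((b : ℝ) ^ 2 - 1) * (p.2 / p.1)))) with hA
    have hA0 : ∀ l, 0 ≤ A l := fun l => Finset.prod_nonneg fun _ _ => nearWeight_nonneg hμ0.le _
    obtain ⟨l₀, hl₀, hmax⟩ := Finset.exists_max_image (Finset.range L) A ⟨0, Finset.mem_range.2 hL⟩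
    have hpow : ∀ l, A l ^ L = ∏ j ∈ Finset.range (2 * K + 1), nearWeight b (μ ^ L)
          (b ^ j * (b ^ (l * (2 * K + 1)) * (((b : ℝ) ^ 2 - 1) * (p.2 / p.1)))) := by
      intro l
      simp only [hA, ← Finset.prod_pow, nearWeight_pow]
    calc ∏ l ∈ Finset.range L, A l ≤ ∏ l ∈ Finset.range L, A l₀ :=
          Finset.prod_le_prod (fun l _ => hA0 l) hmax
      _ = A l₀ ^ L := by simp
      _ ≤ ∑ l ∈ Finset.range L, A l ^ L :=
          Finset.single_le_sum (f := fun l => A l ^ L) (fun l _ => pow_nonneg (hA0 l) L) hl₀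
      _ = _ := Finset.sum_congr rfl fun l _ => hpow l
  calc _ ≤ ∑ p ∈ fareyBlock b K, ∑ l ∈ Finset.range L, ∏ j ∈ Finset.range (2 * K + 1),
          nearWeight b (μ ^ L)
          (b ^ j * (b ^ (l * (2 * K + 1)) * (((b : ℝ) ^ 2 - 1) * (p.2 / p.1)))) :=
        Finset.sum_le_sum h1
    _ = ∑ l ∈ Finset.range L, ∑ p ∈ fareyBlock b K, ∏ j ∈ Finset.range (2 * K + 1),
          nearWeight b (μ ^ L)
          (b ^ j * (b ^ (l * (2 * K + 1)) * (((b : ℝ) ^ 2 - 1) * (p.2 / p.1)))) :=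
        Finset.sum_comm
    _ ≤ ∑ l ∈ Finset.range L, b * ∏ j ∈ Finset.range (2 * K + 1), (1 + (b - 1) * μ ^ L) :=
        Finset.sum_le_sum fun l _ => sum_fareyBlock_nearWeight_le hb K _ (w := fun _ => μ ^ L)
          (fun _ => by positivity) fun _ => pow_le_one₀ hμ0.le hμ1.le
    _ = _ := by simp

/-- The inner digits of a palindrome constrain `2 * T` consecutive digits of the fraction, apart
from the two digits next to the centre. -/
theorem sq_prod_inner_digitRatio_le {K T a r : ℕ} (hT : 1 ≤ T) (hTK : T ≤ K) (har : a + T = r)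
    (k : ℕ) (x : ℝ) :
    (∏ i ∈ Finset.Ico a r, digitRatio b r (x + k / ((b : ℝ) ^ 2 - 1)) i) ^ 2
      ≤ ∏ j ∈ Finset.range (2 * K + 1),
        nearWeight b (if j < 2 * T ∧ j ≠ T - 1 ∧ j ≠ T then μ else 1)
          (b ^ j * (b ^ a * (((b : ℝ) ^ 2 - 1) * x))) := by
  set w : ℕ → ℝ := fun j => nearWeight b μ (b ^ j * (((b : ℝ) ^ 2 - 1) * x)) with hw
  have hw0 : ∀ j, 0 ≤ w j := fun j => nearWeight_nonneg hμ0.le _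
  set F : ℕ → ℝ := fun j => nearWeight b (if j < 2 * T ∧ j ≠ T - 1 ∧ j ≠ T then μ else 1)
          (b ^ j * (b ^ a * (((b : ℝ) ^ 2 - 1) * x))) with hF
  have hFw : ∀ j, (j < 2 * T ∧ j ≠ T - 1 ∧ j ≠ T) → F j = w (a + j) := by
    intro j hj
    simp only [hF, hw, if_pos hj]
    congr 1
    ring
  have hF1 : ∀ j, ¬(j < 2 * T ∧ j ≠ T - 1 ∧ j ≠ T) → F j = 1 := by
    intro j hj
    simp only [hF, if_neg hj]
    unfold nearWeight
    split_ifs <;> rfl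
  have h1 : (∏ i ∈ Finset.Ico a r, digitRatio b r (x + k / ((b : ℝ) ^ 2 - 1)) i) ^ 2
      ≤ ∏ i ∈ Finset.Ico a (r - 1), w i * w (2 * r - 1 - i) := by
    refine sq_prod_Ico_le (fun i => digitRatio_nonneg _ _ _ i)
      (fun i => digitRatio_le_one hb _ _ i) fun i hi => ?_
    rw [Finset.mem_Ico] at hi
    have h2 := norm_digitSum_mul_le hb hμ0 hμ1 hμ (i := i) (r := r) (by omega)
      (x + k / ((b : ℝ) ^ 2 - 1))
    rw [nearWeight_shift hb, nearWeight_shift hb] at h2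
    refine le_of_sq_le_sq ?_ (mul_nonneg (hw0 _) (hw0 _))
    rw [sq, mul_pow]
    have h0 := mul_nonneg (digitRatio_nonneg b r (x + k / ((b : ℝ) ^ 2 - 1)) i)
      (digitRatio_nonneg b r (x + k / ((b : ℝ) ^ 2 - 1)) (i + 1))
    exact mul_le_mul h2.1 h2.2 h0 (sq_nonneg _)
  refine h1.trans (le_of_eq ?_)
  obtain ⟨T', rfl⟩ : ∃ T', T = T' + 1 := ⟨T - 1, by omega⟩
  have e1 : ∏ j ∈ Finset.range (2 * K + 1), F j = ∏ j ∈ Finset.range ((T' + 1) + (T' + 1)), F j := by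
    symm
    refine Finset.prod_subset (Finset.range_subset_range.2 (by omega)) fun j _ hj => hF1 j ?_
    rw [Finset.mem_range] at hj
    omega
  have e2 : ∏ j ∈ Finset.range (T' + 1), F (T' + 1 + j)
      = ∏ j ∈ Finset.range (T' + 1), F (2 * T' + 1 - j) := by
    rw [← Finset.prod_range_reflect]
    refine Finset.prod_congr rfl fun j hj => ?_
    rw [Finset.mem_range] at hj
    congr 1
    omega
  rw [e1, Finset.prod_range_add, e2, ← Finset.prod_mul_distrib, Finset.prod_range_succ,
    hF1 T' (by omega), hF1 (2 * T' + 1 - T') (by omega), one_mul, mul_one,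
    Finset.prod_Ico_eq_prod_range, show r - 1 - a = T' by omega]
  refine Finset.prod_congr rfl fun j hj => ?_
  rw [Finset.mem_range] at hj
  rw [hFw j (by omega), hFw (2 * T' + 1 - j) (by omega)]
  congr 2
  omega

/-- Large denominators: on the few fractions where the product over the `T` inner digits exceeds
`√δ` the other digits are estimated trivially; elsewhere the two outer blocks of `U` digits are
estimated in mean square. -/
theorem fareySum_le_large {K r T U : ℕ} (k : ℕ) (hT : 1 ≤ T) (hTK : T ≤ K) (hr : 2 * U + T = r)
    {δ τ : ℝ} (hδ : 0 < δ) (m : ℕ)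
    (hτ : ∀ n : ℕ, 0 < n → n ≤ b ^ (4 * r + 2) → (n.divisors.card : ℝ) ≤ τ) :
    fareySum b K r k ≤ b ^ r * ((δ⁻¹) ^ m * (b * ((1 + (b - 1) * μ ^ m) ^ (2 * T) *
        b ^ (2 * K + 3 - 2 * T))) + Real.sqrt δ * (b ^ (K + 1) * (b ^ (K + 1) / b ^ U + τ))) := by
  rw [fareySum_eq hb]
  refine mul_le_mul_of_nonneg_left ?_ (by positivity)
  have hb' : (2 : ℝ) ≤ b := by exact_mod_cast hb
  set lam : ℕ → ℝ := fun j => if j < 2 * T ∧ j ≠ T - 1 ∧ j ≠ T then μ else 1 with hlam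
  have hlam0 : ∀ j, 0 ≤ lam j := fun j => by
    simp only [hlam]; split_ifs <;> linarith
  have hlam1 : ∀ j, lam j ≤ 1 := fun j => by
    simp only [hlam]; split_ifs <;> linarith
  set P : ℕ × ℕ → ℝ := fun p => ∏ j ∈ Finset.range (2 * K + 1),
        nearWeight b (lam j) (b ^ j * (b ^ (2 * U) * (((b : ℝ) ^ 2 - 1) * (p.2 / p.1)))) with hP
  have hP0 : ∀ p, 0 ≤ P p := fun p => Finset.prod_nonneg fun j _ => nearWeight_nonneg (hlam0 j) _
  set β : ℝ := k / ((b : ℝ) ^ 2 - 1) with hβ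
  set G : ℕ → ℕ × ℕ → ℝ := fun a p => ∏ i ∈ Finset.range U, digitRatio b r (p.2 / p.1 + β) (a + i)
    with hG
  have hG0 : ∀ a p, 0 ≤ G a p := fun a p => Finset.prod_nonneg fun _ _ => digitRatio_nonneg _ _ _ _
  have hpt : ∀ p ∈ fareyBlock b K, ∏ i ∈ Finset.range r, digitRatio b r (p.2 / p.1 + β) i
      ≤ (δ⁻¹) ^ m * P p ^ m + Real.sqrt δ * ((G 0 p ^ 2 + G U p ^ 2) / 2) := by
    intro p _
    have hnn : 0 ≤ Real.sqrt δ * ((G 0 p ^ 2 + G U p ^ 2) / 2) := by positivity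
    have hnn2 : 0 ≤ (δ⁻¹) ^ m * P p ^ m :=
      mul_nonneg (by positivity) (pow_nonneg (hP0 p) m)
    rcases le_or_gt δ (P p) with h | h
    · have h2 : (1 : ℝ) ≤ (δ⁻¹) ^ m * P p ^ m := by
        rw [← mul_pow]
        apply one_le_pow₀
        rwa [inv_mul_eq_div, one_le_div hδ]
      linarith [prod_digitRatio_le_one hb r (p.2 / p.1 + β) (Finset.range r)]
    · have hin := sq_prod_inner_digitRatio_le hb hμ0 hμ1 hμ hT hTK hr k (p.2 / p.1 : ℝ)
      have hin2 : ∏ i ∈ Finset.Ico (2 * U) r, digitRatio b r (p.2 / p.1 + β) i ≤ Real.sqrt δ :=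
        Real.le_sqrt_of_sq_le (hin.trans h.le)
      have hsplit : ∏ i ∈ Finset.range r, digitRatio b r (p.2 / p.1 + β) i
          = G 0 p * G U p * ∏ i ∈ Finset.Ico (2 * U) r, digitRatio b r (p.2 / p.1 + β) i := by
        rw [← Finset.prod_range_mul_prod_Ico _ (by omega : 2 * U ≤ r), two_mul,
          Finset.prod_range_add]
        simp [hG]
      rw [hsplit]
      calc _ ≤ G 0 p * G U p * Real.sqrt δ :=
            mul_le_mul_of_nonneg_left hin2 (mul_nonneg (hG0 _ _) (hG0 _ _))
        _ ≤ Real.sqrt δ * ((G 0 p ^ 2 + G U p ^ 2) / 2) := by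
            rw [mul_comm]
            refine mul_le_mul_of_nonneg_left ?_ (Real.sqrt_nonneg _)
            nlinarith [sq_nonneg (G 0 p - G U p)]
        _ ≤ _ := by linarith
  have hPsum : ∑ p ∈ fareyBlock b K, P p ^ m
      ≤ b * ((1 + (b - 1) * μ ^ m) ^ (2 * T) * b ^ (2 * K + 3 - 2 * T)) := by
    have e : ∀ p, P p ^ m = ∏ j ∈ Finset.range (2 * K + 1), nearWeight b (lam j ^ m)
        (b ^ j * (b ^ (2 * U) * (((b : ℝ) ^ 2 - 1) * (p.2 / p.1)))) := by
      intro p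
      simp only [hP, ← Finset.prod_pow, nearWeight_pow]
    simp_rw [e]
    refine (sum_fareyBlock_nearWeight_le hb K (2 * U) (w := fun j => lam j ^ m)
      (fun j => pow_nonneg (hlam0 j) m) fun j => pow_le_one₀ (hlam0 j) (hlam1 j)).trans ?_
    refine mul_le_mul_of_nonneg_left ?_ (by positivity)
    set y := 1 + ((b : ℝ) - 1) * μ ^ m with hy
    have hym : 0 ≤ ((b : ℝ) - 1) * μ ^ m := mul_nonneg (by linarith) (by positivity)
    have hy1 : 1 ≤ y := by linarith
    have hle : ∀ j, 1 + ((b : ℝ) - 1) * lam j ^ m ≤ b := fun j => by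
      have : lam j ^ m ≤ 1 := pow_le_one₀ (hlam0 j) (hlam1 j)
      nlinarith
    have hpos : ∀ j, 0 ≤ 1 + ((b : ℝ) - 1) * lam j ^ m := fun j => by
      have : 0 ≤ lam j ^ m := pow_nonneg (hlam0 j) m
      nlinarith
    rw [← Finset.prod_range_mul_prod_Ico _ (by omega : 2 * T ≤ 2 * K + 1)]
    have hA : ∏ j ∈ Finset.range (2 * T), (1 + ((b : ℝ) - 1) * lam j ^ m) ≤ y ^ (2 * T) * b ^ 2 := by
      calc _ ≤ ∏ j ∈ Finset.range (2 * T), (y * ((if j = T - 1 then (b : ℝ) else 1) *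
            (if j = T then (b : ℝ) else 1))) := by
            refine Finset.prod_le_prod (fun j _ => hpos j) fun j hj => ?_
            rw [Finset.mem_range] at hj
            by_cases h1 : j = T - 1
            · rw [if_pos h1, if_neg (by omega), mul_one]
              exact (hle j).trans (le_mul_of_one_le_left (by linarith) hy1)
            · by_cases h2 : j = T
              · rw [if_neg h1, if_pos h2, one_mul]
                exact (hle j).trans (le_mul_of_one_le_left (by linarith) hy1)
              · rw [if_neg h1, if_neg h2, mul_one, mul_one]
                simp only [hlam, if_pos (⟨hj, h1, h2⟩ : j < 2 * T ∧ j ≠ T - 1 ∧ j ≠ T)]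
                exact le_rfl
        _ = y ^ (2 * T) * b ^ 2 := by
            rw [Finset.prod_mul_distrib, Finset.prod_mul_distrib, Finset.prod_ite_eq',
              Finset.prod_ite_eq', if_pos (Finset.mem_range.2 (by omega)),
              if_pos (Finset.mem_range.2 (by omega)), Finset.prod_const, Finset.card_range, sq]
    have hB : ∏ j ∈ Finset.Ico (2 * T) (2 * K + 1), (1 + ((b : ℝ) - 1) * lam j ^ m)
        ≤ b ^ (2 * K + 1 - 2 * T) := by
      calc _ ≤ ∏ j ∈ Finset.Ico (2 * T) (2 * K + 1), (b : ℝ) :=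
            Finset.prod_le_prod (fun j _ => hpos j) fun j _ => hle j
        _ = _ := by simp
    calc _ ≤ y ^ (2 * T) * b ^ 2 * b ^ (2 * K + 1 - 2 * T) :=
          mul_le_mul hA hB (Finset.prod_nonneg fun j _ => hpos j) (by positivity)
      _ = _ := by
          rw [mul_assoc, ← pow_add, show 2 + (2 * K + 1 - 2 * T) = 2 * K + 3 - 2 * T by omega]
  have hG1 := sum_fareyBlock_sq_prod_le (K := K) hb (show 0 + U ≤ r by omega) hτ β
  have hG2 := sum_fareyBlock_sq_prod_le (K := K) hb (show U + U ≤ r by omega) hτ β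
  calc _ ≤ ∑ p ∈ fareyBlock b K,
        ((δ⁻¹) ^ m * P p ^ m + Real.sqrt δ * ((G 0 p ^ 2 + G U p ^ 2) / 2)) := Finset.sum_le_sum hpt
    _ = (δ⁻¹) ^ m * ∑ p ∈ fareyBlock b K, P p ^ m + Real.sqrt δ *
        ((∑ p ∈ fareyBlock b K, G 0 p ^ 2 + ∑ p ∈ fareyBlock b K, G U p ^ 2) / 2) := by
        rw [Finset.sum_add_distrib, Finset.mul_sum, ← Finset.mul_sum _ _ (Real.sqrt δ),
          ← Finset.sum_div, Finset.sum_add_distrib]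
    _ ≤ _ := by
        refine add_le_add (mul_le_mul_of_nonneg_left hPsum (by positivity))
          (mul_le_mul_of_nonneg_left ?_ (Real.sqrt_nonneg _))
        have h1 : ∑ p ∈ fareyBlock b K, G 0 p ^ 2 ≤ b ^ (K + 1) * (b ^ (K + 1) / b ^ U + τ) := hG1
        have h2 : ∑ p ∈ fareyBlock b K, G U p ^ 2 ≤ b ^ (K + 1) * (b ^ (K + 1) / b ^ U + τ) := hG2
        linarith

end

/-! ### The ranges of denominators -/

theorem natCast_pow_eq_exp {b : ℕ} (hb : 2 ≤ b) (n : ℕ) :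
    (b : ℝ) ^ n = Real.exp (Real.log b * n) := by
  have : (0 : ℝ) < b := by positivity
  rw [mul_comm, Real.exp_nat_mul, Real.exp_log this]

theorem exists_one_add_mul_pow_le {A μ t : ℝ} (hμ0 : 0 < μ) (hμ1 : μ < 1) (ht : 1 < t) :
    ∃ m : ℕ, 0 < m ∧ 1 + A * μ ^ m ≤ t := by
  have h1 : Filter.Tendsto (fun m : ℕ => 1 + A * μ ^ m) Filter.atTop (nhds (1 + A * 0)) :=
    ((tendsto_pow_atTop_nhds_zero_of_lt_one hμ0.le hμ1).const_mul A).const_add 1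
  rw [mul_zero, add_zero] at h1
  obtain ⟨m, h2, h3⟩ := ((h1.eventually_lt_const ht).and (Filter.eventually_gt_atTop 0)).exists
  exact ⟨m, h3, h2.le⟩

theorem sqrt_natCast_le (N : ℕ) : Real.sqrt N ≤ N := by
  rw [Real.sqrt_le_left (by positivity)]
  exact_mod_cast Nat.le_self_pow two_ne_zero N

/-- A palindrome with `r` digits on each side of the centre is cut into `T ≈ (1 + ξ) K / 2` inner
digits and two outer blocks of `U` digits; the parity of `r - T` costs at most one digit. -/
theorem exists_block_lengths {ξ : ℝ} (hξ0 : 0 < ξ) (hξ1 : ξ < 1 / 2) {K r : ℕ} (hK : 8 ≤ K)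
    (hKr : K ≤ r) : ∃ T U : ℕ, 1 ≤ T ∧ T ≤ K ∧ 2 * U + T = r ∧ (1 + ξ) * K / 2 ≤ T ∧
      (r : ℝ) / 2 - (1 + ξ) * K / 4 - 1 ≤ U := by
  have hK' : (8 : ℝ) ≤ K := by exact_mod_cast hK
  have hξK : ξ * K ≤ 1 / 2 * K := mul_le_mul_of_nonneg_right hξ1.le (by linarith)
  set T₀ := ⌈(1 + ξ) * K / 2⌉₊ with hT₀
  have hT1 : (1 + ξ) * K / 2 ≤ T₀ := Nat.le_ceil _
  have hT2 : (T₀ : ℝ) < (1 + ξ) * K / 2 + 1 := Nat.ceil_lt_add_one (by positivity)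
  have hT3 : T₀ + 1 ≤ K := by
    have : (T₀ : ℝ) + 1 < K + 1 := by linarith
    have : T₀ + 1 < K + 1 := by exact_mod_cast this
    omega
  have hT4 : 1 ≤ T₀ := by
    have : (0 : ℝ) < T₀ := lt_of_lt_of_le (by positivity) hT1
    exact_mod_cast this
  refine ⟨r - 2 * ((r - T₀) / 2), (r - T₀) / 2, by omega, by omega, by omega,
    hT1.trans (by exact_mod_cast (by omega : T₀ ≤ r - 2 * ((r - T₀) / 2))), ?_⟩
  have h1 : r ≤ 2 * ((r - T₀) / 2) + (T₀ + 1) := by omega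
  have h2 : (r : ℝ) ≤ 2 * ((r - T₀) / 2 : ℕ) + (T₀ + 1) := by exact_mod_cast h1
  linarith

section
variable {b : ℕ} {μ : ℝ} (hb : 2 ≤ b) (hμ0 : 0 < μ) (hμ1 : μ < 1)
  (hμ : ∀ x : ℝ, ¬ NearInt (1 / (b : ℝ) ^ 4) x → ‖digitSum b x‖ ≤ b * μ ^ 2)
include hb

theorem log_base_pos : 0 < Real.log b := Real.log_pos (by exact_mod_cast (by omega : 1 < b))

/-- With at most `N / 2` digits, the trivial estimate `b ^ r` for each fraction suffices. -/
theorem fareySum_bound_short : ∃ C σ : ℝ, 0 < C ∧ 0 < σ ∧ ∀ N r K k : ℕ, 2 * r ≤ N →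
    (K : ℝ) ≤ 2 / 5 * N + 1 →
    fareySum b K r k ≤ C * (b ^ (K + N) * Real.exp (-(σ * Real.sqrt N))) := by
  have hl := log_base_pos hb
  refine ⟨b ^ 3, Real.log b / 10, by positivity, by positivity, fun N r K k hr hK => ?_⟩
  refine (fareySum_le_trivial hb K r k).trans ?_
  simp only [natCast_pow_eq_exp hb, ← Real.exp_add]
  apply Real.exp_le_exp.2
  have hr' : 2 * (r : ℝ) ≤ N := by exact_mod_cast hr
  have hs := sqrt_natCast_le N
  push_cast
  nlinarith

include hμ0 hμ1 hμ

theorem fareySum_bound_small : ∃ c C σ : ℝ, 0 < c ∧ 0 < C ∧ 0 < σ ∧ ∀ N r K k : ℕ, r ≤ N →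
    N ≤ 2 * r → (K : ℝ) + 1 ≤ c * Real.sqrt N →
    fareySum b K r k ≤ C * (b ^ (K + N) * Real.exp (-(σ * Real.sqrt N))) := by
  have hl := log_base_pos hb
  set l := Real.log b with hldef
  have hlam : 0 < -Real.log μ := by have := Real.log_neg hμ0 hμ1; linarith
  set lam := -Real.log μ with hlamdef
  -- the `(r - 1) / (K + 1)` windows, about `√N / (2 c)` of them, have to outweigh the `b ^ (2 K)`
  -- fractions, which forces `4 l c ^ 2 ≤ lam`
  set c := Real.sqrt (lam / (4 * l)) with hc
  have hc0 : 0 < c := Real.sqrt_pos.2 (by positivity)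
  have hcsq : c ^ 2 * (4 * l) = lam := by
    rw [hc, Real.sq_sqrt (by positivity)]
    field_simp
  refine ⟨c, b * μ⁻¹, l * c, hc0, by positivity, by positivity, fun N r K k hr hNr hK => ?_⟩
  refine (fareySum_le_small hb hμ0 hμ1 hμ K r k).trans ?_
  set q := (r - 1) / (K + 1) with hq
  have hq1 : r ≤ (q + 1) * (K + 1) := by
    have := Nat.lt_mul_of_div_lt (Nat.lt_succ_self ((r - 1) / (K + 1))) (Nat.succ_pos K)
    rw [Nat.mul_comm] at this
    simp only [Nat.succ_eq_add_one] at this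
    have h2 : (K + 1) * (q + 1) = (q + 1) * (K + 1) := Nat.mul_comm _ _
    have h3 : r - 1 < (q + 1) * (K + 1) := by
      rw [← h2]
      exact this
    omega
  set s := Real.sqrt N with hs
  have hs2 : s * s = N := Real.mul_self_sqrt (Nat.cast_nonneg N)
  have hspos : 0 < s := by
    by_contra h
    have : s = 0 := le_antisymm (not_lt.1 h) (Real.sqrt_nonneg _)
    rw [this, mul_zero] at hK
    have : (0 : ℝ) ≤ K := Nat.cast_nonneg K
    linarith
  have hq2 : s ≤ 2 * c * (q + 1) := by
    have h1 : (r : ℝ) ≤ ((q : ℝ) + 1) * (K + 1) := by exact_mod_cast hq1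
    have h2 : (N : ℝ) ≤ 2 * r := by exact_mod_cast hNr
    have h3 : ((q : ℝ) + 1) * (K + 1) ≤ (q + 1) * (c * s) := by gcongr
    have h4 : s * s ≤ 2 * c * (q + 1) * s := by nlinarith
    exact le_of_mul_le_mul_right h4 hspos
  have hmu : μ ^ q = μ⁻¹ * Real.exp (-lam * (q + 1)) := by
    have : Real.exp (-lam * (q + 1)) = μ ^ (q + 1) := by
      rw [hlamdef, neg_neg, ← Real.exp_log (pow_pos hμ0 (q + 1)), Real.log_pow]
      congr 1
      push_cast
      ring
    rw [this, pow_succ]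
    field_simp
  have hexp : -lam * (q + 1) ≤ -(2 * l * c * s) := by
    have : 4 * l * c ^ 2 * (q + 1) ≥ 2 * l * c * s := by
      have := mul_le_mul_of_nonneg_left hq2 (by positivity : 0 ≤ 2 * l * c)
      nlinarith
    nlinarith
  rw [hmu]
  have hr' : (r : ℝ) ≤ N := by exact_mod_cast hr
  calc (b : ℝ) ^ r * (b ^ (2 * K + 2) * (μ⁻¹ * Real.exp (-lam * (q + 1))))
      = μ⁻¹ * ((b ^ r * b ^ (2 * K + 2)) * Real.exp (-lam * (q + 1))) := by ring
    _ = μ⁻¹ * Real.exp (l * (r + 2 * K + 2) + -lam * (q + 1)) := by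
        rw [← pow_add, natCast_pow_eq_exp hb, ← hldef, ← Real.exp_add]
        congr 3
        push_cast
        ring
    _ ≤ μ⁻¹ * Real.exp (l * 1 + l * (K + N) + -(l * c * s)) := by
        refine mul_le_mul_of_nonneg_left (Real.exp_le_exp.2 ?_) (by positivity)
        have h1 : l * (K + 1) ≤ l * (c * s) := mul_le_mul_of_nonneg_left hK hl.le
        have h2 : l * r ≤ l * N := mul_le_mul_of_nonneg_left hr' hl.le
        linarith
    _ = b * μ⁻¹ * (b ^ (K + N) * Real.exp (-(l * c * s))) := by
        rw [Real.exp_add, Real.exp_add, mul_one, Real.exp_log (by positivity),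
          natCast_pow_eq_exp hb]
        push_cast
        ring

theorem fareySum_bound_medium {c : ℝ} (hc : 0 < c) : ∃ η C σ : ℝ, 0 < η ∧ 0 < C ∧ 0 < σ ∧
    ∀ N r K k : ℕ, r ≤ N → N ≤ 2 * r → c * Real.sqrt N < (K : ℝ) + 1 → (K : ℝ) + 1 ≤ η * N →
    fareySum b K r k ≤ C * (b ^ (K + N) * Real.exp (-(σ * Real.sqrt N))) := by
  have hl := log_base_pos hb
  set l := Real.log b with hldef
  -- with `L` windows the sum over the fractions is at most about `b ^ (K / 2)`
  obtain ⟨L, hL, hy⟩ := exists_one_add_mul_pow_le (A := b - 1) hμ0 hμ1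
    (Real.one_lt_exp_iff.2 (by positivity : 0 < l / 4))
  have hL' : (1 : ℝ) ≤ L := by exact_mod_cast hL
  refine ⟨1 / (4 * L), L * b ^ 2, l * c / 2, by positivity, by positivity, by positivity,
    fun N r K k hr hNr hK1 hK2 => ?_⟩
  have hfit : L * (2 * K + 1) ≤ r - 1 := by
    have h1 : (L : ℝ) * (2 * K + 2) ≤ r := by
      have h2 : (N : ℝ) ≤ 2 * r := by exact_mod_cast hNr
      have h3 : 4 * L * ((K : ℝ) + 1) ≤ N := by
        calc 4 * L * ((K : ℝ) + 1) ≤ 4 * L * (1 / (4 * L) * N) := by gcongr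
          _ = N := by field_simp
      linarith
    have h4 : L * (2 * K + 2) ≤ r := by exact_mod_cast h1
    have h5 : L * (2 * K + 2) = L * (2 * K + 1) + L := by ring
    omega
  refine (fareySum_le_medium hb hμ0 hμ1 hμ K r k hL hfit).trans ?_
  have hb1 : (0 : ℝ) ≤ (b : ℝ) - 1 := by
    have : (2 : ℝ) ≤ b := by exact_mod_cast hb
    linarith
  have hpow : (1 + ((b : ℝ) - 1) * μ ^ L) ^ (2 * K + 1) ≤ Real.exp (l * (K + 1) / 2) := by
    calc _ ≤ (Real.exp (l / 4)) ^ (2 * K + 1) := by gcongr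
      _ = Real.exp (l / 4 * (2 * K + 1)) := by
          rw [← Real.exp_nat_mul]
          congr 1
          push_cast
          ring
      _ ≤ _ := by
          apply Real.exp_le_exp.2
          nlinarith
  have hr' : (r : ℝ) ≤ N := by exact_mod_cast hr
  calc _ ≤ (b : ℝ) ^ r * (L * (b * Real.exp (l * (K + 1) / 2))) := by gcongr
    _ = L * b * Real.exp (l * r + l * (K + 1) / 2) := by
        rw [natCast_pow_eq_exp hb, Real.exp_add]
        ring
    _ ≤ L * b * Real.exp (l * 1 + l * (K + N) + -(l * c / 2 * Real.sqrt N)) := by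
        refine mul_le_mul_of_nonneg_left (Real.exp_le_exp.2 ?_) (by positivity)
        have h1 : l * (c * Real.sqrt N) ≤ l * (K + 1) := mul_le_mul_of_nonneg_left hK1.le hl.le
        have h2 : l * r ≤ l * N := mul_le_mul_of_nonneg_left hr' hl.le
        linarith
    _ = _ := by
        rw [Real.exp_add, Real.exp_add, mul_one, Real.exp_log (by positivity),
          natCast_pow_eq_exp hb (K + N)]
        push_cast
        ring

set_option maxHeartbeats 400000 in
theorem fareySum_bound_large {η κ : ℝ} (hη : 0 < η) (hκ0 : 0 < κ) (hκ : κ < 2 / 5) :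
    ∃ C σ : ℝ, 0 < C ∧ 0 < σ ∧ ∀ N r K k : ℕ, r ≤ N → N ≤ 2 * r → η * N < (K : ℝ) + 1 →
    (K : ℝ) ≤ κ * N + 1 →
    fareySum b K r k ≤ C * (b ^ (K + N) * Real.exp (-(σ * Real.sqrt N))) := by
  have hl := log_base_pos hb
  have hb' : (2 : ℝ) ≤ b := by exact_mod_cast hb
  set l := Real.log b with hldef
  -- the room that is left by `κ < 2 / 5`
  set ξ : ℝ := (2 - 5 * κ) / 4 with hξ
  have hξ0 : 0 < ξ := by rw [hξ]; linarith
  have hξ1 : ξ < 1 / 2 := by rw [hξ]; linarith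
  obtain ⟨m, hm, hy⟩ := exists_one_add_mul_pow_le (A := b - 1) hμ0 hμ1
    (Real.one_lt_exp_iff.2 (by positivity : 0 < ξ * l / 16))
  have hm' : (0 : ℝ) < m := by exact_mod_cast hm
  -- the inner product is called large when the bound for its square exceeds `exp (-t K)`
  set t : ℝ := ξ * l / (8 * m) with ht
  have ht0 : 0 < t := by positivity
  have htm : t * m = ξ * l / 8 := by rw [ht]; field_simp
  -- the exponent in the divisor bound, small enough not to use up the saving `exp (-t K / 2)`
  set ε : ℝ := t * η / (24 * l) with hε
  have hε0 : 0 < ε := by positivity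
  have hεl : ε * l = t * η / 24 := by rw [hε]; field_simp
  obtain ⟨A, hA0, hA⟩ := exists_card_divisors_le ε hε0
  obtain ⟨N₀, hN₀⟩ := exists_nat_ge (max 10 (9 / η))
  have hN₁ : (10 : ℝ) ≤ N₀ := (le_max_left _ _).trans hN₀
  have hN₂ : 9 / η ≤ N₀ := (le_max_right _ _).trans hN₀
  -- the three rates of decay
  set σ : ℝ := min (3 / 4 * (ξ * l * η)) (min (9 / 10 * ξ * l) (t * η / 4)) with hσ
  have hσ0 : 0 < σ := lt_min (by positivity) (lt_min (by positivity) (by positivity))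
  have hσ1 : σ ≤ 3 / 4 * (ξ * l * η) := min_le_left _ _
  have hσ2 : σ ≤ 9 / 10 * ξ * l := (min_le_right _ _).trans (min_le_left _ _)
  have hσ3 : σ ≤ t * η / 4 := (min_le_right _ _).trans (min_le_right _ _)
  set C : ℝ := Real.exp (l * (N₀ + 3) + σ * N₀) + Real.exp (5 * l) + Real.exp (5 * l)
    + A * Real.exp (l + t) with hC
  refine ⟨C, σ, by positivity, hσ0, fun N r K k hr hNr hK1 hK2 => ?_⟩
  have hr' : (r : ℝ) ≤ N := by exact_mod_cast hr
  have hNr' : (N : ℝ) ≤ 2 * r := by exact_mod_cast hNr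
  have hs := sqrt_natCast_le N
  have hκN : κ * N ≤ 2 / 5 * N := mul_le_mul_of_nonneg_right hκ.le (Nat.cast_nonneg N)
  have hs0 : 0 ≤ Real.sqrt N := Real.sqrt_nonneg _
  have hNn : (0 : ℝ) ≤ N := Nat.cast_nonneg N
  have hE : ∀ u : ℝ, Real.exp (u + l * (K + N) + -(σ * Real.sqrt N))
      = Real.exp u * (b ^ (K + N) * Real.exp (-(σ * Real.sqrt N))) := by
    intro u
    rw [Real.exp_add, Real.exp_add, natCast_pow_eq_exp hb]
    push_cast
    ring
  have hpos : (0 : ℝ) < b ^ (K + N) * Real.exp (-(σ * Real.sqrt N)) := by positivity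
  by_cases hN : N < N₀
  · have hN' : (N : ℝ) ≤ N₀ := by exact_mod_cast hN.le
    calc _ ≤ (b : ℝ) ^ r * b ^ (2 * K + 2) := fareySum_le_trivial hb K r k
      _ = Real.exp (l * (r + 2 * K + 2)) := by
          rw [← pow_add, natCast_pow_eq_exp hb, ← hldef]
          congr 1
          push_cast
          ring
      _ ≤ Real.exp ((l * (N₀ + 3) + σ * N₀) + l * (K + N) + -(σ * Real.sqrt N)) := by
          apply Real.exp_le_exp.2
          have h1 : σ * Real.sqrt N ≤ σ * N₀ := by
            apply mul_le_mul_of_nonneg_left (hs.trans hN') hσ0.le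
          have h2 : (r : ℝ) + 2 * K + 2 ≤ N₀ + 3 + (K + N) := by linarith
          have h3 := mul_le_mul_of_nonneg_left h2 hl.le
          linarith
      _ = Real.exp (l * (N₀ + 3) + σ * N₀) * _ := hE _
      _ ≤ _ := by
          refine mul_le_mul_of_nonneg_right ?_ hpos.le
          rw [hC]
          have : 0 ≤ A * Real.exp (l + t) := by positivity
          linarith [Real.exp_pos (5 * l)]
  have hN' : (N₀ : ℝ) ≤ N := by exact_mod_cast not_lt.1 hN
  have hηN : 9 ≤ η * N := by
    have := (div_le_iff₀ hη).1 (hN₂.trans hN')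
    linarith
  have hK8 : (8 : ℝ) ≤ K := by linarith
  obtain ⟨T, U, hT1, hTK, hrUT, hTgeR, hUR⟩ :=
    exists_block_lengths hξ0 hξ1 (K := K) (r := r) (by exact_mod_cast hK8) (by
      have h1 : (K : ℝ) ≤ r := by linarith
      exact_mod_cast h1)
  have hτ : ∀ n : ℕ, 0 < n → n ≤ b ^ (4 * r + 2) →
      (n.divisors.card : ℝ) ≤ A * Real.exp (t * η * N / 4) := by
    intro n hn0 hn
    refine (hA n hn0.ne').trans ?_
    refine mul_le_mul_of_nonneg_left ?_ hA0.le
    have hnR : (n : ℝ) ≤ (b : ℝ) ^ (4 * r + 2) := by exact_mod_cast hn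
    calc (n : ℝ) ^ ε ≤ ((b : ℝ) ^ (4 * r + 2)) ^ ε := Real.rpow_le_rpow (by positivity) hnR hε0.le
      _ = Real.exp (l * (4 * r + 2) * ε) := by
          rw [natCast_pow_eq_exp hb, ← Real.exp_mul]
          push_cast
          rfl
      _ ≤ Real.exp (t * η * N / 4) := by
          apply Real.exp_le_exp.2
          have : l * (4 * r + 2) * ε = (4 * r + 2) * (t * η / 24) := by rw [← hεl]; ring
          rw [this]
          have h6 : (4 * (r : ℝ) + 2) ≤ 6 * N := by linarith
          have h7 := mul_le_mul_of_nonneg_right h6 (by positivity : 0 ≤ t * η / 24)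
          linarith
  refine (fareySum_le_large hb hμ0 hμ1 hμ k hT1 hTK hrUT
    (Real.exp_pos (-(t * K))) m hτ).trans ?_
  have hsq : Real.sqrt (Real.exp (-(t * K))) = Real.exp (-(t * K) / 2) := (Real.exp_half _).symm
  have hinv : (Real.exp (-(t * K)))⁻¹ ^ m = Real.exp (ξ * l / 8 * K) := by
    rw [← Real.exp_neg, neg_neg, ← Real.exp_nat_mul, ← htm]
    congr 1
    ring
  have hTR : (T : ℝ) ≤ K := by exact_mod_cast hTK
  have hb1 : (0 : ℝ) ≤ (b : ℝ) - 1 := by linarith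
  have hyT : (1 + ((b : ℝ) - 1) * μ ^ m) ^ (2 * T) ≤ Real.exp (ξ * l / 8 * K) := by
    calc _ ≤ (Real.exp (ξ * l / 16)) ^ (2 * T) := by gcongr
      _ = Real.exp (ξ * l / 8 * T) := by
          rw [← Real.exp_nat_mul]
          congr 1
          push_cast
          ring
      _ ≤ _ := by
          apply Real.exp_le_exp.2
          gcongr
  have hTcast : ((2 * K + 3 - 2 * T : ℕ) : ℝ) = 2 * K + 3 - 2 * T := by
    rw [Nat.cast_sub (by omega)]
    push_cast
    ring
  -- the fractions at which the inner product is large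
  have term1 : (b : ℝ) ^ r * (Real.exp (ξ * l / 8 * K) * (b * (Real.exp (ξ * l / 8 * K) *
        b ^ (2 * K + 3 - 2 * T))))
      ≤ Real.exp (5 * l) * (b ^ (K + N) * Real.exp (-(σ * Real.sqrt N))) := by
    rw [← hE, natCast_pow_eq_exp hb, natCast_pow_eq_exp hb, hTcast, ← hldef]
    nth_rewrite 1 [← Real.exp_log (by positivity : (0 : ℝ) < b)]
    simp only [← Real.exp_add]
    apply Real.exp_le_exp.2
    rw [← hldef]
    have h1 : σ * Real.sqrt N ≤ 3 / 4 * (ξ * l * η) * N :=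
      mul_le_mul hσ1 hs hs0 (by positivity)
    have h2 : ξ * l * (η * N) ≤ ξ * l * (K + 1) := by
      apply mul_le_mul_of_nonneg_left hK1.le; positivity
    have h3 : l * ((1 + ξ) * K) ≤ l * (2 * T) := by
      apply mul_le_mul_of_nonneg_left _ hl.le; linarith
    have h4 : l * r ≤ l * N := mul_le_mul_of_nonneg_left hr' hl.le
    have h5 : ξ * l ≤ 1 / 2 * l := mul_le_mul_of_nonneg_right hξ1.le hl.le
    linarith
  -- the mean square, diagonal terms
  have term2 : (b : ℝ) ^ r * (Real.exp (-(t * K) / 2) * (b ^ (K + 1) * (b ^ (K + 1) / b ^ U)))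
      ≤ Real.exp (5 * l) * (b ^ (K + N) * Real.exp (-(σ * Real.sqrt N))) := by
    have h0 : Real.exp (-(t * K) / 2) ≤ 1 := by
      apply Real.exp_le_one_iff.2
      have : 0 ≤ t * K := by positivity
      linarith
    calc _ ≤ (b : ℝ) ^ r * (1 * (b ^ (K + 1) * (b ^ (K + 1) / b ^ U))) := by gcongr
      _ = Real.exp (l * (r + 2 * K + 2 - U)) := by
          rw [one_mul, ← mul_div_assoc, ← mul_div_assoc]
          simp only [natCast_pow_eq_exp hb, ← Real.exp_add, ← Real.exp_sub]
          congr 1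
          push_cast
          ring
      _ ≤ _ := by
          rw [← hE]
          apply Real.exp_le_exp.2
          have h1 : σ * Real.sqrt N ≤ 9 / 10 * ξ * l * N :=
            mul_le_mul hσ2 hs hs0 (by positivity)
          have h2 : (5 + ξ) / 4 * K ≤ (5 + ξ) / 4 * (κ * N + 1) := by
            apply mul_le_mul_of_nonneg_left hK2; positivity
          have h3 : (5 + ξ) / 4 * κ ≤ 1 / 2 - 9 / 10 * ξ := by
            rw [hξ]
            nlinarith [sq_nonneg (5 * κ - 2)]
          have h4 : (5 + ξ) / 4 * κ * N ≤ (1 / 2 - 9 / 10 * ξ) * N :=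
            mul_le_mul_of_nonneg_right h3 hNn
          have h5 : (r : ℝ) + 2 * K + 2 - U ≤ 5 + (K + N) - 9 / 10 * ξ * N := by linarith
          have h6 := mul_le_mul_of_nonneg_left h5 hl.le
          linarith
  -- the mean square, off-diagonal terms
  have term3 : (b : ℝ) ^ r * (Real.exp (-(t * K) / 2) *
        (b ^ (K + 1) * (A * Real.exp (t * η * N / 4))))
      ≤ A * Real.exp (l + t) * (b ^ (K + N) * Real.exp (-(σ * Real.sqrt N))) := by
    calc _ = A * Real.exp (l * r + -(t * K) / 2 + l * (K + 1) + t * η * N / 4) := by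
          simp only [natCast_pow_eq_exp hb, Real.exp_add]
          push_cast
          ring
      _ ≤ A * Real.exp (l + t + l * (K + N) + -(σ * Real.sqrt N)) := by
          refine mul_le_mul_of_nonneg_left (Real.exp_le_exp.2 ?_) hA0.le
          have h1 : σ * Real.sqrt N ≤ t * η / 4 * N := mul_le_mul hσ3 hs hs0 (by positivity)
          have h2 : t * (η * N) ≤ t * (K + 1) := mul_le_mul_of_nonneg_left hK1.le ht0.le
          have h4 : l * r ≤ l * N := mul_le_mul_of_nonneg_left hr' hl.le
          linarith
      _ = _ := by rw [hE, mul_assoc]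
  rw [hsq, hinv]
  calc _ ≤ (b : ℝ) ^ r * (Real.exp (ξ * l / 8 * K) * (b * (Real.exp (ξ * l / 8 * K) *
        b ^ (2 * K + 3 - 2 * T))) + Real.exp (-(t * K) / 2) * (b ^ (K + 1) *
        (b ^ (K + 1) / b ^ U + A * Real.exp (t * η * N / 4)))) := by gcongr
    _ = (b : ℝ) ^ r * (Real.exp (ξ * l / 8 * K) * (b * (Real.exp (ξ * l / 8 * K) *
        b ^ (2 * K + 3 - 2 * T)))) +
        (b : ℝ) ^ r * (Real.exp (-(t * K) / 2) * (b ^ (K + 1) * (b ^ (K + 1) / b ^ U))) +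
        (b : ℝ) ^ r * (Real.exp (-(t * K) / 2) *
        (b ^ (K + 1) * (A * Real.exp (t * η * N / 4)))) := by ring
    _ ≤ _ := by
        have := Real.exp_pos (l * (N₀ + 3) + σ * N₀)
        have h8 := mul_pos this hpos
        rw [hC, add_mul, add_mul, add_mul]
        linarith

end

/-- The average of the palindromic products over fractions with denominators of size `b ^ K`,
uniformly in the number `r ≤ N` of digits, for `b ^ K` up to a power of `b ^ N` below `2 / 5`. -/
theorem exists_fareySum_le {b : ℕ} (hb : 2 ≤ b) {κ : ℝ} (hκ0 : 0 < κ) (hκ : κ < 2 / 5) :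
    ∃ C σ : ℝ, 0 < C ∧ 0 < σ ∧ ∀ N r K k : ℕ, r ≤ N → (K : ℝ) ≤ κ * N + 1 →
    fareySum b K r k ≤ C * (b ^ (K + N) * Real.exp (-(σ * Real.sqrt N))) := by
  have hb' : (2 : ℝ) ≤ b := by exact_mod_cast hb
  obtain ⟨μ, hμ0, hμ1, hμ⟩ := exists_norm_digitSum_le b hb (1 / (b : ℝ) ^ 4) (by positivity) (by
    rw [div_le_div_iff₀ (by positivity) (by norm_num)]
    have : (2 : ℝ) ^ 4 ≤ (b : ℝ) ^ 4 := pow_le_pow_left₀ (by norm_num) hb' 4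
    linarith)
  obtain ⟨C₁, σ₁, hC₁, hσ₁, h₁⟩ := fareySum_bound_short hb
  obtain ⟨c, C₂, σ₂, hc, hC₂, hσ₂, h₂⟩ := fareySum_bound_small hb hμ0 hμ1 hμ
  obtain ⟨η, C₃, σ₃, hη, hC₃, hσ₃, h₃⟩ := fareySum_bound_medium hb hμ0 hμ1 hμ hc
  obtain ⟨C₄, σ₄, hC₄, hσ₄, h₄⟩ := fareySum_bound_large hb hμ0 hμ1 hμ hη hκ0 hκ
  set σ := min (min σ₁ σ₂) (min σ₃ σ₄) with hσ
  have hmono : ∀ N r K k : ℕ, ∀ C' σ' : ℝ, 0 < C' → C' ≤ C₁ + C₂ + C₃ + C₄ → σ ≤ σ' →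
      fareySum b K r k ≤ C' * (b ^ (K + N) * Real.exp (-(σ' * Real.sqrt N))) →
      fareySum b K r k ≤
        (C₁ + C₂ + C₃ + C₄) * (b ^ (K + N) * Real.exp (-(σ * Real.sqrt N))) := by
    intro N r K k C' σ' hC' hCle hσle h
    refine h.trans ?_
    gcongr
  refine ⟨C₁ + C₂ + C₃ + C₄, σ, by positivity, by positivity, fun N r K k hr hK => ?_⟩
  rcases le_total (2 * r) N with hrN | hrN
  · refine hmono N r K k C₁ σ₁ hC₁ (by linarith) ((min_le_left _ _).trans (min_le_left _ _))
      (h₁ N r K k hrN (hK.trans ?_))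
    gcongr
  rcases le_or_gt ((K : ℝ) + 1) (c * Real.sqrt N) with hKc | hKc
  · exact hmono N r K k C₂ σ₂ hC₂ (by linarith) ((min_le_left _ _).trans (min_le_right _ _))
      (h₂ N r K k hr hrN hKc)
  rcases le_or_gt ((K : ℝ) + 1) (η * N) with hKη | hKη
  · exact hmono N r K k C₃ σ₃ hC₃ (by linarith) ((min_le_right _ _).trans (min_le_left _ _))
      (h₃ N r K k hr hrN hKc hKη)
  · exact hmono N r K k C₄ σ₄ hC₄ (by linarith) ((min_le_right _ _).trans (min_le_right _ _))
      (h₄ N r K k hr hrN hKη hK)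

/-! ### From discrepancies to exponential sums -/

theorem cube_sub_pos {b : ℕ} (hb : 2 ≤ b) : 0 < b ^ 3 - b := by
  rw [cube_sub_eq]
  have : 1 < b ^ 2 := Nat.one_lt_pow two_ne_zero (by omega)
  exact Nat.mul_pos (by omega) (by omega)

theorem sum_Ico_expChar_div {q : ℕ} (hq : 0 < q) (m : ℤ) :
    ∑ h ∈ Finset.Ico 1 q, expChar (h * m / q) = (if (q : ℤ) ∣ m then (q : ℂ) else 0) - 1 := by
  have h1 := sum_expChar_div q hq m
  rw [Finset.range_eq_Ico, Finset.sum_eq_sum_Ico_succ_bot hq] at h1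
  rw [← h1]
  simp [expChar_zero]

/-- The indicator of coprimality to `B`, expanded into additive characters modulo `B`. -/
theorem coprime_indicator_eq {B : ℕ} (hB : 0 < B) (n : ℕ) :
    (if Nat.Coprime n B then (1 : ℂ) else 0) =
      ∑ c ∈ (Finset.range B).filter (fun c => Nat.Coprime c B), (1 / (B : ℂ)) *
        ∑ k ∈ Finset.range B, expChar (k * ((n : ℤ) - (c : ℤ) : ℤ) / B) := by
  have hB' : (B : ℂ) ≠ 0 := by exact_mod_cast hB.ne'
  have h1 : ∀ c ∈ (Finset.range B).filter (fun c => Nat.Coprime c B), (1 / (B : ℂ)) *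
        ∑ k ∈ Finset.range B, expChar (k * ((n : ℤ) - (c : ℤ) : ℤ) / B)
        = if c = n % B then 1 else 0 := by
    intro c hc
    rw [Finset.mem_filter, Finset.mem_range] at hc
    rw [sum_expChar_div B hB]
    have h2 : (B : ℤ) ∣ (n : ℤ) - c ↔ c = n % B := by
      rw [← Nat.modEq_iff_dvd, Nat.ModEq, Nat.mod_eq_of_lt hc.1]
    by_cases h3 : c = n % B
    · rw [if_pos h3, if_pos (h2.2 h3), one_div_mul_cancel hB']
    · rw [if_neg h3, if_neg (mt h2.1 h3), mul_zero]
  rw [Finset.sum_congr rfl h1, Finset.sum_ite_eq']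
  congr 1
  rw [Finset.mem_filter, Finset.mem_range, eq_iff_iff, Nat.coprime_iff_gcd_eq_one,
    Nat.coprime_iff_gcd_eq_one, ← Nat.gcd_rec, Nat.gcd_comm]
  exact ⟨fun h => ⟨Nat.mod_lt _ hB, h⟩, fun h => h.2⟩

/-- The frequencies with `h = 0` make up the expected main term, so only `h ≠ 0` occurs. -/
theorem palindromeDiscrepancy_le_sum_norm {b q N : ℕ} (hb : 2 ≤ b) (hq : 0 < q) {y : ℝ}
    (hy : y < (b : ℝ) ^ (2 * N + 2)) (a : ℤ) :
    palindromeDiscrepancy b y a q ≤ (1 / q) * ∑ h ∈ Finset.Ico 1 q,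
      ∑ k ∈ Finset.range (b ^ 3 - b), ∑ M ∈ Finset.range (N + 1),
        ‖palindromeExpSum b M ⌊y⌋₊ (h / q + k / ((b ^ 3 - b : ℕ) : ℝ))‖ := by
  set B := b ^ 3 - b with hBdef
  have hB : 0 < B := cube_sub_pos hb
  have hB' : (B : ℂ) ≠ 0 := by exact_mod_cast hB.ne'
  have hq' : (q : ℂ) ≠ 0 := by exact_mod_cast hq.ne'
  set Y := ⌊y⌋₊ with hY
  set I := (Finset.range B).filter (fun c => Nat.Coprime c B) with hI
  have hIcard : (I.card : ℝ) ≤ B := by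
    exact_mod_cast (Finset.card_filter_le _ _).trans (Finset.card_range B).le
  -- the discrepancy as a sum over palindromes
  have e1 : (((coprimePalindromesInClass b y a q).card : ℝ)
      - ((coprimePalindromesUpTo b y).card : ℝ) / q : ℝ)
      = ∑ n ∈ coprimePalindromesUpTo b y,
        ((if (q : ℤ) ∣ (n : ℤ) - a then (1 : ℝ) else 0) - 1 / q) := by
    rw [Finset.sum_sub_distrib, Finset.sum_const, nsmul_eq_mul, mul_one_div,
      coprimePalindromesInClass, Finset.card_filter]
    push_cast
    congr 1
    refine Finset.sum_congr rfl fun n _ => ?_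
    have : (n : ℤ) ≡ a [ZMOD q] ↔ (q : ℤ) ∣ (n : ℤ) - a := by
      rw [Int.modEq_comm, Int.modEq_iff_dvd]
    by_cases h : (q : ℤ) ∣ (n : ℤ) - a
    · rw [if_pos h, if_pos (this.2 h)]
    · rw [if_neg h, if_neg (mt this.1 h)]
  have e2 : ∀ n : ℕ, (((if (q : ℤ) ∣ (n : ℤ) - a then (1 : ℝ) else 0) - 1 / q : ℝ) : ℂ)
      = (1 / q) * ∑ h ∈ Finset.Ico 1 q, expChar (h * ((n : ℤ) - a : ℤ) / q) := by
    intro n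
    rw [sum_Ico_expChar_div hq]
    push_cast
    split_ifs
    · push_cast
      field_simp
    · push_cast
      ring
  have e3 : ((∑ n ∈ coprimePalindromesUpTo b y,
        ((if (q : ℤ) ∣ (n : ℤ) - a then (1 : ℝ) else 0) - 1 / q) : ℝ) : ℂ)
      = ∑ M ∈ Finset.range (N + 1), ∑ h ∈ Finset.Ico 1 q, ∑ c ∈ I, ∑ k ∈ Finset.range B,
        ((1 / (q : ℂ)) * (1 / (B : ℂ)) * expChar (-(h * a / q) - k * c / B)) *
          palindromeExpSum b M Y (h / q + k / (B : ℝ)) := by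
    rw [sum_coprimePalindromesUpTo hb hy]
    push_cast
    refine Finset.sum_congr rfl fun M _ => ?_
    calc _ = ∑ n ∈ (paddedPalindromes b M).filter (· ≤ Y),
          ((1 / (q : ℂ)) * ∑ h ∈ Finset.Ico 1 q, expChar (h * ((n : ℤ) - a : ℤ) / q)) *
            (if Nat.Coprime n B then (1 : ℂ) else 0) := by
          rw [← Finset.filter_filter, Finset.sum_filter]
          refine Finset.sum_congr rfl fun n _ => ?_
          rw [← e2]
          push_cast
          split_ifs <;> simp
      _ = ∑ n ∈ (paddedPalindromes b M).filter (· ≤ Y), ∑ h ∈ Finset.Ico 1 q, ∑ c ∈ I,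
          ∑ k ∈ Finset.range B,
          ((1 / (q : ℂ)) * (1 / (B : ℂ)) * expChar (-(h * a / q) - k * c / B)) *
            expChar (n * (h / q + k / (B : ℝ))) := by
          refine Finset.sum_congr rfl fun n _ => ?_
          rw [coprime_indicator_eq hB, ← hI, Finset.mul_sum (Finset.Ico 1 q), Finset.sum_mul]
          refine Finset.sum_congr rfl fun h _ => ?_
          rw [Finset.mul_sum]
          refine Finset.sum_congr rfl fun c _ => ?_
          rw [Finset.mul_sum, Finset.mul_sum]
          refine Finset.sum_congr rfl fun k _ => ?_
          have : expChar (h * ((n : ℤ) - a : ℤ) / q) * expChar (k * ((n : ℤ) - (c : ℤ) : ℤ) / B)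
              = expChar (-(h * a / q) - k * c / B) * expChar (n * (h / q + k / (B : ℝ))) := by
            rw [← expChar_add, ← expChar_add]
            congr 1
            push_cast
            ring
          rw [mul_mul_mul_comm, this]
          ring
      _ = _ := by
          rw [Finset.sum_comm]
          refine Finset.sum_congr rfl fun h _ => ?_
          rw [Finset.sum_comm]
          refine Finset.sum_congr rfl fun c _ => ?_
          rw [Finset.sum_comm]
          refine Finset.sum_congr rfl fun k _ => ?_
          rw [palindromeExpSum, Finset.mul_sum]
  have hterm : ∀ M h c k : ℕ,
      ‖((1 / (q : ℂ)) * (1 / (B : ℂ)) * expChar (-(h * a / q) - k * c / B)) *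
          palindromeExpSum b M Y (h / q + k / (B : ℝ))‖
      = (1 / q) * (1 / B) * ‖palindromeExpSum b M Y (h / q + k / (B : ℝ))‖ := by
    intro M h c k
    rw [norm_mul, norm_mul, norm_expChar]
    simp
  rw [palindromeDiscrepancy, e1, ← Real.norm_eq_abs, ← Complex.norm_real, e3]
  calc _ ≤ ∑ M ∈ Finset.range (N + 1), ∑ h ∈ Finset.Ico 1 q, ∑ c ∈ I, ∑ k ∈ Finset.range B,
        (1 / q : ℝ) * (1 / B) * ‖palindromeExpSum b M Y (h / q + k / (B : ℝ))‖ := by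
        refine norm_sum_le_of_le _ fun M _ => norm_sum_le_of_le _ fun h _ =>
          norm_sum_le_of_le _ fun c _ => norm_sum_le_of_le _ fun k _ => (hterm M h c k).le
    _ = (I.card / B : ℝ) * ((1 / q) * ∑ h ∈ Finset.Ico 1 q,
      ∑ k ∈ Finset.range B, ∑ M ∈ Finset.range (N + 1),
        ‖palindromeExpSum b M Y (h / q + k / (B : ℝ))‖) := by
        rw [Finset.sum_comm, Finset.mul_sum, Finset.mul_sum]
        refine Finset.sum_congr rfl fun h _ => ?_
        rw [Finset.sum_comm (s := Finset.range B)]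
        simp only [Finset.sum_const, nsmul_eq_mul, Finset.mul_sum]
        refine Finset.sum_congr rfl fun M _ => Finset.sum_congr rfl fun k _ => ?_
        ring
    _ ≤ _ := by
        refine mul_le_of_le_one_left ?_ ?_
        · refine mul_nonneg (by positivity) (Finset.sum_nonneg fun _ _ => Finset.sum_nonneg
            fun _ _ => Finset.sum_nonneg fun _ _ => norm_nonneg _)
        · rw [div_le_one (by exact_mod_cast hB)]
          exact hIcard

/-- A majorant, uniform in the cut-off, for the exponential sums over the palindromes that are
coprime to `b ^ 3 - b` and have at most `2 * N + 1` digits. -/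
noncomputable def palindromeMajorant (b N : ℕ) (θ : ℝ) : ℝ :=
  ∑ k ∈ Finset.range (b ^ 3 - b), ∑ M ∈ Finset.range (N + 1),
    b ^ 2 * (1 + ∑ r ∈ Finset.range M,
      palindromeProduct b r (b ^ (M - r) * (θ + k / ((b ^ 3 - b : ℕ) : ℝ))))

theorem palindromeMajorant_nonneg (b N : ℕ) (θ : ℝ) : 0 ≤ palindromeMajorant b N θ :=
  Finset.sum_nonneg fun _ _ => Finset.sum_nonneg fun _ _ => mul_nonneg (by positivity)
    (add_nonneg zero_le_one (Finset.sum_nonneg fun _ _ => palindromeProduct_nonneg _ _ _))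

theorem maxPalindromeDiscrepancy_le {b q N : ℕ} (hb : 2 ≤ b) (hq : 0 < q) {x : ℝ}
    (hx : x < (b : ℝ) ^ (2 * N + 2)) :
    maxPalindromeDiscrepancy b x q ≤
      (1 / q) * ∑ h ∈ Finset.Ico 1 q, palindromeMajorant b N (h / q) := by
  have : Nonempty (Set.Iic x) := ⟨⟨x, Set.mem_Iic.2 le_rfl⟩⟩
  refine ciSup_le fun y => ciSup_le fun a =>
    (palindromeDiscrepancy_le_sum_norm hb hq (lt_of_le_of_lt y.2 hx) a).trans ?_
  refine mul_le_mul_of_nonneg_left (Finset.sum_le_sum fun h _ => ?_) (by positivity)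
  exact Finset.sum_le_sum fun k _ => Finset.sum_le_sum fun M _ => norm_palindromeExpSum_le b hb _ _ _

/-- Every fraction `h / q` reduces to some `h' / d` with `q = m d`; the factor `1 / m` sums to a
logarithm. -/
theorem sum_fractions_le {b X J : ℕ} (hb : 2 ≤ b) (hX : X < b ^ J) {F : ℝ → ℝ}
    (hF : ∀ θ, 0 ≤ F θ) :
    ∑ q ∈ (Finset.Icc 1 X).filter (fun q => Nat.Coprime q (b ^ 3 - b)),
        (1 / (q : ℝ)) * ∑ h ∈ Finset.Ico 1 q, F (h / q)
      ≤ (1 + Real.log X) * ∑ K ∈ Finset.range J, ∑ p ∈ fareyBlock b K,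
        (1 / (p.1 : ℝ)) * F (p.2 / p.1) := by
  set S : Finset (Σ _ : ℕ, ℕ) := ((Finset.Icc 1 X).filter
    (fun q => Nat.Coprime q (b ^ 3 - b))).sigma fun q => Finset.Ico 1 q with hS
  set T : Finset (ℕ × Σ _ : ℕ, ℕ × ℕ) :=
    Finset.Icc 1 X ×ˢ (Finset.range J).sigma fun K => fareyBlock b K with hT
  set g : (ℕ × Σ _ : ℕ, ℕ × ℕ) → ℝ := fun t =>
    (1 / (t.1 : ℝ)) * ((1 / (t.2.2.1 : ℝ)) * F (t.2.2.2 / t.2.2.1)) with hg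
  have hg0 : ∀ t, 0 ≤ g t := fun t =>
    mul_nonneg (by positivity) (mul_nonneg (by positivity) (hF _))
  -- `(q, h)` goes to `m = gcd (h, q)` and the reduced fraction, listed under its size `K`
  set ψ : (Σ _ : ℕ, ℕ) → (ℕ × Σ _ : ℕ, ℕ × ℕ) := fun s =>
    (Nat.gcd s.2 s.1, ⟨Nat.log b (s.1 / Nat.gcd s.2 s.1),
      (s.1 / Nat.gcd s.2 s.1, s.2 / Nat.gcd s.2 s.1)⟩) with hψ
  have hinj : Set.InjOn ψ S := by
    rintro ⟨q, h⟩ - ⟨q', h'⟩ - heq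
    simp only [hψ, Prod.mk.injEq, Sigma.mk.injEq, heq_eq_eq] at heq
    obtain ⟨h1, -, h2, h3⟩ := heq
    have e1 : q = q' := by
      rw [← Nat.div_mul_cancel (Nat.gcd_dvd_right h q),
        ← Nat.div_mul_cancel (Nat.gcd_dvd_right h' q'), h2, h1]
    have e2 : h = h' := by
      rw [← Nat.div_mul_cancel (Nat.gcd_dvd_left h q),
        ← Nat.div_mul_cancel (Nat.gcd_dvd_left h' q'), h3, h1]
    subst e1 e2
    rfl
  have hmaps : S.image ψ ⊆ T := by
    intro t ht
    obtain ⟨⟨q, h⟩, hs, rfl⟩ := Finset.mem_image.1 ht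
    simp only [hS, Finset.mem_sigma, Finset.mem_filter, Finset.mem_Icc, Finset.mem_Ico] at hs
    obtain ⟨⟨⟨hq1, hqX⟩, hqc⟩, hh1, hhq⟩ := hs
    have hg : 0 < Nat.gcd h q := Nat.gcd_pos_of_pos_left _ (by omega)
    have hd : 0 < q / Nat.gcd h q :=
      Nat.div_pos (Nat.le_of_dvd (by omega) (Nat.gcd_dvd_right h q)) hg
    have hh : 0 < h / Nat.gcd h q :=
      Nat.div_pos (Nat.le_of_dvd (by omega) (Nat.gcd_dvd_left h q)) hg
    have hlt : h / Nat.gcd h q < q / Nat.gcd h q :=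
      Nat.div_lt_div_of_lt_of_dvd (Nat.gcd_dvd_right h q) hhq
    have hdX : q / Nat.gcd h q ≤ X := (Nat.div_le_self _ _).trans hqX
    have hlog1 : b ^ Nat.log b (q / Nat.gcd h q) ≤ q / Nat.gcd h q :=
      Nat.pow_log_le_self b hd.ne'
    simp only [hT, hψ, Finset.mem_product, Finset.mem_Icc, Finset.mem_sigma, Finset.mem_range]
    refine ⟨⟨hg, (Nat.le_of_dvd (by omega) (Nat.gcd_dvd_right h q)).trans hqX⟩, ?_, ?_⟩
    · exact (Nat.pow_lt_pow_iff_right (by omega : 1 < b)).1 ((hlog1.trans hdX).trans_lt hX)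
    · rw [mem_fareyBlock]
      exact ⟨hlog1, Nat.lt_pow_succ_log_self (by omega) _, by dsimp only; omega,
        hqc.coprime_dvd_left (Nat.div_dvd_of_dvd (Nat.gcd_dvd_right h q)), hlt,
        Nat.coprime_div_gcd_div_gcd hg⟩
  have hval : ∀ s ∈ S, (1 / (s.1 : ℝ)) * F (s.2 / s.1) = g (ψ s) := by
    rintro ⟨q, h⟩ hs
    simp only [hS, Finset.mem_sigma, Finset.mem_filter, Finset.mem_Icc, Finset.mem_Ico] at hs
    have hg0 : 0 < Nat.gcd h q := Nat.gcd_pos_of_pos_left _ (by omega)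
    set m := Nat.gcd h q with hm
    have hq : (q : ℝ) = m * (q / m : ℕ) := by
      exact_mod_cast (Nat.mul_div_cancel' (Nat.gcd_dvd_right h q)).symm
    have hh : (h : ℝ) = m * (h / m : ℕ) := by
      exact_mod_cast (Nat.mul_div_cancel' (Nat.gcd_dvd_left h q)).symm
    have hm0 : (m : ℝ) ≠ 0 := by exact_mod_cast hg0.ne'
    simp only [hg, hψ, ← hm]
    rw [hh, hq, mul_div_mul_left _ _ hm0, ← mul_assoc, one_div_mul_one_div]
  have hharm : ∑ m ∈ Finset.Icc 1 X, (1 / (m : ℝ)) ≤ 1 + Real.log X := by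
    have h1 := harmonic_le_one_add_log X
    rw [harmonic_eq_sum_Icc] at h1
    push_cast at h1
    simpa only [one_div] using h1
  calc _ = ∑ s ∈ S, (1 / (s.1 : ℝ)) * F (s.2 / s.1) := by
        rw [hS, Finset.sum_sigma]
        exact Finset.sum_congr rfl fun q _ => Finset.mul_sum _ _ _
    _ = ∑ s ∈ S, g (ψ s) := Finset.sum_congr rfl hval
    _ = ∑ t ∈ S.image ψ, g t := (Finset.sum_image hinj).symm
    _ ≤ ∑ t ∈ T, g t := Finset.sum_le_sum_of_subset_of_nonneg hmaps fun t _ _ => hg0 t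
    _ = (∑ m ∈ Finset.Icc 1 X, (1 / (m : ℝ))) * ∑ K ∈ Finset.range J, ∑ p ∈ fareyBlock b K,
        (1 / (p.1 : ℝ)) * F (p.2 / p.1) := by
        rw [hT, Finset.sum_product, Finset.sum_mul]
        refine Finset.sum_congr rfl fun m _ => ?_
        rw [Finset.sum_sigma, Finset.mul_sum]
        exact Finset.sum_congr rfl fun K _ => by rw [Finset.mul_sum]
    _ ≤ _ := mul_le_mul_of_nonneg_right hharm (Finset.sum_nonneg fun K _ => Finset.sum_nonneg
        fun p _ => mul_nonneg (by positivity) (hF _))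

/-- Multiplication by a power of `b` permutes the reduced fractions with a given denominator. -/
theorem sum_palindromeProduct_mul_le {b : ℕ} (hb : 2 ≤ b) (K r k t : ℕ) :
    ∑ p ∈ fareyBlock b K, palindromeProduct b r
        (b ^ (t + 1) * (p.2 / p.1 + k / ((b ^ 3 - b : ℕ) : ℝ)))
      ≤ fareySum b K r (b ^ t * k) := by
  have hb' : (2 : ℝ) ≤ b := by exact_mod_cast hb
  set ψ : ℕ × ℕ → ℕ × ℕ := fun p => (p.1, b ^ (t + 1) * p.2 % p.1) with hψ
  have hinj : Set.InjOn ψ (fareyBlock b K) := by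
    rintro ⟨d, h⟩ hp ⟨d', h'⟩ hp' heq
    simp only [hψ, Prod.mk.injEq] at heq
    obtain ⟨rfl, h2⟩ := heq
    have h3 : h ≡ h' [MOD d] :=
      Nat.ModEq.cancel_left_of_coprime ((fareyBlock_coprime hp).1.pow_left (t + 1)).symm h2
    rw [h3.eq_of_lt_of_lt (mem_fareyBlock.1 hp).2.2.2.2.1 (mem_fareyBlock.1 hp').2.2.2.2.1]
  have hmaps : (fareyBlock b K).image ψ ⊆ fareyBlock b K := by
    intro p hp
    obtain ⟨⟨d, h⟩, hq, rfl⟩ := Finset.mem_image.1 hp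
    obtain ⟨h1, h2, h3, h4, h5, h6⟩ := mem_fareyBlock.1 hq
    refine mem_fareyBlock.2 ⟨h1, h2, h3, h4, Nat.mod_lt _ (by dsimp only at h3 ⊢; omega), ?_⟩
    simp only [hψ]
    rw [Nat.coprime_iff_gcd_eq_one, ← Nat.gcd_rec, Nat.gcd_comm]
    exact Nat.Coprime.mul_left ((fareyBlock_coprime hq).1.pow_left (t + 1)) h6
  have hval : ∀ p ∈ fareyBlock b K, palindromeProduct b r
        (b ^ (t + 1) * (p.2 / p.1 + k / ((b ^ 3 - b : ℕ) : ℝ)))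
      = palindromeProduct b r ((ψ p).2 / (ψ p).1 + (b ^ t * k : ℕ) / ((b : ℝ) ^ 2 - 1)) := by
    intro p hp
    have hd : (p.1 : ℝ) ≠ 0 := by
      have := (mem_fareyBlock.1 hp).2.2.1
      positivity
    have hB : ((b ^ 3 - b : ℕ) : ℝ) = b * ((b : ℝ) ^ 2 - 1) := by
      rw [cube_sub_eq, Nat.cast_mul, Nat.cast_sub (Nat.one_le_pow _ _ (by omega))]
      push_cast
      ring
    have hb1 : (b : ℝ) ^ 2 - 1 ≠ 0 := by nlinarith
    have hb0 : (b : ℝ) ≠ 0 := by linarith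
    have hdiv : (b : ℝ) ^ (t + 1) * p.2 = p.1 * ((b ^ (t + 1) * p.2 / p.1 : ℕ) : ℝ)
        + ((b ^ (t + 1) * p.2 % p.1 : ℕ) : ℝ) := by
      exact_mod_cast (Nat.div_add_mod _ _).symm
    rw [← palindromeProduct_add_int b r ((ψ p).2 / (ψ p).1 + (b ^ t * k : ℕ) / ((b : ℝ) ^ 2 - 1))
      ((b ^ (t + 1) * p.2 / p.1 : ℕ) : ℤ)]
    congr 1
    rw [mul_add, ← mul_div_assoc, hdiv, hB, Int.cast_natCast]
    simp only [hψ]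
    rw [Nat.cast_mul, Nat.cast_pow, pow_succ]
    field_simp
    ring
  rw [Finset.sum_congr rfl hval, fareySum,
    ← Finset.sum_image (f := fun p : ℕ × ℕ => palindromeProduct b r
      (p.2 / p.1 + (b ^ t * k : ℕ) / ((b : ℝ) ^ 2 - 1))) hinj]
  exact Finset.sum_le_sum_of_subset_of_nonneg hmaps fun _ _ _ => palindromeProduct_nonneg _ _ _

theorem sum_fareyBlock_majorant_le {b N K : ℕ} (hb : 2 ≤ b) {V : ℝ}
    (hV : ∀ r k : ℕ, r ≤ N → fareySum b K r k ≤ b ^ K * V) :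
    ∑ p ∈ fareyBlock b K, (1 / (p.1 : ℝ)) * palindromeMajorant b N (p.2 / p.1)
      ≤ (b ^ 3 - b : ℕ) * b ^ 2 * ((N + 1) ^ 2 * V) := by
  have hb0 : (0 : ℝ) < b := by positivity
  have hbK : (0 : ℝ) < (b : ℝ) ^ K := by positivity
  set B := b ^ 3 - b with hB
  have hV0 : 0 ≤ V := by
    have h1 : 0 ≤ fareySum b K 0 0 := Finset.sum_nonneg fun _ _ => palindromeProduct_nonneg _ _ _
    exact nonneg_of_mul_nonneg_right (h1.trans (hV 0 0 (Nat.zero_le _))) hbK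
  have hone : ∑ p ∈ fareyBlock b K, (1 : ℝ) ≤ b ^ K * V := by
    have := hV 0 0 (Nat.zero_le _)
    simpa only [fareySum, palindromeProduct_zero] using this
  have h1 : ∑ p ∈ fareyBlock b K, palindromeMajorant b N (p.2 / p.1)
      = ∑ k ∈ Finset.range B, ∑ M ∈ Finset.range (N + 1), b ^ 2 *
        (∑ p ∈ fareyBlock b K, (1 : ℝ) + ∑ r ∈ Finset.range M, ∑ p ∈ fareyBlock b K,
          palindromeProduct b r (b ^ (M - r) * (p.2 / p.1 + k / (B : ℝ)))) := by
    simp only [palindromeMajorant]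
    rw [Finset.sum_comm]
    refine Finset.sum_congr rfl fun k _ => ?_
    rw [Finset.sum_comm]
    refine Finset.sum_congr rfl fun M _ => ?_
    rw [← Finset.mul_sum, Finset.sum_add_distrib, Finset.sum_comm (s := Finset.range M)]
  calc _ ≤ ∑ p ∈ fareyBlock b K, (1 / (b : ℝ) ^ K) * palindromeMajorant b N (p.2 / p.1) := by
        refine Finset.sum_le_sum fun p hp => mul_le_mul_of_nonneg_right ?_
          (palindromeMajorant_nonneg _ _ _)
        apply one_div_le_one_div_of_le hbK
        exact_mod_cast (mem_fareyBlock.1 hp).1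
    _ = (1 / (b : ℝ) ^ K) * ∑ k ∈ Finset.range B, ∑ M ∈ Finset.range (N + 1), b ^ 2 *
        (∑ p ∈ fareyBlock b K, (1 : ℝ) + ∑ r ∈ Finset.range M, ∑ p ∈ fareyBlock b K,
          palindromeProduct b r (b ^ (M - r) * (p.2 / p.1 + k / (B : ℝ)))) := by
        rw [← Finset.mul_sum, h1]
    _ ≤ (1 / (b : ℝ) ^ K) * ∑ k ∈ Finset.range B, ∑ M ∈ Finset.range (N + 1), b ^ 2 *
        (b ^ K * V + ∑ r ∈ Finset.range N, b ^ K * V) := by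
        refine mul_le_mul_of_nonneg_left ?_ (by positivity)
        refine Finset.sum_le_sum fun k _ => Finset.sum_le_sum fun M hM => ?_
        refine mul_le_mul_of_nonneg_left (add_le_add hone ?_) (by positivity)
        have hMN := Finset.mem_range.1 hM
        calc _ ≤ ∑ r ∈ Finset.range M, (b : ℝ) ^ K * V := by
              refine Finset.sum_le_sum fun r hr => ?_
              have hrM := Finset.mem_range.1 hr
              -- `r < M`, so the shift `k / (b ^ 3 - b)` is multiplied by `b` at least once
              obtain ⟨t, ht⟩ : ∃ t, M - r = t + 1 := ⟨M - r - 1, by omega⟩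
              rw [ht]
              exact (sum_palindromeProduct_mul_le hb K r k t).trans (hV _ _ (by omega))
          _ ≤ _ := Finset.sum_le_sum_of_subset_of_nonneg
              (Finset.range_subset_range.2 (by omega)) fun _ _ _ => by positivity
    _ = _ := by
        simp only [Finset.sum_const, Finset.card_range, nsmul_eq_mul]
        push_cast
        field_simp
        ring

/-! ### A lower bound for the number of palindromes -/

/-- The padded palindromes whose central digit is `1`. -/
def centralOnePalindromes (b : ℕ) : ℕ → Finset ℕ
  | 0 => {1}
  | R + 1 => (Finset.range b ×ˢ centralOnePalindromes b R).image
      fun p => p.1 * (1 + b ^ (2 * R + 2)) + b * p.2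

theorem centralOnePalindromes_subset {b : ℕ} (hb : 2 ≤ b) (R : ℕ) :
    centralOnePalindromes b R ⊆ paddedPalindromes b R := by
  induction R with
  | zero =>
    intro n hn
    rw [centralOnePalindromes, Finset.mem_singleton] at hn
    rw [paddedPalindromes, Finset.mem_range]
    omega
  | succ R ih => exact Finset.image_subset_image (Finset.product_subset_product_right ih)

theorem card_centralOnePalindromes (b R : ℕ) : (centralOnePalindromes b R).card = b ^ R := by
  induction R with
  | zero => rfl
  | succ R ih =>
    rw [centralOnePalindromes, Finset.card_image_of_injOn, Finset.card_product, Finset.card_range,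
      ih, pow_succ']
    rintro ⟨d, m⟩ h1 ⟨d', m'⟩ h2 h3
    simp only [Finset.coe_product, Set.mem_prod, Finset.mem_coe, Finset.mem_range] at h1 h2
    obtain ⟨rfl, rfl⟩ := peel_injective h1.1 h2.1 h3
    rfl

theorem sq_modEq_one {b : ℕ} (hb : 2 ≤ b) : b ^ 2 ≡ 1 [MOD b ^ 2 - 1] := by
  have h : 1 ≤ b ^ 2 := Nat.one_le_pow _ _ (by omega)
  exact ((Nat.modEq_iff_dvd' h).2 dvd_rfl).symm

theorem peel_modEq {b : ℕ} (hb : 2 ≤ b) (R d m : ℕ) :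
    d * (1 + b ^ (2 * R + 2)) + b * m ≡ 2 * d + b * m [MOD b ^ 2 - 1] := by
  have h1 : b ^ (2 * R + 2) ≡ 1 [MOD b ^ 2 - 1] := by
    have := (sq_modEq_one hb).pow (R + 1)
    rwa [one_pow, ← pow_mul, show 2 * (R + 1) = 2 * R + 2 by ring] at this
  have h2 : d * (1 + b ^ (2 * R + 2)) ≡ d * (1 + 1) [MOD b ^ 2 - 1] :=
    (h1.add_left 1).mul_left d
  have := h2.add_right (b * m)
  rwa [show d * (1 + 1) = 2 * d by ring] at this

/-- As `b ^ 2 ≡ 1`, each outer digit occurs twice with the same coefficient modulo `b ^ 2 - 1`, and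
only the central digit contributes an odd multiple of a power of `b`. -/
theorem centralOnePalindromes_modEq {b R n : ℕ} (hb : 2 ≤ b) (hn : n ∈ centralOnePalindromes b R) :
    ∃ s, n ≡ b ^ R + 2 * s [MOD b ^ 2 - 1] := by
  induction R generalizing n with
  | zero =>
    rw [centralOnePalindromes, Finset.mem_singleton] at hn
    exact ⟨0, by rw [hn]; rfl⟩
  | succ R ih =>
    simp only [centralOnePalindromes, Finset.mem_image, Finset.mem_product, Finset.mem_range,
      Prod.exists] at hn
    obtain ⟨d, m, ⟨-, hm⟩, rfl⟩ := hn
    obtain ⟨s, hs⟩ := ih hm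
    refine ⟨d + b * s, (peel_modEq hb R d m).trans ?_⟩
    have := (hs.mul_left b).add_left (2 * d)
    rwa [show 2 * d + b * (b ^ R + 2 * s) = b ^ (R + 1) + 2 * (d + b * s) by ring] at this

/-- With central digit `1` and first digit `1`, the second and third digits can be chosen so that
the palindrome is congruent to a power of `b` modulo `b ^ 2 - 1`. -/
theorem exists_digits_coprime {b R m : ℕ} (hb : 2 ≤ b) (hm : m ∈ centralOnePalindromes b R) :
    ∃ d₁ d₂ : ℕ, d₁ < b ∧ d₂ < b ∧ Nat.Coprime (1 * (1 + b ^ (2 * (R + 2) + 2)) +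
      b * (d₁ * (1 + b ^ (2 * (R + 1) + 2)) + b * (d₂ * (1 + b ^ (2 * R + 2)) + b * m)))
      (b ^ 3 - b) := by
  obtain ⟨s, hs⟩ := centralOnePalindromes_modEq hb hm
  set Q := b ^ 2 - 1 with hQ
  have hb2 : 1 < b ^ 2 := Nat.one_lt_pow two_ne_zero (by omega)
  have hQ0 : 0 < Q := by omega
  -- the two free digits are those of `e ≡ -(1 + b s)`, which cancels the even part
  set e := (Q - 1) * (1 + b * s) % Q with he
  have heQ : e < b ^ 2 := (Nat.mod_lt _ hQ0).trans_le (by omega)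
  have hsum : 1 + e + b * s ≡ 0 [MOD Q] := by
    have h1 : e ≡ (Q - 1) * (1 + b * s) [MOD Q] := Nat.mod_modEq _ _
    have h2 := h1.add_right (1 + b * s)
    have h3 : (Q - 1) * (1 + b * s) + (1 + b * s) = Q * (1 + b * s) := by
      obtain ⟨q, hq⟩ : ∃ q, Q = q + 1 := ⟨Q - 1, by omega⟩
      rw [hq, Nat.add_sub_cancel]
      ring
    rw [h3] at h2
    have h4 : Q * (1 + b * s) ≡ 0 [MOD Q] := (Nat.modEq_zero_iff_dvd).2 (Dvd.intro _ rfl)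
    have h5 := h2.trans h4
    rwa [show e + (1 + b * s) = 1 + e + b * s by ring] at h5
  refine ⟨e / b, e % b, ?_, Nat.mod_lt _ (by omega), ?_⟩
  · rw [Nat.div_lt_iff_lt_mul (by omega), ← sq]
    exact heQ
  set n₂ := e % b * (1 + b ^ (2 * R + 2)) + b * m with hn₂
  set n₁ := e / b * (1 + b ^ (2 * (R + 1) + 2)) + b * n₂ with hn₁
  set n := 1 * (1 + b ^ (2 * (R + 2) + 2)) + b * n₁ with hn
  rw [cube_sub_eq, Nat.coprime_mul_iff_right]
  constructor
  · have : n = 1 + b * (b ^ (2 * (R + 2) + 1) + n₁) := by rw [hn]; ring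
    rw [this]
    simp
  · have c2 : n₂ ≡ 2 * (e % b) + b * (b ^ R + 2 * s) [MOD Q] :=
      (peel_modEq hb R _ _).trans ((hs.mul_left b).add_left _)
    have c1 : n₁ ≡ 2 * (e / b) + b * (2 * (e % b) + b * (b ^ R + 2 * s)) [MOD Q] :=
      (peel_modEq hb _ _ _).trans ((c2.mul_left b).add_left _)
    have c0 : n ≡ 2 * 1 + b * (2 * (e / b) + b * (2 * (e % b) + b * (b ^ R + 2 * s))) [MOD Q] :=
      (peel_modEq hb _ _ _).trans ((c1.mul_left b).add_left _)
    have key : n ≡ b ^ (R + 1) [MOD Q] := by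
      have hbb := sq_modEq_one hb
      have e1 : 2 * 1 + b * (2 * (e / b) + b * (2 * (e % b) + b * (b ^ R + 2 * s)))
          = (2 * 1 + 2 * (b * (e / b))) + b ^ 2 * (2 * (e % b) + b ^ (R + 1) + 2 * (b * s)) := by
        ring
      have e2 : (2 * 1 + 2 * (b * (e / b))) + 1 * (2 * (e % b) + b ^ (R + 1) + 2 * (b * s))
          = 2 * (1 + e + b * s) + b ^ (R + 1) := by
        have := Nat.div_add_mod e b
        linarith
      rw [e1] at c0
      refine c0.trans (((hbb.mul_right _).add_left _).trans ?_)
      rw [e2]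
      have := (hsum.mul_left 2).add_right (b ^ (R + 1))
      simpa using this
    rw [Nat.coprime_iff_gcd_eq_one, key.gcd_eq]
    refine Nat.Coprime.pow_left _ ?_
    have h6 : Nat.Coprime b (b ^ 2 - 1) := by
      have h7 : b ^ 2 = (b ^ 2 - 1) + 1 := by omega
      have h8 : Nat.Coprime (b ^ 2) (b ^ 2 - 1) := by
        conv_lhs => rw [h7]
        simp
      exact Nat.Coprime.coprime_dvd_left (dvd_pow_self b two_ne_zero) h8
    exact h6

/-- Completing each padded palindrome with central digit `1` by three outer digits gives enough
palindromes coprime to `b ^ 3 - b`. -/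
theorem pow_le_card_coprimePalindromesUpTo {b N : ℕ} (hb : 2 ≤ b) {x : ℝ}
    (hx : (b : ℝ) ^ (2 * N) ≤ x) :
    (b : ℝ) ^ N ≤ b ^ 4 * ((coprimePalindromesUpTo b x).card : ℝ) := by
  have hb1 : (1 : ℝ) ≤ b := by exact_mod_cast (by omega : 1 ≤ b)
  rcases lt_or_ge N 4 with hN | hN
  · have h1 : 1 ∈ coprimePalindromesUpTo b x := by
      rw [mem_coprimePalindromesUpTo, mem_coprimePalindromes_iff hb]
      refine ⟨⟨0, ?_, Nat.coprime_one_left _⟩, ?_⟩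
      · rw [paddedPalindromes, Finset.mem_range]
        omega
      · rw [Nat.cast_one]
        exact (one_le_pow₀ hb1).trans hx
    have h2 : (1 : ℝ) ≤ ((coprimePalindromesUpTo b x).card : ℝ) := by
      exact_mod_cast Finset.card_pos.2 ⟨1, h1⟩
    calc (b : ℝ) ^ N ≤ b ^ 4 := pow_le_pow_right₀ hb1 hN.le
      _ ≤ _ := le_mul_of_one_le_right (by positivity) h2
  · obtain ⟨R, rfl⟩ : ∃ R, N = R + 4 := ⟨N - 4, by omega⟩
    have hex : ∀ m : ℕ, ∃ d₁ d₂ : ℕ, m ∈ centralOnePalindromes b R → d₁ < b ∧ d₂ < b ∧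
        Nat.Coprime (1 * (1 + b ^ (2 * (R + 2) + 2)) + b * (d₁ * (1 + b ^ (2 * (R + 1) + 2)) +
          b * (d₂ * (1 + b ^ (2 * R + 2)) + b * m))) (b ^ 3 - b) := by
      intro m
      by_cases hm : m ∈ centralOnePalindromes b R
      · obtain ⟨d₁, d₂, h⟩ := exists_digits_coprime hb hm
        exact ⟨d₁, d₂, fun _ => h⟩
      · exact ⟨0, 0, fun h => absurd h hm⟩
    choose d₁ d₂ hd using hex
    have hcard : (centralOnePalindromes b R).card ≤ (coprimePalindromesUpTo b x).card := by
      refine Finset.card_le_card_of_injOn (fun m => 1 * (1 + b ^ (2 * (R + 2) + 2)) +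
        b * (d₁ m * (1 + b ^ (2 * (R + 1) + 2)) +
          b * (d₂ m * (1 + b ^ (2 * R + 2)) + b * m))) ?_ ?_
      · intro m hm
        obtain ⟨h1, h2, h3⟩ := hd m hm
        have hmem := mem_paddedPalindromes_succ (b := b) (by omega : 1 < b)
          (mem_paddedPalindromes_succ h1
            (mem_paddedPalindromes_succ h2 (centralOnePalindromes_subset hb R hm)))
        rw [Finset.mem_coe, mem_coprimePalindromesUpTo, mem_coprimePalindromes_iff hb]
        refine ⟨⟨_, hmem, h3⟩, le_trans ?_ hx⟩
        have h4 := (paddedPalindromes_lt hmem).le.trans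
          (Nat.pow_le_pow_right (by omega : 0 < b)
            (by omega : 2 * (R + 1 + 1 + 1) + 1 ≤ 2 * (R + 4)))
        exact_mod_cast h4
      · intro m hm m' hm' heq
        obtain ⟨h1, h2, -⟩ := hd m hm
        obtain ⟨h1', h2', -⟩ := hd m' hm'
        obtain ⟨-, e1⟩ := peel_injective (by omega : 1 < b) (by omega : 1 < b) heq
        obtain ⟨-, e2⟩ := peel_injective h1 h1' e1
        exact (peel_injective h2 h2' e2).2
    rw [card_centralOnePalindromes] at hcard
    rw [pow_add, mul_comm]
    gcongr
    exact_mod_cast hcard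

/-! ### The level of distribution -/

theorem exists_pow_bounds {b : ℕ} (hb : 2 ≤ b) {x : ℝ} (hx : 1 ≤ x) :
    ∃ N : ℕ, (b : ℝ) ^ (2 * N) ≤ x ∧ x < (b : ℝ) ^ (2 * N + 2) := by
  have hb1 : (1 : ℝ) < b := by exact_mod_cast (by omega : 1 < b)
  obtain ⟨n, h1, h2⟩ := exists_nat_pow_near hx (by nlinarith : (1 : ℝ) < (b : ℝ) ^ 2)
  refine ⟨n, by rwa [pow_mul], ?_⟩
  rwa [show 2 * n + 2 = 2 * (n + 1) by ring, pow_mul]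

theorem add_two_pow_four_le {σ : ℝ} (hσ : 0 < σ) (N : ℕ) :
    ((N : ℝ) + 2) ^ 4 ≤ Nat.factorial 8 * (2 / σ) ^ 8 * Real.exp σ *
      Real.exp (σ / 2 * Real.sqrt N) := by
  set s := Real.sqrt N with hs
  have hs0 : 0 ≤ s := Real.sqrt_nonneg _
  have hs2 : s ^ 2 = N := Real.sq_sqrt (Nat.cast_nonneg N)
  have h1 : ((N : ℝ) + 2) ^ 4 ≤ (s + 2) ^ 8 := by
    calc ((N : ℝ) + 2) ^ 4 ≤ ((s + 2) ^ 2) ^ 4 := by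
          apply pow_le_pow_left₀ (by positivity)
          nlinarith
      _ = _ := by ring
  have h2 := Real.pow_div_factorial_le_exp (σ / 2 * (s + 2)) (by positivity) 8
  have h3 : (s + 2) ^ 8 = (2 / σ) ^ 8 * (σ / 2 * (s + 2)) ^ 8 := by
    rw [← mul_pow]
    congr 1
    field_simp
  rw [div_le_iff₀ (by positivity)] at h2
  calc _ ≤ (2 / σ) ^ 8 * (σ / 2 * (s + 2)) ^ 8 := h1.trans h3.le
    _ ≤ (2 / σ) ^ 8 * (Real.exp (σ / 2 * (s + 2)) * Nat.factorial 8) := by gcongr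
    _ = _ := by
        rw [show σ / 2 * (s + 2) = σ + σ / 2 * s by ring, Real.exp_add]
        ring

/-- The bound in terms of the number of digits. The factor `(N + 2) ^ 4` comes from the reduction to
lowest terms, the number of sizes `K`, and the two sums over digits; it is absorbed by halving `σ`. -/
theorem exists_sum_discrepancy_le {b : ℕ} (hb : 2 ≤ b) {κ : ℝ} (hκ0 : 0 < κ) (hκ : κ < 2 / 5) :
    ∃ C σ : ℝ, 0 < C ∧ 0 < σ ∧ ∀ (N : ℕ) (x : ℝ) (X : ℕ), x < (b : ℝ) ^ (2 * N + 2) →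
      (X : ℝ) ≤ (b : ℝ) ^ (κ * N + 1) →
      ∑ q ∈ (Finset.Icc 1 X).filter (fun q => Nat.Coprime q (b ^ 3 - b)),
          maxPalindromeDiscrepancy b x q ≤ C * (b ^ N * Real.exp (-(σ * Real.sqrt N))) := by
  obtain ⟨C, σ, hC, hσ, hF⟩ := exists_fareySum_le hb hκ0 hκ
  have hb1 : (1 : ℝ) < b := by exact_mod_cast (by omega : 1 < b)
  have hl := log_base_pos hb
  set B : ℝ := ((b ^ 3 - b : ℕ) : ℝ) with hB
  have hB0 : 0 < B := by rw [hB]; exact_mod_cast cube_sub_pos hb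
  set E : ℝ := Nat.factorial 8 * (2 / σ) ^ 8 * Real.exp σ with hE
  have hE0 : 0 < E := by positivity
  refine ⟨(1 + Real.log b) * (B * b ^ 2 * C) * E, σ / 2, by positivity, by positivity,
    fun N x X hx hX => ?_⟩
  have hNn : (0 : ℝ) ≤ N := Nat.cast_nonneg N
  set J := Nat.log b X + 1 with hJ
  have hXJ : X < b ^ J := Nat.lt_pow_succ_log_self (by omega) X
  -- every exponent that occurs is in the admissible range
  have hK : ∀ K < J, (K : ℝ) ≤ κ * N + 1 := by
    intro K hKJ
    rcases Nat.eq_zero_or_pos X with h0 | h0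
    · have : K = 0 := by
        rw [hJ, h0, Nat.log_zero_right] at hKJ
        omega
      rw [this, Nat.cast_zero]
      positivity
    · have h1 : b ^ K ≤ X :=
        (Nat.pow_le_pow_right (by omega) (by omega : K ≤ Nat.log b X)).trans
          (Nat.pow_log_le_self b h0.ne')
      have h2 : (b : ℝ) ^ (K : ℝ) ≤ (b : ℝ) ^ (κ * N + 1) := by
        rw [Real.rpow_natCast]
        exact le_trans (by exact_mod_cast h1) hX
      exact (Real.rpow_le_rpow_left_iff hb1).1 h2
  have hJN : (J : ℝ) ≤ N + 2 := by
    have := hK (Nat.log b X) (by omega)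
    have h2 : κ * N ≤ 1 * N := mul_le_mul_of_nonneg_right (by linarith) hNn
    rw [hJ]
    push_cast
    linarith
  have hlogX : 1 + Real.log X ≤ (1 + Real.log b) * (N + 2) := by
    have h1 : Real.log X ≤ Real.log b * (N + 2) := by
      rcases Nat.eq_zero_or_pos X with h0 | h0
      · rw [h0, Nat.cast_zero, Real.log_zero]
        positivity
      · calc Real.log X ≤ Real.log ((b : ℝ) ^ J) :=
              Real.log_le_log (by exact_mod_cast h0) (by exact_mod_cast hXJ.le)
          _ = Real.log b * J := by rw [Real.log_pow, mul_comm]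
          _ ≤ _ := by gcongr
    nlinarith
  set V : ℝ := C * (b ^ N * Real.exp (-(σ * Real.sqrt N))) with hV
  have hV0 : 0 ≤ V := by positivity
  have hblock : ∀ K ∈ Finset.range J, ∑ p ∈ fareyBlock b K,
      (1 / (p.1 : ℝ)) * palindromeMajorant b N (p.2 / p.1) ≤ B * b ^ 2 * ((N + 1) ^ 2 * V) := by
    intro K hKJ
    refine sum_fareyBlock_majorant_le hb fun r k hr => ?_
    refine (hF N r K k hr (hK K (Finset.mem_range.1 hKJ))).trans (le_of_eq ?_)
    rw [hV, pow_add]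
    ring
  have hpoly := add_two_pow_four_le hσ N
  have hexp : Real.exp (σ / 2 * Real.sqrt N) * Real.exp (-(σ * Real.sqrt N))
      = Real.exp (-(σ / 2 * Real.sqrt N)) := by
    rw [← Real.exp_add]
    congr 1
    ring
  calc _ ≤ ∑ q ∈ (Finset.Icc 1 X).filter (fun q => Nat.Coprime q (b ^ 3 - b)),
        (1 / (q : ℝ)) * ∑ h ∈ Finset.Ico 1 q, palindromeMajorant b N (h / q) := by
        refine Finset.sum_le_sum fun q hq => maxPalindromeDiscrepancy_le hb ?_ hx
        rw [Finset.mem_filter, Finset.mem_Icc] at hq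
        exact hq.1.1
    _ ≤ (1 + Real.log X) * ∑ K ∈ Finset.range J, ∑ p ∈ fareyBlock b K,
        (1 / (p.1 : ℝ)) * palindromeMajorant b N (p.2 / p.1) :=
        sum_fractions_le hb hXJ (palindromeMajorant_nonneg b N)
    _ ≤ ((1 + Real.log b) * (N + 2)) * ∑ K ∈ Finset.range J, B * b ^ 2 * ((N + 1) ^ 2 * V) := by
        refine mul_le_mul hlogX (Finset.sum_le_sum hblock) ?_ (by positivity)
        exact Finset.sum_nonneg fun K _ => Finset.sum_nonneg fun p _ =>
          mul_nonneg (by positivity) (palindromeMajorant_nonneg _ _ _)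
    _ = ((1 + Real.log b) * (N + 2)) * (J * (B * b ^ 2 * ((N + 1) ^ 2 * V))) := by
        rw [Finset.sum_const, Finset.card_range, nsmul_eq_mul]
    _ ≤ ((1 + Real.log b) * (N + 2)) * ((N + 2) * (B * b ^ 2 * ((N + 2) ^ 2 * V))) := by
        gcongr
        norm_num
    _ = (1 + Real.log b) * (B * b ^ 2) * V * ((N : ℝ) + 2) ^ 4 := by ring
    _ ≤ (1 + Real.log b) * (B * b ^ 2) * V * (E * Real.exp (σ / 2 * Real.sqrt N)) := by
        gcongr
    _ = (1 + Real.log b) * (B * b ^ 2 * C) * E *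
        (b ^ N * (Real.exp (σ / 2 * Real.sqrt N) * Real.exp (-(σ * Real.sqrt N)))) := by
        rw [hV]
        ring
    _ = _ := by rw [hexp]

theorem mainTheorem2 (b : ℕ) (hb : 2 ≤ b) (ε : ℝ) (hε : 0 < ε) :
    ∃ σ : ℝ, 0 < σ ∧ ∃ C : ℝ, 0 < C ∧ ∀ x : ℝ, 1 ≤ x →
      ∑ q ∈ (Finset.Icc 1 ⌊x ^ ((1 : ℝ) / 5 - ε)⌋₊).filter (fun q => Nat.Coprime q (b ^ 3 - b)),
          maxPalindromeDiscrepancy b x q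
        ≤ C * (((coprimePalindromesUpTo b x).card : ℝ) /
            Real.exp (σ * Real.sqrt (Real.log x))) := by
  have hb1 : (1 : ℝ) < b := by exact_mod_cast (by omega : 1 < b)
  have hl := log_base_pos hb
  -- `x ^ (1 / 5 - ε)` is less than `b ^ (κ (N + 1))` when `x < b ^ (2 N + 2)`
  set κ : ℝ := max (1 / 5) (2 / 5 - 2 * ε) with hκdef
  have hκ0 : 0 < κ := lt_of_lt_of_le (by norm_num) (le_max_left _ _)
  have hκ1 : κ < 2 / 5 := max_lt (by norm_num) (by linarith)
  have hκε : 1 / 5 - ε ≤ κ / 2 := by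
    have : 2 / 5 - 2 * ε ≤ κ := le_max_right _ _
    linarith
  obtain ⟨C, σ, hC, hσ, h⟩ := exists_sum_discrepancy_le hb hκ0 hκ1
  set a := Real.sqrt (2 * Real.log b) with ha
  have ha0 : 0 < a := Real.sqrt_pos.2 (by positivity)
  refine ⟨σ / a, by positivity, C * b ^ 4 * Real.exp σ, by positivity, fun x hx => ?_⟩
  obtain ⟨N, hN1, hN2⟩ := exists_pow_bounds hb hx
  have hx0 : 0 < x := by linarith
  have hX : ((⌊x ^ ((1 : ℝ) / 5 - ε)⌋₊ : ℕ) : ℝ) ≤ (b : ℝ) ^ (κ * N + 1) := by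
    calc ((⌊x ^ ((1 : ℝ) / 5 - ε)⌋₊ : ℕ) : ℝ) ≤ x ^ ((1 : ℝ) / 5 - ε) :=
          Nat.floor_le (by positivity)
      _ ≤ x ^ (κ / 2) := Real.rpow_le_rpow_of_exponent_le hx hκε
      _ ≤ ((b : ℝ) ^ (2 * N + 2)) ^ (κ / 2) :=
          Real.rpow_le_rpow hx0.le hN2.le (by positivity)
      _ = (b : ℝ) ^ (κ * N + κ) := by
          rw [← Real.rpow_natCast, ← Real.rpow_mul (by linarith)]
          congr 1
          push_cast
          ring
      _ ≤ _ := Real.rpow_le_rpow_of_exponent_le hb1.le (by linarith)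
  refine (h N x _ hN2 hX).trans ?_
  have hsqrt : σ / a * Real.sqrt (Real.log x) ≤ σ * Real.sqrt N + σ := by
    have h1 : Real.log x ≤ 2 * Real.log b * (N + 1) := by
      calc Real.log x ≤ Real.log ((b : ℝ) ^ (2 * N + 2)) := Real.log_le_log hx0 hN2.le
        _ = _ := by
          rw [Real.log_pow]
          push_cast
          ring
    have h2 : Real.sqrt (Real.log x) ≤ a * Real.sqrt (N + 1) := by
      rw [ha, ← Real.sqrt_mul (by positivity)]
      exact Real.sqrt_le_sqrt h1
    have h3 : Real.sqrt ((N : ℝ) + 1) ≤ Real.sqrt N + 1 := by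
      rw [Real.sqrt_le_left (by positivity)]
      have := Real.sq_sqrt (Nat.cast_nonneg (α := ℝ) N)
      nlinarith [Real.sqrt_nonneg (N : ℝ)]
    calc σ / a * Real.sqrt (Real.log x) ≤ σ / a * (a * (Real.sqrt N + 1)) := by
          gcongr
          exact h2.trans (by gcongr)
      _ = _ := by field_simp
  have hcard := pow_le_card_coprimePalindromesUpTo hb hN1
  have hexp : Real.exp (-(σ * Real.sqrt N))
      ≤ Real.exp σ / Real.exp (σ / a * Real.sqrt (Real.log x)) := by
    rw [← Real.exp_sub]
    apply Real.exp_le_exp.2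
    linarith
  calc C * (b ^ N * Real.exp (-(σ * Real.sqrt N)))
      ≤ C * ((b ^ 4 * ((coprimePalindromesUpTo b x).card : ℝ)) *
        (Real.exp σ / Real.exp (σ / a * Real.sqrt (Real.log x)))) := by gcongr
    _ = _ := by ring
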